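/- **Setting.** Let $\mathcal S,\mathcal A$ be finite or countable, $P(\cdot\mid s,a)$ a transition kernel, $r:\mathcal S\times\mathcal A\to[0,1]$ a reward, $\gamma\in[0,1)$ a discount factor, $\pi$ a policy, and $\mu$ a stationary distribution of the induced transition matrix $P(s'\mid s)=\mathbb E_{a\sim\pi(\cdot\mid s)}P(s'\mid s,a)$. Let $\phi:\mathcal S\to\mathbb R^d$ satisfy $\|\phi(s)\|_2\le 1$ for all $s$, and let $\Sigma=\mathbb E_{s\sim\mu}[\phi(s)\phi(s)^\top]$ be positive definite. Let $(s_t,a_t,s_t')_{t\ge1}$ be i.i.d. with $s_t\sim\mu$, $a_t\sim\pi(\cdot\mid s_t)$, $s_t'\sim P(\cdot\mid s_t,a_t)$, and put $$A_t=\phi(s_t)(\phi(s_t)-\gamma\phi(s_t'))^\top,\quad b_t=r(s_t,a_t)\phi(s_t),\quad A=\mathbb E[A_t],\quad b=\mathbb E[b_t],\quad \theta^\star=A^{-1}b,$$ $$\Gamma=\mathbb E[(A_t\theta^\star-b_t)(A_t\theta^\star-b_t)^\top],\qquad \Lambda^\star=A^{-1}\Gamma A^{-\top}.$$ For a deterministic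 $\theta_0\in\mathbb R^d$, TD learning with step sizes $\eta_t=\eta_0t^{-\alpha}$ is $\theta_t=\theta_{t-1}-\eta_t(A_t\theta_{t-1}-b_t)$, $t\ge 1$; write $\bar\Delta_T=\frac1T\sum_{t=1}^T\theta_t-\theta^\star$. **Theorem.** There is an absolute constant $C>0$ such that, for every such problem $(P,r,\gamma,\pi,\mu,\phi,\theta_0)$ and every $\alpha\in(1/2,1)$, there are constants $c,K>0$, depending only on the problem and on $\alpha$ (not on $\delta,\eta_0,T$), with the following properties. (i) For every $\delta\in(0,1)$ there is $\eta_0\in(0,1/2)$ with $$\eta_0\sqrt{\log\frac1{\delta\eta_0}}\le c.\qquad(*)$$ (ii) For all $\delta\in(0,1)$, all $\eta_0\in(0,1/2)$ satisfying $(*)$ and all integers $T\ge1$, with probability at least $1-\delta$, $$\|\bar\Delta_T\|_2\le C\sqrt{\frac{\mathrm{Tr}(\Lambda^\star)}{T}\log\frac e\delta}+\tilde C\,T^{-\frac{\alpha+1}2}\log\frac{eT}\delta,\qquad \tilde C=K\,\eta_0^{-\frac1{1-\alpha}}.$$ -/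

import Mathlib

open MeasureTheory ProbabilityTheory
open scoped Matrix

/-- A discounted Markov decision process with state space `S` and action space `A`. -/
structure MDP (S A : Type*) where
  /-- `P s a` is the law of the next state after playing action `a` in state `s`. -/
  P : S → A → PMF S
  /-- The reward of action `a` in state `s`. -/
  r : S → A → ℝ
  /-- The discount factor. -/
  γ : ℝ
  r_nonneg : ∀ s a, 0 ≤ r s a
  r_le_one : ∀ s a, r s a ≤ 1
  γ_nonneg : 0 ≤ γ
  γ_lt_one : γ < 1

namespace MDP

variable {S A : Type*} (M : MDP S A)

/-- The transition matrix of the state process induced by the policy `π`: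
`P(s' | s) = E_{a ∼ π(· | s)} P(s' | s, a)`. -/
noncomputable def transition (π : S → PMF A) (s : S) : PMF S :=
  (π s).bind (M.P s)

/-- `μ` is a stationary distribution of the transition matrix induced by `π`. -/
def IsStationary (π : S → PMF A) (μ : PMF S) : Prop :=
  μ.bind (M.transition π) = μ

/-- The law of one sample `(s, a, s')`: `s ∼ μ`, `a ∼ π(· | s)`, `s' ∼ P(· | s, a)`. -/
noncomputable def sampleLaw (π : S → PMF A) (μ : PMF S) : PMF (S × A × S) :=
  μ.bind fun s => (π s).bind fun a => (M.P s a).map fun s' => (s, a, s')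

variable {d : ℕ} (φ : S → EuclideanSpace ℝ (Fin d))

/-- The matrix `φ(s) (φ(s) - γ φ(s'))ᵀ` of one sample `x = (s, a, s')`. -/
def sampleA (x : S × A × S) : Matrix (Fin d) (Fin d) ℝ :=
  Matrix.of fun i j => φ x.1 i * (φ x.1 j - M.γ * φ x.2.2 j)

/-- The vector `r(s, a) φ(s)` of one sample `x = (s, a, s')`. -/
noncomputable def sampleB (x : S × A × S) : EuclideanSpace ℝ (Fin d) :=
  M.r x.1 x.2.1 • φ x.1

/-- The TD iterates `θ_t = θ_{t-1} - η_t (A_t θ_{t-1} - b_t)`, run with the step sizes `η` and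
the samples `x 1, x 2, …`, and started at `θ₀`. -/
noncomputable def tdIterate (η : ℕ → ℝ) (θ₀ : EuclideanSpace ℝ (Fin d)) (x : ℕ → S × A × S) :
    ℕ → EuclideanSpace ℝ (Fin d)
  | 0 => θ₀
  | t + 1 =>
    tdIterate η θ₀ x t - η (t + 1) •
      (Matrix.toEuclideanLin (M.sampleA φ (x (t + 1))) (tdIterate η θ₀ x t)
        - M.sampleB φ (x (t + 1)))

/-- The Polyak-Ruppert average `(θ_1 + ⋯ + θ_T) / T` of the TD iterates. -/
noncomputable def tdAverage (η : ℕ → ℝ) (θ₀ : EuclideanSpace ℝ (Fin d)) (x : ℕ → S × A × S)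
    (T : ℕ) : EuclideanSpace ℝ (Fin d) :=
  (1 / (T : ℝ)) • ∑ t ∈ Finset.Icc 1 T, M.tdIterate φ η θ₀ x t

variable [MeasurableSpace S] [MeasurableSpace A]

/-- The feature covariance matrix `Σ = E_{s ∼ μ} [φ(s) φ(s)ᵀ]`. -/
noncomputable def featureCov (μ : PMF S) (φ : S → EuclideanSpace ℝ (Fin d)) :
    Matrix (Fin d) (Fin d) ℝ :=
  Matrix.of fun i j => ∫ s, φ s i * φ s j ∂μ.toMeasure

/-- The matrix `A = E [φ(s) (φ(s) - γ φ(s'))ᵀ]`. -/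
noncomputable def meanA (π : S → PMF A) (μ : PMF S) : Matrix (Fin d) (Fin d) ℝ :=
  Matrix.of fun i j => ∫ x, M.sampleA φ x i j ∂(M.sampleLaw π μ).toMeasure

/-- The vector `b = E [r(s, a) φ(s)]`. -/
noncomputable def meanB (π : S → PMF A) (μ : PMF S) : EuclideanSpace ℝ (Fin d) :=
  ∫ x, M.sampleB φ x ∂(M.sampleLaw π μ).toMeasure

/-- The target `θ⋆ = A⁻¹ b`. -/
noncomputable def thetaStar (π : S → PMF A) (μ : PMF S) : EuclideanSpace ℝ (Fin d) :=
  Matrix.toEuclideanLin (M.meanA φ π μ)⁻¹ (M.meanB φ π μ)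

/-- The noise `A_t θ⋆ - b_t` at the target, as a function of the sample `x`. -/
noncomputable def noise (π : S → PMF A) (μ : PMF S) (x : S × A × S) :
    EuclideanSpace ℝ (Fin d) :=
  Matrix.toEuclideanLin (M.sampleA φ x) (M.thetaStar φ π μ) - M.sampleB φ x

/-- The noise covariance `Γ = E [(A_t θ⋆ - b_t) (A_t θ⋆ - b_t)ᵀ]`. -/
noncomputable def noiseCov (π : S → PMF A) (μ : PMF S) : Matrix (Fin d) (Fin d) ℝ :=
  Matrix.of fun i j =>
    ∫ x, M.noise φ π μ x i * M.noise φ π μ x j ∂(M.sampleLaw π μ).toMeasure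

/-- The asymptotic covariance `Λ⋆ = A⁻¹ Γ A⁻ᵀ`. -/
noncomputable def asympCov (π : S → PMF A) (μ : PMF S) : Matrix (Fin d) (Fin d) ℝ :=
  (M.meanA φ π μ)⁻¹ * M.noiseCov φ π μ * ((M.meanA φ π μ)⁻¹)ᵀ

end MDP

/-! Subtracting `θ⋆` turns TD into `Δ_t = Δ_{t-1} - η_t (A_t Δ_{t-1} + ξ_t)` with `‖A_t‖ ≤ 2`,
bounded centred `ξ_t` and, by stationarity of `μ`, a coercive mean `A` (`MDP.inner_meanA_ge`).
Everything probabilistic is proved for such a `LinearSA`. Solving the recursion for `A Δ_{t-1}` and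
summing by parts (`LinearSA.sum_err_eq`) writes `∑ Δ_t` through `A⁻¹ ∑ ξ_t`, the martingale `A⁻¹ ∑
(A_t - A) Δ_{t-1}`, and boundary and drift terms of size `‖Δ_t‖ / η_t`. A dimension-free Bernstein
inequality (`measure_norm_sum_martingaleDiff_le`) turns the first sum into the leading term; the
rest needs bounds on `Δ_t` along the whole trajectory.

These come in two stages. In `LinearSA.measure_growth_le`, the power `(‖Δ_t‖² + κ)^θ` with `θ` of
order `log (1/δ)` is a supermartingale up to a factor governed by `η_t²`. Since `α > 1/2`, `∑ η_t²`
is of order `η₀²`, and `(*)` bounds `η₀² log (1/δ)`; so the iterates stay in a ball whose radius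
does not depend on `δ`. Inside this ball, `LinearSA.lintegral_confined_exp_le` controls the moment
of `exp (c ‖Δ_t‖² / η_t)` after a transient of length `n₀ ∼ η₀^(-1/(1-α))`. Hence `‖Δ_t‖² ≲ η_t log
(T/δ) + (n₀/t)²`. The length `n₀` is the source of the power of `η₀` in the second term.

One obstacle remains: the boundary term is of order `T^(α/2)`, more than the permitted
`T^((1-α)/2)`, but less than `√T`. If `Tr Λ⋆ > 0`, then for large `T` it is absorbed by the leading
term, and for small `T` it is paid for by powers of `1/η₀` (`exists_absorb`); thus `K` depends on
`Tr Λ⋆`. If `Tr Λ⋆ = 0`, the noise vanishes almost surely, the error decays exponentially in `∑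
η_t`, and the sum of errors is bounded uniformly in `T`. -/

open scoped ENNReal RealInnerProductSpace

universe w

/-! ### Sums of powers. -/

/-- Partial sums of `t ^ (-s)` for `0 ≤ s < 1`. -/
lemma sum_Icc_rpow_neg_le {s : ℝ} (hs0 : 0 ≤ s) (hs1 : s < 1) (T : ℕ) :
    ∑ t ∈ Finset.Icc 1 T, (t : ℝ) ^ (-s) ≤ (T : ℝ) ^ (1 - s) / (1 - s) := by
  have h1 : 0 < 1 - s := by linarith
  rw [le_div_iff₀ h1]
  induction T with
  | zero => simp; rw [Real.zero_rpow h1.ne']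
  | succ n ih =>
    rw [Finset.sum_Icc_succ_top (by omega), add_mul]
    have hp : (0 : ℝ) < n + 1 := by positivity
    have key := rpow_one_add_le_one_add_mul_self (s := -(1 / ((n : ℝ) + 1))) (p := 1 - s)
      (by rw [neg_le_neg_iff, div_le_one hp]; linarith [(Nat.cast_nonneg n : (0 : ℝ) ≤ n)])
      h1.le (by linarith)
    have e1 : (1 : ℝ) + -(1 / ((n : ℝ) + 1)) = n / (n + 1) := by field_simp; ring
    rw [e1, Real.div_rpow (by positivity) hp.le] at key
    have e2 : ((n : ℝ) + 1) ^ (-s) = ((n : ℝ) + 1) ^ (1 - s) / (n + 1) := by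
      rw [show -s = (1 - s) - 1 by ring, Real.rpow_sub_one hp.ne']
    have hpos : 0 < ((n : ℝ) + 1) ^ (1 - s) := by positivity
    rw [div_le_iff₀ hpos] at key
    push_cast
    rw [e2]
    calc _ ≤ (n : ℝ) ^ (1 - s) + ((n : ℝ) + 1) ^ (1 - s) / (n + 1) * (1 - s) := by gcongr
      _ ≤ (1 + (1 - s) * -(1 / ((n : ℝ) + 1))) * ((n : ℝ) + 1) ^ (1 - s)
          + ((n : ℝ) + 1) ^ (1 - s) / (n + 1) * (1 - s) := by gcongr
      _ = _ := by field_simp; ring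

/-- A discrete form of comparing the sum with the integral of `x ^ (-s)`: it makes the tail sum
telescope. -/
lemma rpow_neg_le_sub_rpow {s : ℝ} (hs : 1 < s) {n : ℕ} (hn : 1 ≤ n) :
    (s - 1) * ((n : ℝ) + 1) ^ (-s) ≤ (n : ℝ) ^ (1 - s) - ((n : ℝ) + 1) ^ (1 - s) := by
  have hn0 : (0 : ℝ) < n := by exact_mod_cast hn
  have hp : (0 : ℝ) < n + 1 := by positivity
  have hu : 1 + (s - 1) * (1 / ((n : ℝ) + 1)) ≤ ((n : ℝ) / (n + 1)) ^ (1 - s) := by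
    rw [Real.rpow_def_of_pos (by positivity)]
    have hl := Real.log_le_sub_one_of_pos (show (0 : ℝ) < n / (n + 1) by positivity)
    have e : (n : ℝ) / (n + 1) - 1 = -(1 / ((n : ℝ) + 1)) := by field_simp; ring
    rw [e] at hl
    nlinarith [Real.add_one_le_exp (Real.log ((n : ℝ) / (n + 1)) * (1 - s))]
  have e2 : ((n : ℝ) + 1) ^ (-s) = ((n : ℝ) + 1) ^ (1 - s) / (n + 1) := by
    rw [show -s = (1 - s) - 1 by ring, Real.rpow_sub_one hp.ne']
  rw [Real.div_rpow hn0.le hp.le, le_div_iff₀ (by positivity)] at hu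
  rw [e2]
  calc _ = (1 + (s - 1) * (1 / ((n : ℝ) + 1))) * ((n : ℝ) + 1) ^ (1 - s)
        - ((n : ℝ) + 1) ^ (1 - s) := by field_simp; ring
    _ ≤ _ := by linarith

/-- Tails of `∑ t ^ (-s)` for `s > 1`. -/
lemma sum_Ioc_rpow_neg_le {s : ℝ} (hs : 1 < s) {n : ℕ} (hn : 1 ≤ n) (T : ℕ) :
    ∑ t ∈ Finset.Ioc n T, (t : ℝ) ^ (-s) ≤ (n : ℝ) ^ (1 - s) / (s - 1) := by
  have h1 : 0 < s - 1 := by linarith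
  have hn0 : (0 : ℝ) < n := by exact_mod_cast hn
  rcases le_total T n with h | h
  · rw [Finset.Ioc_eq_empty_of_le h]; simp; positivity
  · suffices hh : (∑ t ∈ Finset.Ioc n T, (t : ℝ) ^ (-s)) * (s - 1)
        ≤ (n : ℝ) ^ (1 - s) - (T : ℝ) ^ (1 - s) by
      rw [le_div_iff₀ h1]
      have : (0 : ℝ) ≤ (T : ℝ) ^ (1 - s) := by positivity
      linarith
    induction T, h using Nat.le_induction with
    | base => simp
    | succ m hm ih =>
      rw [Finset.sum_Ioc_succ_top (by omega), add_mul]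
      have := rpow_neg_le_sub_rpow hs (n := m) (by omega)
      push_cast
      linarith

/-- Partial sums of `t ^ (-s)` for `s > 1`. -/
lemma sum_Icc_rpow_neg_le_of_one_lt {s : ℝ} (hs : 1 < s) (T : ℕ) :
    ∑ t ∈ Finset.Icc 1 T, (t : ℝ) ^ (-s) ≤ 1 + 1 / (s - 1) := by
  have h1 : 0 < s - 1 := by linarith
  rcases Nat.eq_zero_or_pos T with rfl | h
  · simp; positivity
  · rw [← Finset.add_sum_Ioc_eq_sum_Icc h]
    have := sum_Ioc_rpow_neg_le hs le_rfl T
    simp at this ⊢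
    simpa using this

/-! ### Functions of the sample history and a maximal inequality. -/

section History

variable {E : Type*}

lemma DependsOn.exists_eq_comp_restrict [Nonempty E] {β : Type*} {t : ℕ} {f : (ℕ → E) → β}
    (hf : DependsOn f (Set.Iic t)) :
    ∃ g : (Finset.Iic t → E) → β, ∀ x, f x = g fun i => x i := by
  classical
  refine ⟨fun r => f fun i => if h : i ∈ Finset.Iic t then r ⟨i, h⟩ else Classical.arbitrary E,
    fun x => hf fun i hi => ?_⟩
  have : i ∈ Finset.Iic t := by simpa using hi
  simp [this]

/-- The process `M`, frozen as soon as it reaches the level `a`. -/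
noncomputable def frozenAt (M : ℕ → (ℕ → E) → ℝ≥0∞) (a : ℝ≥0∞) : ℕ → (ℕ → E) → ℝ≥0∞
  | 0 => M 0
  | t + 1 => open Classical in
      fun x => if ∃ s ≤ t, a ≤ M s x then frozenAt M a t x else M (t + 1) x

lemma le_frozenAt {M : ℕ → (ℕ → E) → ℝ≥0∞} {a : ℝ≥0∞} {x : ℕ → E} :
    ∀ {t : ℕ}, (∃ s ≤ t, a ≤ M s x) → a ≤ frozenAt M a t x
  | 0, ⟨s, hs, h⟩ => by
    obtain rfl : s = 0 := by omega
    simpa [frozenAt] using h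
  | t + 1, ⟨s, hs, h⟩ => by
    by_cases hc : ∃ s ≤ t, a ≤ M s x
    · simpa [frozenAt, hc] using le_frozenAt hc
    · have : s = t + 1 := by
        by_contra hne
        exact hc ⟨s, by omega, h⟩
      subst this
      simpa only [frozenAt, hc, if_false] using h

lemma frozenAt_eq {M : ℕ → (ℕ → E) → ℝ≥0∞} {a : ℝ≥0∞} {x : ℕ → E} :
    ∀ {t : ℕ}, (¬ ∃ s < t, a ≤ M s x) → frozenAt M a t x = M t x
  | 0, _ => rfl
  | t + 1, h => by
    have : ¬ ∃ s ≤ t, a ≤ M s x := fun ⟨s, hs, hh⟩ => h ⟨s, by omega, hh⟩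
    simp only [frozenAt, this, if_false]

lemma dependsOn_frozenAt {M : ℕ → (ℕ → E) → ℝ≥0∞} {a : ℝ≥0∞}
    (hM : ∀ t, DependsOn (M t) (Set.Iic t)) : ∀ t, DependsOn (frozenAt M a t) (Set.Iic t)
  | 0 => hM 0
  | t + 1 => by
    intro x y hxy
    have h1 : ∀ s ≤ t + 1, M s x = M s y := fun s hs =>
      hM s fun i hi => hxy i (le_trans (Set.mem_Iic.1 hi) hs)
    have h2 : frozenAt M a t x = frozenAt M a t y :=
      dependsOn_frozenAt hM t fun i hi => hxy i (le_trans (Set.mem_Iic.1 hi) (by omega))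
    have h3 : (∃ s ≤ t, a ≤ M s x) ↔ (∃ s ≤ t, a ≤ M s y) :=
      exists_congr fun s => and_congr_right fun hs => by rw [h1 s (by omega)]
    simp only [frozenAt, h2, h1 (t + 1) le_rfl, h3]

variable {Ω : Type*} [MeasurableSpace E] [Countable E] [DiscreteMeasurableSpace E]
  [MeasurableSpace Ω] {Pr : Measure Ω} {X : ℕ → Ω → E}

/-- Finitely many coordinates in a countable discrete space form a discrete space again, so every
function of a finite history is measurable. -/
lemma DependsOn.measurable_comp {β : Type*} [MeasurableSpace β] {t : ℕ} {f : (ℕ → E) → β}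
    (hf : DependsOn f (Set.Iic t)) (hX : ∀ t, Measurable (X t)) :
    Measurable fun ω => f fun i => X i ω := by
  rcases isEmpty_or_nonempty Ω with h | ⟨⟨ω₀⟩⟩
  · exact measurable_of_empty _
  have : Nonempty E := ⟨X 0 ω₀⟩
  obtain ⟨g, hg⟩ := hf.exists_eq_comp_restrict
  simp only [hg]
  exact (Measurable.of_discrete (f := g)).comp (measurable_pi_lambda _ fun i => hX i)

/-- The next sample may be integrated out while the history is kept fixed. -/
lemma lintegral_history_succ [IsProbabilityMeasure Pr] {ν : Measure E} [IsProbabilityMeasure ν]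
    (hX : ∀ t, Measurable (X t)) (hind : iIndepFun X Pr) (hlaw : ∀ t, Pr.map (X t) = ν)
    {t : ℕ} {g : (ℕ → E) → E → ℝ≥0∞} (hg : ∀ y, DependsOn (fun x => g x y) (Set.Iic t)) :
    ∫⁻ ω, g (fun i => X i ω) (X (t + 1) ω) ∂Pr
      = ∫⁻ ω, ∫⁻ y, g (fun i => X i ω) y ∂ν ∂Pr := by
  obtain ⟨ω₀⟩ : Nonempty Ω := Pr.nonempty_of_neZero
  have : Nonempty E := ⟨X 0 ω₀⟩
  choose G hG using fun y => (hg y).exists_eq_comp_restrict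
  have hH : Measurable fun ω => fun i : Finset.Iic t => X i ω :=
    measurable_pi_lambda _ fun i => hX i
  have hi : IndepFun (fun ω => fun i : Finset.Iic t => X i ω) (X (t + 1)) Pr := by
    have h := hind.indepFun_finset (Finset.Iic t) {t + 1} (by simp) hX
    exact h.comp measurable_id (measurable_pi_apply (⟨t + 1, by simp⟩ : ({t + 1} : Finset ℕ)))
  have hm := (indepFun_iff_map_prod_eq_prod_map_map hH.aemeasurable (hX (t + 1)).aemeasurable).1 hi
  have hF : Measurable fun p : (Finset.Iic t → E) × E => G p.2 p.1 := Measurable.of_discrete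
  have : IsProbabilityMeasure (Pr.map fun ω => fun i : Finset.Iic t => X i ω) :=
    Measure.isProbabilityMeasure_map hH.aemeasurable
  calc ∫⁻ ω, g (fun i => X i ω) (X (t + 1) ω) ∂Pr
      = ∫⁻ p, G p.2 p.1 ∂(Pr.map fun ω => ((fun i : Finset.Iic t => X i ω), X (t + 1) ω)) := by
        rw [lintegral_map hF (hH.prodMk (hX _))]; simp only [hG]
    _ = ∫⁻ r, ∫⁻ y, G y r ∂ν ∂(Pr.map fun ω => fun i : Finset.Iic t => X i ω) := by
        rw [hm, hlaw, lintegral_prod _ hF.aemeasurable]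
    _ = _ := by
        rw [lintegral_map Measurable.of_discrete hH]; simp only [hG]

/-- One step of every supermartingale argument below: `g x y` is the value at time `t + 1` when the
history is `x` and the new sample is `y`. It replaces conditional expectations. -/
lemma lintegral_history_le [IsProbabilityMeasure Pr] {ν : Measure E} [IsProbabilityMeasure ν]
    (hX : ∀ t, Measurable (X t)) (hind : iIndepFun X Pr) (hlaw : ∀ t, Pr.map (X t) = ν)
    {t : ℕ} {f h : (ℕ → E) → ℝ≥0∞} (g : (ℕ → E) → E → ℝ≥0∞)
    (hg : ∀ y, DependsOn (fun x => g x y) (Set.Iic t))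
    (hfg : ∀ x, f x ≤ g x (x (t + 1))) (hgh : ∀ x, ∫⁻ y, g x y ∂ν ≤ h x) :
    ∫⁻ ω, f (fun i => X i ω) ∂Pr ≤ ∫⁻ ω, h (fun i => X i ω) ∂Pr :=
  calc _ ≤ ∫⁻ ω, g (fun i => X i ω) (X (t + 1) ω) ∂Pr := lintegral_mono fun _ => hfg _
    _ = _ := lintegral_history_succ hX hind hlaw hg
    _ ≤ _ := lintegral_mono fun _ => hgh _

/-- Maximal inequality for nonnegative supermartingales. -/
lemma measure_exists_le_supermartingale [IsProbabilityMeasure Pr] {ν : Measure E}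
    [IsProbabilityMeasure ν]
    (hX : ∀ t, Measurable (X t)) (hind : iIndepFun X Pr) (hlaw : ∀ t, Pr.map (X t) = ν)
    {M : ℕ → (ℕ → E) → ℝ≥0∞} (hM : ∀ t, DependsOn (M t) (Set.Iic t))
    (g : ℕ → (ℕ → E) → E → ℝ≥0∞)
    (hg : ∀ t y, DependsOn (fun x => g t x y) (Set.Iic t))
    (hfg : ∀ t x, M (t + 1) x ≤ g t x (x (t + 1))) (hgh : ∀ t x, ∫⁻ y, g t x y ∂ν ≤ M t x)
    {m : ℝ≥0∞} (h0 : ∀ x, M 0 x ≤ m) (a : ℝ≥0∞) (T : ℕ) :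
    a * Pr {ω | ∃ t ≤ T, a ≤ M t fun i => X i ω} ≤ m := by
  classical
  -- Freezing preserves the supermartingale property, and a path that ever reaches `a` is still at
  -- least `a` at time `T`; Markov's inequality at the single time `T` then suffices.
  have hstep : ∀ t, ∫⁻ ω, frozenAt M a t (fun i => X i ω) ∂Pr ≤ m := by
    intro t
    induction t with
    | zero =>
      calc _ ≤ ∫⁻ _, m ∂Pr := lintegral_mono fun ω => h0 _
        _ = m := by simp
    | succ t ih =>
      refine le_trans (lintegral_history_le hX hind hlaw (t := t)
        (fun x y => if ∃ s ≤ t, a ≤ M s x then frozenAt M a t x else g t x y) ?_ ?_ ?_) ih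
      · intro y x z hxz
        have h1 : ∀ s ≤ t, M s x = M s z := fun s hs =>
          hM s fun i hi => hxz i (le_trans (Set.mem_Iic.1 hi) hs)
        have h3 : (∃ s ≤ t, a ≤ M s x) ↔ (∃ s ≤ t, a ≤ M s z) :=
          exists_congr fun s => and_congr_right fun hs => by rw [h1 s hs]
        have h4 : g t x y = g t z y := hg t y hxz
        simp only [dependsOn_frozenAt hM t hxz, h3, h4]
      · intro x
        simp only [frozenAt]
        split_ifs
        · exact le_rfl
        · exact hfg t x
      · intro x
        by_cases hc : ∃ s ≤ t, a ≤ M s x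
        · simp [hc]
        · simp only [hc, if_false]
          rw [frozenAt_eq fun ⟨s, hs, h⟩ => hc ⟨s, hs.le, h⟩]
          exact hgh t x
  calc a * Pr {ω | ∃ t ≤ T, a ≤ M t fun i => X i ω}
      ≤ a * Pr {ω | a ≤ frozenAt M a T fun i => X i ω} := by
        gcongr
        exact fun hω => le_frozenAt hω
    _ ≤ _ := mul_meas_ge_le_lintegral ((dependsOn_frozenAt hM T).measurable_comp hX) a
    _ ≤ m := hstep T

end History

/-! ### Linear stochastic approximation and uniform-in-time growth. -/

/-- Hoeffding's lemma for a bounded variable whose mean is at most `m`. -/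
lemma lintegral_exp_le_of_abs_le {E : Type*} [MeasurableSpace E] {ν : Measure E}
    [IsProbabilityMeasure ν] {h : E → ℝ} (hm : AEMeasurable h ν) {D m θ : ℝ} (hD : 0 ≤ D)
    (hθ : 0 ≤ θ) (hb : ∀ᵐ y ∂ν, |h y| ≤ D) (hmean : ∫ y, h y ∂ν ≤ m) :
    ∫⁻ y, ENNReal.ofReal (Real.exp (θ * h y)) ∂ν
      ≤ ENNReal.ofReal (Real.exp (θ * m + θ ^ 2 * D ^ 2 / 2)) := by
  have hs := hasSubgaussianMGF_of_mem_Icc (μ := ν) (a := -D) (b := D) hm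
    (by filter_upwards [hb] with y hy; exact abs_le.1 hy)
  have hc : (((‖D - -D‖₊ / 2) ^ 2 : NNReal) : ℝ) = D ^ 2 := by
    push_cast
    rw [Real.norm_of_nonneg (by linarith)]
    ring
  have h1 := hs.mgf_le θ
  rw [hc, mgf] at h1
  have hint := hs.integrable_exp_mul θ
  have e : ∀ y, Real.exp (θ * h y)
      = Real.exp (θ * ∫ y, h y ∂ν) * Real.exp (θ * (h y - ∫ y, h y ∂ν)) := by
    intro y
    rw [← Real.exp_add]
    ring_nf
  simp only [e]
  rw [← ofReal_integral_eq_lintegral_ofReal (hint.const_mul _)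
    (Filter.Eventually.of_forall fun y => by positivity), integral_const_mul]
  refine ENNReal.ofReal_le_ofReal ?_
  calc _ ≤ Real.exp (θ * m) * Real.exp (D ^ 2 * θ ^ 2 / 2) := by gcongr
    _ = _ := by rw [← Real.exp_add]; ring_nf

/-- The error recursion `Δ_t = Δ_{t-1} - η_t (A_t Δ_{t-1} + ξ_t)`. -/
noncomputable def errIterate {E H : Type*} [NormedAddCommGroup H] [NormedSpace ℝ H]
    (A : E → H →L[ℝ] H) (ξ : E → H) (η : ℕ → ℝ) (Δ₀ : H) : ℕ → (ℕ → E) → H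
  | 0 => fun _ => Δ₀
  | t + 1 => fun x => errIterate A ξ η Δ₀ t x
      - η (t + 1) • (A (x (t + 1)) (errIterate A ξ η Δ₀ t x) + ξ (x (t + 1)))

lemma dependsOn_errIterate {E H : Type*} [NormedAddCommGroup H] [NormedSpace ℝ H]
    (A : E → H →L[ℝ] H) (ξ : E → H) (η : ℕ → ℝ) (Δ₀ : H) :
    ∀ t, DependsOn (errIterate A ξ η Δ₀ t) (Set.Iic t)
  | 0 => fun _ _ _ => rfl
  | t + 1 => by
    intro x y hxy
    have h1 : errIterate A ξ η Δ₀ t x = errIterate A ξ η Δ₀ t y :=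
      dependsOn_errIterate A ξ η Δ₀ t fun i hi => hxy i (le_trans (Set.mem_Iic.1 hi) (by omega))
    simp only [errIterate, h1, hxy (t + 1) (Set.mem_Iic.2 le_rfl)]

/-- The data of a linear stochastic approximation scheme with bounded samples and a coercive
mean. -/
structure LinearSA {E : Type*} [MeasurableSpace E] (ν : Measure E) (H : Type*)
    [NormedAddCommGroup H] [InnerProductSpace ℝ H] where
  /-- the random matrix -/
  mat : E → H →L[ℝ] H
  /-- the noise at the target -/
  noise : E → H
  /-- the mean of the random matrix -/
  mean : H →L[ℝ] H
  /-- an inverse of the mean -/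
  inv : H →L[ℝ] H
  /-- a bound for the noise -/
  B : ℝ
  /-- a coercivity constant -/
  β : ℝ
  mat_le : ∀ y, ‖mat y‖ ≤ 2
  noise_le : ∀ y, ‖noise y‖ ≤ B
  B_nonneg : 0 ≤ B
  β_pos : 0 < β
  β_le : β ≤ 1
  integral_mat : ∀ v, ∫ y, mat y v ∂ν = mean v
  integral_noise : ∫ y, noise y ∂ν = 0
  coercive : ∀ v, β * ‖v‖ ^ 2 ≤ ⟪v, mean v⟫
  inv_mean : ∀ v, inv (mean v) = v
  mean_inv : ∀ v, mean (inv v) = v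

namespace LinearSA

variable {E H : Type*} [MeasurableSpace E] [Countable E] [DiscreteMeasurableSpace E]
  {ν : Measure E} [IsProbabilityMeasure ν]
  [NormedAddCommGroup H] [InnerProductSpace ℝ H]

omit [InnerProductSpace ℝ H] in
lemma integrable_of_norm_le {f : E → H} {C : ℝ} (h : ∀ y, ‖f y‖ ≤ C) : Integrable f ν :=
  Integrable.of_bound StronglyMeasurable.of_discrete.aestronglyMeasurable C
    (Filter.Eventually.of_forall h)

variable (P : LinearSA ν H)

/-- The error iterates of the scheme. -/
noncomputable def err (η : ℕ → ℝ) (Δ₀ : H) : ℕ → (ℕ → E) → H := errIterate P.mat P.noise η Δ₀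

omit [Countable E] [DiscreteMeasurableSpace E] [IsProbabilityMeasure ν] in
lemma norm_mat_le (y : E) (v : H) : ‖P.mat y v‖ ≤ 2 * ‖v‖ :=
  (P.mat y).le_of_opNorm_le (P.mat_le y) v

lemma integral_inner [CompleteSpace H] (v : H) :
    ∫ y, ⟪v, P.mat y v + P.noise y⟫ ∂ν = ⟪v, P.mean v⟫ := by
  have h1 : Integrable (fun y => P.mat y v) ν := integrable_of_norm_le fun y => P.norm_mat_le y v
  have h2 : Integrable P.noise ν := integrable_of_norm_le P.noise_le
  have h3 := _root_.integral_inner (𝕜 := ℝ) (h1.add h2) v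
  simp only [Pi.add_apply] at h3
  rw [h3, integral_add h1 h2, P.integral_mat, P.integral_noise, add_zero]

omit [MeasurableSpace E] [Countable E] [DiscreteMeasurableSpace E] in
lemma norm_sub_smul_sq (v w : H) (η : ℝ) :
    ‖v - η • w‖ ^ 2 = ‖v‖ ^ 2 - 2 * η * ⟪v, w⟫ + η ^ 2 * ‖w‖ ^ 2 := by
  rw [norm_sub_sq_real, inner_smul_right, norm_smul, mul_pow, Real.norm_eq_abs, sq_abs]
  ring

/-- Relative to `U = ‖v‖² + κ`, the linear part of the increment is `η h` with `h = -2⟨v, w⟩ / U`,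
which is bounded by `4 + B` whatever the size of `v`; Hoeffding's lemma then applies to the power
`θ`. The parameter `κ` serves two regimes: `κ = 1`, `ρ = 0` for general bounded noise, and `κ = 0`,
`ρ = 2β` for vanishing noise. -/
lemma lintegral_growth_step [CompleteSpace H] {κ ρ η θ : ℝ} (hκ : 0 ≤ κ)
    (hξ : ∀ᵐ y ∂ν, ‖P.noise y‖ ^ 2 ≤ P.B ^ 2 * κ) (v : H)
    (hρ : ρ * (‖v‖ ^ 2 + κ) ≤ 2 * P.β * ‖v‖ ^ 2) (hη : 0 ≤ η) (hθ : 0 < θ) :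
    ∫⁻ y, ENNReal.ofReal ((‖v - η • (P.mat y v + P.noise y)‖ ^ 2 + κ) ^ θ) ∂ν
      ≤ ENNReal.ofReal ((‖v‖ ^ 2 + κ) ^ θ *
          Real.exp (-(θ * ρ * η) + η ^ 2 * (θ * (8 + 2 * P.B ^ 2)
            + θ ^ 2 * (4 + P.B) ^ 2 / 2))) := by
  have hB := P.B_nonneg
  have hU0 : 0 ≤ ‖v‖ ^ 2 + κ := by positivity
  -- If `U = 0`, then `κ = 0` and `v = 0`, and the noise vanishes almost surely, so the iterate
  -- stays at `0`.
  rcases hU0.eq_or_lt with hU | hU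
  · have hv : v = 0 := by
      have : ‖v‖ ^ 2 = 0 := by nlinarith [sq_nonneg ‖v‖]
      simpa using this
    have hk : κ = 0 := by nlinarith [sq_nonneg ‖v‖]
    have : ∫⁻ y, ENNReal.ofReal ((‖v - η • (P.mat y v + P.noise y)‖ ^ 2 + κ) ^ θ) ∂ν
        = ∫⁻ y, 0 ∂ν := by
      refine lintegral_congr_ae ?_
      filter_upwards [hξ] with y hy
      have : P.noise y = 0 := by
        have : ‖P.noise y‖ ^ 2 = 0 := le_antisymm (by simpa [hk] using hy) (sq_nonneg _)
        simpa using this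
      simp [hv, hk, this, Real.zero_rpow hθ.ne']
    rw [this]
    simp
  set U := ‖v‖ ^ 2 + κ with hUdef
  set w : E → H := fun y => P.mat y v + P.noise y with hw
  set h : E → ℝ := fun y => -2 / U * ⟪v, w y⟫ with hh
  have hwb : ∀ᵐ y ∂ν, ‖w y‖ ≤ 2 * ‖v‖ + P.B * √κ := by
    filter_upwards [hξ] with y hy
    have : ‖P.noise y‖ ≤ P.B * √κ := by
      refine abs_le_of_sq_le_sq' ?_ (by positivity) |>.2
      rw [mul_pow, Real.sq_sqrt hκ]
      exact hy
    calc _ ≤ ‖P.mat y v‖ + ‖P.noise y‖ := norm_add_le _ _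
      _ ≤ _ := add_le_add (P.norm_mat_le y v) this
  have hk2 : √κ ^ 2 = κ := Real.sq_sqrt hκ
  have hhb : ∀ᵐ y ∂ν, |h y| ≤ 4 + P.B := by
    filter_upwards [hwb] with y hy
    rw [hh, abs_mul, abs_div, abs_of_pos hU, div_mul_eq_mul_div, div_le_iff₀ hU]
    have h1 := abs_real_inner_le_norm v (w y)
    have h2 : ‖v‖ * ‖w y‖ ≤ ‖v‖ * (2 * ‖v‖ + P.B * √κ) := by gcongr
    have h3 : 2 * (‖v‖ * √κ) ≤ U := by nlinarith [sq_nonneg (‖v‖ - √κ)]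
    have h4 : ‖v‖ ^ 2 ≤ U := by linarith
    norm_num
    nlinarith [mul_le_mul_of_nonneg_left h3 hB]
  have hmean : ∫ y, h y ∂ν ≤ -ρ := by
    rw [hh, integral_const_mul, P.integral_inner, div_mul_eq_mul_div, div_le_iff₀ hU]
    nlinarith [P.coercive v]
  have hH := lintegral_exp_le_of_abs_le (ν := ν) (h := h) (θ := θ * η)
    Measurable.of_discrete.aemeasurable (by positivity : 0 ≤ 4 + P.B) (by positivity) hhb hmean
  calc _ ≤ ∫⁻ y, ENNReal.ofReal (U ^ θ * Real.exp (θ * η ^ 2 * (8 + 2 * P.B ^ 2)))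
        * ENNReal.ofReal (Real.exp (θ * η * h y)) ∂ν := by
        refine lintegral_mono_ae ?_
        filter_upwards [hwb] with y hy
        rw [← ENNReal.ofReal_mul (by positivity)]
        refine ENNReal.ofReal_le_ofReal ?_
        have hw2 : ‖w y‖ ^ 2 ≤ (8 + 2 * P.B ^ 2) * U := by
          have : ‖w y‖ ^ 2 ≤ (2 * ‖v‖ + P.B * √κ) ^ 2 := by gcongr
          nlinarith [sq_nonneg (2 * ‖v‖ - P.B * √κ), mul_nonneg (sq_nonneg P.B) (sq_nonneg ‖v‖)]
        have e1 : ‖v - η • (P.mat y v + P.noise y)‖ ^ 2 + κ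
            ≤ U * Real.exp (η * h y + η ^ 2 * (8 + 2 * P.B ^ 2)) := by
          rw [norm_sub_smul_sq]
          have e2 : U * (η * h y) = - 2 * η * ⟪v, w y⟫ := by rw [hh]; field_simp
          have e3 := mul_le_mul_of_nonneg_left
            (Real.add_one_le_exp (η * h y + η ^ 2 * (8 + 2 * P.B ^ 2))) hU.le
          nlinarith [mul_le_mul_of_nonneg_left hw2 (sq_nonneg η)]
        calc _ ≤ (U * Real.exp (η * h y + η ^ 2 * (8 + 2 * P.B ^ 2))) ^ θ := by gcongr
          _ = _ := by
            rw [Real.mul_rpow hU.le (by positivity), ← Real.exp_mul, mul_assoc, ← Real.exp_add]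
            ring_nf
    _ ≤ _ := by
        rw [lintegral_const_mul _ Measurable.of_discrete]
        refine (mul_le_mul_right hH _).trans ?_
        rw [← ENNReal.ofReal_mul (by positivity), mul_assoc, ← Real.exp_add]
        refine le_of_eq ?_
        ring_nf

variable {Ω : Type*} [MeasurableSpace Ω] {Pr : Measure Ω} [IsProbabilityMeasure Pr]
  {X : ℕ → Ω → E}

/-- Uniform-in-time growth bound: with probability at least `1 - exp (-θ)` the potential
`‖Δ_t‖² + κ` decays like `exp (-ρ (η_1 + ⋯ + η_t))` up to a constant factor. -/
lemma measure_growth_le [CompleteSpace H] (hX : ∀ t, Measurable (X t)) (hind : iIndepFun X Pr)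
    (hlaw : ∀ t, Pr.map (X t) = ν) {κ ρ θ S U₀ : ℝ} (hκ : 0 ≤ κ)
    (hξ : ∀ᵐ y ∂ν, ‖P.noise y‖ ^ 2 ≤ P.B ^ 2 * κ)
    (hρ : ∀ v : H, ρ * (‖v‖ ^ 2 + κ) ≤ 2 * P.β * ‖v‖ ^ 2) (hθ : 0 < θ)
    {η : ℕ → ℝ} (hη : ∀ t, 0 ≤ η t) (hS : ∀ t, ∑ i ∈ Finset.Icc 1 t, η i ^ 2 ≤ S)
    {Δ₀ : H} (hU₀ : 0 < U₀) (hΔ₀ : ‖Δ₀‖ ^ 2 + κ ≤ U₀) (T : ℕ) :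
    Pr {ω | ∃ t ≤ T, U₀ * Real.exp (1 + S * ((8 + 2 * P.B ^ 2) + θ * (4 + P.B) ^ 2 / 2)
        - ρ * ∑ i ∈ Finset.Icc 1 t, η i) ≤ ‖P.err η Δ₀ t fun i => X i ω‖ ^ 2 + κ}
      ≤ ENNReal.ofReal (Real.exp (-θ)) := by
  have hB := P.B_nonneg
  set L := θ * (8 + 2 * P.B ^ 2) + θ ^ 2 * (4 + P.B) ^ 2 / 2 with hL
  have hL0 : 0 ≤ L := by positivity
  set D : ℕ → ℝ := fun t => θ * ρ * ∑ i ∈ Finset.Icc 1 t, η i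
    - (∑ i ∈ Finset.Icc 1 t, η i ^ 2) * L with hD
  have hdep := dependsOn_errIterate P.mat P.noise η Δ₀
  have key := measure_exists_le_supermartingale hX hind hlaw
    (M := fun t x => ENNReal.ofReal ((‖P.err η Δ₀ t x‖ ^ 2 + κ) ^ θ * Real.exp (D t)))
    (fun t x y hxy => by simp only [err, hdep t hxy])
    (fun t x y => ENNReal.ofReal ((‖P.err η Δ₀ t x - η (t + 1) • (P.mat y (P.err η Δ₀ t x)
      + P.noise y)‖ ^ 2 + κ) ^ θ * Real.exp (D (t + 1))))
    (fun t y x z hxz => by simp only [err, hdep t hxz])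
    (fun t x => le_rfl)
    (fun t x => by
      simp only [ENNReal.ofReal_mul' (Real.exp_nonneg (D (t + 1)))]
      rw [lintegral_mul_const _ Measurable.of_discrete]
      refine (mul_le_mul_left (P.lintegral_growth_step hκ hξ (P.err η Δ₀ t x)
        (hρ _) (hη (t + 1)) hθ) _).trans ?_
      rw [← ENNReal.ofReal_mul (by positivity), mul_assoc, ← Real.exp_add]
      refine le_of_eq ?_
      congr 3
      simp only [hD, Finset.sum_Icc_succ_top (Nat.le_add_left 1 t), hL]
      ring)
    (m := ENNReal.ofReal (U₀ ^ θ))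
    (fun x => by
      refine ENNReal.ofReal_le_ofReal ?_
      simp only [hD, err, errIterate]
      simp
      gcongr)
    -- The level exceeds the initial value by the factor `exp θ`, which gives probability `exp
    -- (-θ)`; after the `θ`-th root this costs only the factor `exp 1`.
    (ENNReal.ofReal (U₀ ^ θ * Real.exp θ)) T
  have hsub : Pr {ω | ∃ t ≤ T, U₀ * Real.exp (1 + S * ((8 + 2 * P.B ^ 2)
      + θ * (4 + P.B) ^ 2 / 2) - ρ * ∑ i ∈ Finset.Icc 1 t, η i)
      ≤ ‖P.err η Δ₀ t fun i => X i ω‖ ^ 2 + κ}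
      ≤ Pr {ω | ∃ t ≤ T, ENNReal.ofReal (U₀ ^ θ * Real.exp θ) ≤ ENNReal.ofReal
        ((‖P.err η Δ₀ t fun i => X i ω‖ ^ 2 + κ) ^ θ * Real.exp (D t))} := by
    refine measure_mono ?_
    rintro ω ⟨t, ht, h⟩
    refine ⟨t, ht, ENNReal.ofReal_le_ofReal ?_⟩
    have h1 := Real.rpow_le_rpow (by positivity) h hθ.le
    rw [Real.mul_rpow hU₀.le (by positivity), ← Real.exp_mul] at h1
    calc _ ≤ U₀ ^ θ * Real.exp ((1 + S * ((8 + 2 * P.B ^ 2)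
        + θ * (4 + P.B) ^ 2 / 2) - ρ * ∑ i ∈ Finset.Icc 1 t, η i) * θ) * Real.exp (D t) := by
          rw [mul_assoc, ← Real.exp_add]
          gcongr
          simp only [hD]
          have := mul_le_mul_of_nonneg_right (hS t) hL0
          have e : S * L = S * ((8 + 2 * P.B ^ 2) + θ * (4 + P.B) ^ 2 / 2) * θ := by
            rw [hL]; ring
          nlinarith
      _ ≤ _ := by gcongr
  refine hsub.trans ?_
  rw [← ENNReal.mul_le_mul_iff_right (a := ENNReal.ofReal (U₀ ^ θ * Real.exp θ))
    (by simpa using by positivity) ENNReal.ofReal_ne_top]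
  refine key.trans (le_of_eq ?_)
  rw [← ENNReal.ofReal_mul (by positivity), mul_assoc, ← Real.exp_add]
  simp

end LinearSA

/-! ### Exponential moments of the squared error after the transient. -/

/-- Jensen's inequality for a concave power, obtained from Hölder against the constant `1`. -/
lemma lintegral_rpow_le_rpow_lintegral {Ω : Type*} [MeasurableSpace Ω] {Pr : Measure Ω}
    [IsProbabilityMeasure Pr] {f : Ω → ℝ≥0∞} (hf : AEMeasurable f Pr) {p : ℝ} (hp0 : 0 < p)
    (hp1 : p < 1) : ∫⁻ ω, f ω ^ p ∂Pr ≤ (∫⁻ ω, f ω ∂Pr) ^ p := by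
  have hpq : (1 / p).HolderConjugate (1 / (1 - p)) := by
    have := Real.HolderConjugate.inv_one_sub_inv hp0 hp1
    simpa using this
  have h := ENNReal.lintegral_mul_le_Lp_mul_Lq Pr hpq (hf.pow_const p)
    (aemeasurable_const (b := (1 : ℝ≥0∞)))
  simpa [← ENNReal.rpow_mul, hp0.ne'] using h

namespace LinearSA

variable {E H : Type*} [MeasurableSpace E] [Countable E] [DiscreteMeasurableSpace E]
  {ν : Measure E} [IsProbabilityMeasure ν]
  [NormedAddCommGroup H] [InnerProductSpace ℝ H] (P : LinearSA ν H)

/-- Scaling the exponent by `1/η` makes the cross term `-2c⟨v, w⟩` free of `η`. Its mean contributes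
`-2cβ‖v‖²`, and its Hoeffding correction `2c²Q²‖v‖²` is at most `cβ‖v‖²` by the choice of `c`; half
of the contraction survives. -/
lemma lintegral_exp_sq_step [CompleteSpace H] {R c η : ℝ} (hR : 0 ≤ R) (hc : 0 ≤ c)
    (hcQ : c * (2 * R + P.B) ^ 2 ≤ P.β / 2) (hη : 0 < η) {v : H} (hv : ‖v‖ ≤ R) :
    ∫⁻ y, ENNReal.ofReal (Real.exp (c / η * ‖v - η • (P.mat y v + P.noise y)‖ ^ 2)) ∂ν
      ≤ ENNReal.ofReal (Real.exp (c / η * (1 - P.β * η) * ‖v‖ ^ 2 + P.β / 2 * η)) := by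
  have hB := P.B_nonneg
  set Q := 2 * R + P.B with hQ
  set w : E → H := fun y => P.mat y v + P.noise y with hw
  have hQ0 : 0 ≤ Q := by positivity
  have hwb : ∀ y, ‖w y‖ ≤ Q := fun y => by
    calc _ ≤ ‖P.mat y v‖ + ‖P.noise y‖ := norm_add_le _ _
      _ ≤ 2 * ‖v‖ + P.B := add_le_add (P.norm_mat_le y v) (P.noise_le y)
      _ ≤ _ := by linarith
  have hH := lintegral_exp_le_of_abs_le (ν := ν) (h := fun y => -2 * ⟪v, w y⟫) (θ := c)
    (D := 2 * ‖v‖ * Q) (m := -2 * P.β * ‖v‖ ^ 2) Measurable.of_discrete.aemeasurable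
    (by positivity) hc
    (Filter.Eventually.of_forall fun y => by
      rw [abs_mul]
      norm_num
      calc _ ≤ 2 * (‖v‖ * ‖w y‖) := by gcongr; exact abs_real_inner_le_norm v (w y)
        _ ≤ _ := by rw [mul_assoc]; gcongr; exact hwb y)
    (by
      rw [integral_const_mul, P.integral_inner]
      nlinarith [P.coercive v])
  calc _ ≤ ∫⁻ y, ENNReal.ofReal (Real.exp (c / η * ‖v‖ ^ 2 + P.β / 2 * η))
        * ENNReal.ofReal (Real.exp (c * (-2 * ⟪v, w y⟫))) ∂ν := by
        refine lintegral_mono fun y => ?_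
        rw [← ENNReal.ofReal_mul (by positivity), ← Real.exp_add]
        refine ENNReal.ofReal_le_ofReal (Real.exp_le_exp.2 ?_)
        rw [norm_sub_smul_sq]
        have h1 : c * ‖w y‖ ^ 2 ≤ P.β / 2 :=
          (mul_le_mul_of_nonneg_left (pow_le_pow_left₀ (norm_nonneg _) (hwb y) 2) hc).trans hcQ
        have h2 : c / η * (‖v‖ ^ 2 - 2 * η * ⟪v, w y⟫ + η ^ 2 * ‖w y‖ ^ 2)
            = c / η * ‖v‖ ^ 2 + c * (-2 * ⟪v, w y⟫) + η * (c * ‖w y‖ ^ 2) := by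
          field_simp
          ring
        rw [h2]
        nlinarith [mul_le_mul_of_nonneg_left h1 hη.le]
    _ ≤ _ := by
        rw [lintegral_const_mul _ Measurable.of_discrete]
        refine (mul_le_mul_right hH _).trans ?_
        rw [← ENNReal.ofReal_mul (by positivity), ← Real.exp_add]
        refine ENNReal.ofReal_le_ofReal (Real.exp_le_exp.2 ?_)
        have h1 : c / η * (1 - P.β * η) * ‖v‖ ^ 2 = c / η * ‖v‖ ^ 2 - c * P.β * ‖v‖ ^ 2 := by
          field_simp
        rw [h1]
        have h2 := mul_le_mul_of_nonneg_left hcQ (mul_nonneg hc (sq_nonneg ‖v‖))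
        nlinarith

open Classical in
/-- The indicator of the event that the error stays within radius `R` up to time `t`. -/
noncomputable def confined (η : ℕ → ℝ) (Δ₀ : H) (R : ℝ) (t : ℕ) (x : ℕ → E) : ℝ≥0∞ :=
  if ∀ s ≤ t, ‖P.err η Δ₀ s x‖ ≤ R then 1 else 0

omit [Countable E] [DiscreteMeasurableSpace E] [IsProbabilityMeasure ν] in
lemma dependsOn_confined (η : ℕ → ℝ) (Δ₀ : H) (R : ℝ) (t : ℕ) :
    DependsOn (P.confined η Δ₀ R t) (Set.Iic t) := by
  intro x y hxy
  have h : ∀ s ≤ t, P.err η Δ₀ s x = P.err η Δ₀ s y := fun s hs =>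
    dependsOn_errIterate P.mat P.noise η Δ₀ s fun i hi => hxy i (le_trans (Set.mem_Iic.1 hi) hs)
  have h2 : (∀ s ≤ t, ‖P.err η Δ₀ s x‖ ≤ R) ↔ (∀ s ≤ t, ‖P.err η Δ₀ s y‖ ≤ R) :=
    forall_congr' fun s => forall_congr' fun hs => by rw [h s hs]
  simp only [confined, h2]

variable {Ω : Type*} [MeasurableSpace Ω] {Pr : Measure Ω} [IsProbabilityMeasure Pr]
  {X : ℕ → Ω → E}

/-- Half of the remaining contraction pays for the change of scale from `1/η t` to `1/η (t + 1)`.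
The other half leaves a power `p = 1 - (β/2) η (t + 1)`, which Jensen moves outside the integral.
The logarithm of the moment then obeys `a ↦ p a + (1 - p)`: its fixed point is `1`, and the excess
over `1` decays like `1/t²`. -/
lemma lintegral_confined_exp_le [CompleteSpace H] (hX : ∀ t, Measurable (X t))
    (hind : iIndepFun X Pr) (hlaw : ∀ t, Pr.map (X t) = ν) {R c : ℝ} (hR : 0 ≤ R) (hc : 0 ≤ c)
    (hcQ : c * (2 * R + P.B) ^ 2 ≤ P.β / 2) {η : ℕ → ℝ} (hη : ∀ t, 1 ≤ t → 0 < η t)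
    (hη1 : ∀ t, η t ≤ 1) {n₀ : ℕ} (hn₀ : 1 ≤ n₀)
    (hq : ∀ t, n₀ ≤ t → 2 / ((t : ℝ) + 1) ≤ P.β / 2 * η (t + 1))
    (hr : ∀ t, n₀ ≤ t → t * η t ≤ (t + 1) * η (t + 1)) (Δ₀ : H) {t : ℕ} (ht : n₀ ≤ t) :
    ∫⁻ ω, P.confined η Δ₀ R t (fun i => X i ω)
        * ENNReal.ofReal (Real.exp (c / η t * ‖P.err η Δ₀ t fun i => X i ω‖ ^ 2)) ∂Pr
      ≤ ENNReal.ofReal (Real.exp (1 + c / η n₀ * R ^ 2 * (n₀ : ℝ) ^ 2 / (t : ℝ) ^ 2)) := by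
  have hβ := P.β_pos
  have hβ1 := P.β_le
  have hdep := dependsOn_errIterate P.mat P.noise η Δ₀
  induction t, ht using Nat.le_induction with
  | base =>
    have hn : (0 : ℝ) < n₀ := by exact_mod_cast hn₀
    calc _ ≤ ∫⁻ _, ENNReal.ofReal (Real.exp (c / η n₀ * R ^ 2)) ∂Pr := by
          refine lintegral_mono fun ω => ?_
          simp only [confined]
          split_ifs with h
          · have h0 := h n₀ le_rfl
            have := (hη n₀ hn₀).le
            rw [one_mul]
            gcongr
          · simp
      _ ≤ _ := by
          simp only [lintegral_const, measure_univ, mul_one]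
          refine ENNReal.ofReal_le_ofReal (Real.exp_le_exp.2 ?_)
          rw [mul_div_assoc, div_self (by positivity)]
          linarith
  | succ t ht ih =>
    have ht0 : (0 : ℝ) < t := by exact_mod_cast (by omega : 0 < t)
    have hηt := hη t (by omega)
    have hηs := hη (t + 1) (by omega)
    have hηs1 := hη1 (t + 1)
    have hqt := hq t ht
    have hrt := hr t ht
    set p := 1 - P.β / 2 * η (t + 1) with hp
    have hp0 : 0 < p := by nlinarith
    have hp1 : p < 1 := by nlinarith
    -- By `hr`, the ratio `η t / η (t + 1)` is at most `1 + 1/t`, and `hq` makes this relative loss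
    -- smaller than the spare contraction `(β/2) η (t + 1)`.
    have hlam : c / η (t + 1) * (1 - P.β * η (t + 1)) ≤ c / η t * p := by
      have h1 : 1 - P.β * η (t + 1) ≥ 0 := by nlinarith
      rw [div_mul_eq_mul_div, div_mul_eq_mul_div, div_le_div_iff₀ hηs hηt, mul_assoc, mul_assoc]
      refine mul_le_mul_of_nonneg_left ?_ hc
      have h2 : 2 ≤ P.β / 2 * η (t + 1) * (t + 1) := by
        rwa [div_le_iff₀ (by positivity)] at hqt
      have h3 : (1 - P.β * η (t + 1)) * (t * η t)
          ≤ (1 - P.β * η (t + 1)) * ((t + 1) * η (t + 1)) := mul_le_mul_of_nonneg_left hrt h1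
      have h4 : (1 - P.β * η (t + 1)) * (t + 1) ≤ p * t := by rw [hp]; nlinarith
      have h5 := mul_le_mul_of_nonneg_right h4 hηs.le
      refine le_of_mul_le_mul_left ?_ ht0
      nlinarith
    refine (lintegral_history_le hX hind hlaw (t := t)
      (f := fun x => P.confined η Δ₀ R (t + 1) x * ENNReal.ofReal (Real.exp
        (c / η (t + 1) * ‖P.err η Δ₀ (t + 1) x‖ ^ 2)))
      (h := fun x => ENNReal.ofReal (Real.exp (P.β / 2 * η (t + 1))) * (P.confined η Δ₀ R t x *
        ENNReal.ofReal (Real.exp (c / η t * ‖P.err η Δ₀ t x‖ ^ 2))) ^ p)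
      (fun x y => P.confined η Δ₀ R t x * ENNReal.ofReal (Real.exp (c / η (t + 1) *
        ‖P.err η Δ₀ t x - η (t + 1) • (P.mat y (P.err η Δ₀ t x) + P.noise y)‖ ^ 2)))
      ?_ ?_ ?_).trans ?_
    · intro y x z hxz
      simp only [P.dependsOn_confined η Δ₀ R t hxz, err, hdep t hxz]
    · intro x
      have : P.confined η Δ₀ R (t + 1) x ≤ P.confined η Δ₀ R t x := by
        simp only [confined]
        split_ifs with h1 h2
        · exact le_rfl
        · exact absurd (fun s hs => h1 s (by omega)) h2
        · simp
        · simp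
      exact mul_le_mul_left this _
    · intro x
      simp only [confined]
      split_ifs with h
      · simp only [one_mul]
        refine (P.lintegral_exp_sq_step hR hc hcQ hηs (h t le_rfl)).trans ?_
        rw [ENNReal.ofReal_rpow_of_pos (by positivity), ← ENNReal.ofReal_mul (by positivity),
          ← Real.exp_mul, ← Real.exp_add]
        refine ENNReal.ofReal_le_ofReal (Real.exp_le_exp.2 ?_)
        nlinarith [mul_le_mul_of_nonneg_right hlam (sq_nonneg ‖P.err η Δ₀ t x‖)]
      · simp
    · have hm : Measurable fun ω => P.confined η Δ₀ R t (fun i => X i ω) *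
          ENNReal.ofReal (Real.exp (c / η t * ‖P.err η Δ₀ t fun i => X i ω‖ ^ 2)) :=
        DependsOn.measurable_comp (t := t) (f := fun x => P.confined η Δ₀ R t x *
          ENNReal.ofReal (Real.exp (c / η t * ‖P.err η Δ₀ t x‖ ^ 2)))
          (fun x z hxz => by simp only [P.dependsOn_confined η Δ₀ R t hxz, err, hdep t hxz]) hX
      rw [lintegral_const_mul _ (hm.pow_const p)]
      refine (mul_le_mul_right (lintegral_rpow_le_rpow_lintegral hm.aemeasurable hp0 hp1)
        _).trans ?_
      refine (mul_le_mul_right (ENNReal.rpow_le_rpow ih hp0.le) _).trans ?_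
      rw [ENNReal.ofReal_rpow_of_pos (by positivity), ← ENNReal.ofReal_mul (by positivity),
        ← Real.exp_mul, ← Real.exp_add]
      refine ENNReal.ofReal_le_ofReal (Real.exp_le_exp.2 ?_)
      set b := c / η n₀ * R ^ 2 * (n₀ : ℝ) ^ 2 with hb
      have hb0 : 0 ≤ b := by
        have := (hη n₀ hn₀).le
        positivity
      -- Here the constant `2` in `hq` matters: `(1 - 2/(t+1)) (t+1)² = t² - 1 ≤ t²`.
      have h3 : p / (t : ℝ) ^ 2 ≤ 1 / ((t : ℝ) + 1) ^ 2 := by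
        rw [div_le_div_iff₀ (by positivity) (by positivity), one_mul]
        have h4 : p ≤ 1 - 2 / ((t : ℝ) + 1) := by linarith
        calc _ ≤ (1 - 2 / ((t : ℝ) + 1)) * ((t : ℝ) + 1) ^ 2 := by gcongr
          _ = (t : ℝ) ^ 2 - 1 := by field_simp; ring
          _ ≤ _ := by linarith
      have h5 := mul_le_mul_of_nonneg_left h3 hb0
      push_cast
      have e1 : b / (t : ℝ) ^ 2 * p = b * (p / (t : ℝ) ^ 2) := by ring
      have e2 : b / ((t : ℝ) + 1) ^ 2 = b * (1 / ((t : ℝ) + 1) ^ 2) := by ring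
      rw [add_mul, e1, e2, hp]
      rw [hp] at h5
      linarith

/-- Tail bound for the squared error after the transient phase. -/
lemma measure_confined_sq_le [CompleteSpace H] (hX : ∀ t, Measurable (X t))
    (hind : iIndepFun X Pr) (hlaw : ∀ t, Pr.map (X t) = ν) {R c : ℝ} (hR : 0 ≤ R) (hc : 0 < c)
    (hcQ : c * (2 * R + P.B) ^ 2 ≤ P.β / 2) {η : ℕ → ℝ} (hη : ∀ t, 1 ≤ t → 0 < η t)
    (hη1 : ∀ t, η t ≤ 1) {n₀ : ℕ} (hn₀ : 1 ≤ n₀)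
    (hq : ∀ t, n₀ ≤ t → 2 / ((t : ℝ) + 1) ≤ P.β / 2 * η (t + 1))
    (hr : ∀ t, n₀ ≤ t → t * η t ≤ (t + 1) * η (t + 1)) (Δ₀ : H) {t : ℕ} (ht : n₀ ≤ t)
    (hmono : η t ≤ η n₀) (z : ℝ) :
    Pr {ω | (∀ s ≤ t, ‖P.err η Δ₀ s fun i => X i ω‖ ≤ R) ∧
        η t / c * (1 + z) + R ^ 2 * ((n₀ : ℝ) / t) ^ 2 ≤ ‖P.err η Δ₀ t fun i => X i ω‖ ^ 2}
      ≤ ENNReal.ofReal (Real.exp (-z)) := by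
  have ht0 : (0 : ℝ) < t := by exact_mod_cast (by omega : 0 < t)
  have hηt := hη t (by omega)
  have hηn := hη n₀ hn₀
  set b := c / η n₀ * R ^ 2 * (n₀ : ℝ) ^ 2 / (t : ℝ) ^ 2 with hb
  have hm : Measurable fun ω => P.confined η Δ₀ R t (fun i => X i ω) *
      ENNReal.ofReal (Real.exp (c / η t * ‖P.err η Δ₀ t fun i => X i ω‖ ^ 2)) :=
    DependsOn.measurable_comp (t := t) (f := fun x => P.confined η Δ₀ R t x *
      ENNReal.ofReal (Real.exp (c / η t * ‖P.err η Δ₀ t x‖ ^ 2)))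
      (fun x z hxz => by simp only [P.dependsOn_confined η Δ₀ R t hxz, err,
        dependsOn_errIterate P.mat P.noise η Δ₀ t hxz]) hX
  have key := (mul_meas_ge_le_lintegral hm (ENNReal.ofReal (Real.exp (1 + b + z)))).trans
    (P.lintegral_confined_exp_le hX hind hlaw hR hc.le hcQ hη hη1 hn₀ hq hr Δ₀ ht)
  rw [← ENNReal.mul_le_mul_iff_right (a := ENNReal.ofReal (Real.exp (1 + b + z)))
    (by simpa using by positivity) ENNReal.ofReal_ne_top]
  rw [← ENNReal.ofReal_mul (by positivity), ← Real.exp_add,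
    show 1 + b + z + -z = 1 + b by ring]
  refine le_trans (mul_le_mul_right (measure_mono ?_) _) key
  rintro ω ⟨h1, h2⟩
  have h3 : P.confined η Δ₀ R t (fun i => X i ω) = 1 := if_pos h1
  rw [Set.mem_ofPred_eq, h3, one_mul]
  refine ENNReal.ofReal_le_ofReal (Real.exp_le_exp.2 ?_)
  refine le_trans ?_ (mul_le_mul_of_nonneg_left h2 (by positivity : 0 ≤ c / η t))
  have e1 : c / η t * (η t / c * (1 + z) + R ^ 2 * ((n₀ : ℝ) / t) ^ 2)
      = 1 + z + c / η t * R ^ 2 * (n₀ : ℝ) ^ 2 / (t : ℝ) ^ 2 := by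
    field_simp
  have e2 : b ≤ c / η t * R ^ 2 * (n₀ : ℝ) ^ 2 / (t : ℝ) ^ 2 := by
    rw [hb]
    gcongr
  rw [e1]
  linarith

end LinearSA

/-! ### A Bernstein inequality in Hilbert space. -/

section Bernstein

variable {E H : Type*} [MeasurableSpace E] [Countable E] [DiscreteMeasurableSpace E]
  {ν : Measure E} [IsProbabilityMeasure ν]
  [NormedAddCommGroup H] [InnerProductSpace ℝ H]

/-- The function `√(a² + ‖v‖²)` is a smooth substitute for the norm whose second-order increment
involves only `‖y‖²`, not the dimension. The linear term is kept exactly, so that it integrates to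
zero for centred `y`. -/
lemma exp_sqrt_add_le {a B l : ℝ} (ha : 0 < a) (hBa : B ≤ a) (hl : 0 ≤ l)
    (hlB : l * B ≤ 1 / 2) {v y : H} (hy : ‖y‖ ≤ B) :
    Real.exp (l * √(a ^ 2 + ‖v + y‖ ^ 2)) ≤ Real.exp (l * √(a ^ 2 + ‖v‖ ^ 2))
      * (1 + l / √(a ^ 2 + ‖v‖ ^ 2) * ⟪v, y⟫ + (l / (2 * a) + 5 / 2 * l ^ 2) * ‖y‖ ^ 2) := by
  set f := √(a ^ 2 + ‖v‖ ^ 2) with hf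
  have hf2 : f ^ 2 = a ^ 2 + ‖v‖ ^ 2 := Real.sq_sqrt (by positivity)
  have hf0 : 0 < f := Real.sqrt_pos.2 (by positivity)
  have hfa : a ≤ f := Real.le_sqrt_of_sq_le (by nlinarith [sq_nonneg ‖v‖])
  have hfv : ‖v‖ ≤ f := Real.le_sqrt_of_sq_le (by nlinarith [sq_nonneg a])
  have hB : 0 ≤ B := (norm_nonneg y).trans hy
  set g := ⟪v, y⟫ / f + ‖y‖ ^ 2 / (2 * f) with hg
  have h1 : √(a ^ 2 + ‖v + y‖ ^ 2) ≤ f + g := by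
    rw [Real.sqrt_le_iff]
    have e : f * g = ⟪v, y⟫ + ‖y‖ ^ 2 / 2 := by rw [hg]; field_simp
    have e2 : ‖v + y‖ ^ 2 = ‖v‖ ^ 2 + 2 * ⟪v, y⟫ + ‖y‖ ^ 2 := norm_add_sq_real v y
    constructor
    · have : 0 ≤ f * (f + g) := by
        nlinarith [sq_nonneg ‖v + y‖, sq_nonneg ‖v‖, sq_nonneg a]
      exact nonneg_of_mul_nonneg_right this hf0
    · nlinarith [sq_nonneg g]
  have hin : |⟪v, y⟫ / f| ≤ ‖y‖ := by
    rw [abs_div, abs_of_pos hf0, div_le_iff₀ hf0]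
    calc _ ≤ ‖v‖ * ‖y‖ := abs_real_inner_le_norm v y
      _ ≤ _ := by rw [mul_comm]; gcongr
  have hq : ‖y‖ ^ 2 / (2 * f) ≤ ‖y‖ / 2 := by
    rw [div_le_div_iff₀ (by positivity) (by norm_num)]
    nlinarith [norm_nonneg y]
  have hq0 : 0 ≤ ‖y‖ ^ 2 / (2 * f) := by positivity
  have hga : |g| ≤ 3 / 2 * ‖y‖ := by
    rw [abs_le] at hin ⊢
    constructor <;> linarith
  have hlg : |l * g| ≤ 1 := by
    rw [abs_mul, abs_of_nonneg hl]
    have : l * |g| ≤ l * (3 / 2 * B) := by gcongr; linarith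
    linarith
  -- This needs `|l g| ≤ 1`; it holds because `|g| ≤ (3/2) B` and `l B ≤ 1/2`.
  have hexp : Real.exp (l * g) ≤ 1 + l * g + (l * g) ^ 2 := by
    have := (abs_le.1 (Real.abs_exp_sub_one_sub_id_le hlg)).2
    linarith
  have hg2 : g ^ 2 ≤ 5 / 2 * ‖y‖ ^ 2 := by
    rw [← sq_abs]
    nlinarith [abs_nonneg g, norm_nonneg y]
  have hq' : ‖y‖ ^ 2 / (2 * f) ≤ ‖y‖ ^ 2 / (2 * a) := by gcongr
  calc _ ≤ Real.exp (l * (f + g)) := by gcongr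
    _ = Real.exp (l * f) * Real.exp (l * g) := by rw [mul_add, Real.exp_add]
    _ ≤ _ := by
      gcongr
      refine hexp.trans ?_
      have e1 : l * g = l / f * ⟪v, y⟫ + l * (‖y‖ ^ 2 / (2 * f)) := by rw [hg]; field_simp
      have e2 : l / (2 * a) * ‖y‖ ^ 2 = l * (‖y‖ ^ 2 / (2 * a)) := by ring
      rw [add_mul, e2]
      have h3 := mul_le_mul_of_nonneg_left hq' hl
      have h4 := mul_le_mul_of_nonneg_left hg2 (sq_nonneg l)
      rw [mul_pow]
      linarith

lemma lintegral_exp_sqrt_step [CompleteSpace H] {a B l w : ℝ} (ha : 0 < a) (hBa : B ≤ a)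
    (hl : 0 ≤ l) (hlB : l * B ≤ 1 / 2) (v : H) {y : E → H} (hy : ∀ e, ‖y e‖ ≤ B)
    (hy0 : ∫ e, y e ∂ν = 0) (hyw : ∫ e, ‖y e‖ ^ 2 ∂ν ≤ w) :
    ∫⁻ e, ENNReal.ofReal (Real.exp (l * √(a ^ 2 + ‖v + y e‖ ^ 2))) ∂ν
      ≤ ENNReal.ofReal (Real.exp (l * √(a ^ 2 + ‖v‖ ^ 2) + (l / (2 * a) + 5 / 2 * l ^ 2) * w)) := by
  have hyi : Integrable y ν := LinearSA.integrable_of_norm_le hy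
  have hin : Integrable (fun e => ⟪v, y e⟫) ν := hyi.const_inner v
  have hsq : Integrable (fun e => ‖y e‖ ^ 2) ν :=
    Integrable.of_bound StronglyMeasurable.of_discrete.aestronglyMeasurable (B ^ 2)
      (Filter.Eventually.of_forall fun e => by
        rw [Real.norm_of_nonneg (sq_nonneg _)]
        exact pow_le_pow_left₀ (norm_nonneg _) (hy e) 2)
  set f := √(a ^ 2 + ‖v‖ ^ 2) with hf
  have hA : Integrable (fun e => 1 + l / f * ⟪v, y e⟫) ν :=
    (integrable_const _).add (hin.const_mul _)
  have hI : Integrable (fun e => Real.exp (l * f) * (1 + l / f * ⟪v, y e⟫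
      + (l / (2 * a) + 5 / 2 * l ^ 2) * ‖y e‖ ^ 2)) ν :=
    (hA.add (hsq.const_mul _)).const_mul _
  calc _ ≤ ∫⁻ e, ENNReal.ofReal (Real.exp (l * f) * (1 + l / f * ⟪v, y e⟫
      + (l / (2 * a) + 5 / 2 * l ^ 2) * ‖y e‖ ^ 2)) ∂ν :=
        lintegral_mono fun e => ENNReal.ofReal_le_ofReal (exp_sqrt_add_le ha hBa hl hlB (hy e))
    _ = ENNReal.ofReal (∫ e, Real.exp (l * f) * (1 + l / f * ⟪v, y e⟫
      + (l / (2 * a) + 5 / 2 * l ^ 2) * ‖y e‖ ^ 2) ∂ν) := by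
        rw [ofReal_integral_eq_lintegral_ofReal hI]
        exact Filter.Eventually.of_forall fun e =>
          (Real.exp_nonneg _).trans (exp_sqrt_add_le ha hBa hl hlB (hy e))
    _ ≤ _ := by
        refine ENNReal.ofReal_le_ofReal ?_
        rw [integral_const_mul, integral_add hA (hsq.const_mul _), integral_add (integrable_const _) (hin.const_mul _),
          integral_const_mul, integral_const_mul, _root_.integral_inner hyi, hy0, inner_zero_right,
          Real.exp_add]
        simp only [integral_const, probReal_univ, smul_eq_mul, mul_zero, add_zero, mul_one]
        gcongr
        have h0 : 0 ≤ l / (2 * a) + 5 / 2 * l ^ 2 := by positivity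
        have h1 := mul_le_mul_of_nonneg_left hyw h0
        linarith [Real.add_one_le_exp ((l / (2 * a) + 5 / 2 * l ^ 2) * w)]

variable {Ω : Type*} [MeasurableSpace Ω] {Pr : Measure Ω} [IsProbabilityMeasure Pr]
  {X : ℕ → Ω → E}

/-- Dimension-free Bernstein inequality for sums of bounded martingale differences in a Hilbert
space. -/
lemma measure_norm_sum_martingaleDiff_le [CompleteSpace H] (hX : ∀ t, Measurable (X t))
    (hind : iIndepFun X Pr) (hlaw : ∀ t, Pr.map (X t) = ν) {y : ℕ → (ℕ → E) → E → H}
    (hdep : ∀ t e, DependsOn (fun x => y t x e) (Set.Iic t)) {B : ℝ} (hB : 0 < B)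
    (hy : ∀ t x e, ‖y t x e‖ ≤ B) (hy0 : ∀ t x, ∫ e, y t x e ∂ν = 0) {w : ℕ → ℝ}
    (hyw : ∀ t x, ∫ e, ‖y t x e‖ ^ 2 ∂ν ≤ w t) {T : ℕ} {W L : ℝ}
    (hW0 : 0 ≤ W) (hW : ∑ t ∈ Finset.range T, w t ≤ W) (hL : 1 ≤ L) :
    Pr {ω | 5 * √(W * L) + 3 * B * L
        ≤ ‖∑ t ∈ Finset.range T, y t (fun i => X i ω) (X (t + 1) ω)‖}
      ≤ ENNReal.ofReal (Real.exp (-L)) := by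
  have hL0 : 0 < L := by linarith
  -- The smoothing scale is at least `B`, as the one-step bound requires, and at least `√W`, so that
  -- `W / (2a) ≤ √W / 2`.
  set a := B + √W with ha
  have hsW : 0 ≤ √W := Real.sqrt_nonneg W
  have ha0 : 0 < a := by positivity
  have hsWL : √(W * L) = √W * √L := Real.sqrt_mul hW0 L
  have hsL : 1 ≤ √L := Real.one_le_sqrt.2 hL
  have hsL2 : √L ^ 2 = L := Real.sq_sqrt hL0.le
  have hsW2 : √W ^ 2 = W := Real.sq_sqrt hW0
  -- This `l` gives `l B ≤ 1/2`, `l W ≤ √(W L)` and `L / l = 2 B L + √(W L)`. The coefficients of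
  -- `√(W L)` add up to `1 + 1/2 + 5/2 + 1 = 5`, those of `B L` to `1 + 2 = 3`.
  set l := 1 / (2 * B + √W / √L) with hl
  have hden : 0 < 2 * B + √W / √L := by positivity
  have hl0 : 0 < l := by positivity
  have hlB : l * B ≤ 1 / 2 := by
    rw [hl, div_mul_eq_mul_div, div_le_div_iff₀ hden (by norm_num)]
    have : 0 ≤ √W / √L := by positivity
    linarith
  set S : ℕ → (ℕ → E) → H := fun t x => ∑ i ∈ Finset.range t, y i x (x (i + 1)) with hS
  have hSdep : ∀ t, DependsOn (S t) (Set.Iic t) := by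
    intro t x z hxz
    refine Finset.sum_congr rfl fun i hi => ?_
    have hi' : i < t := Finset.mem_range.1 hi
    rw [hxz (i + 1) (Set.mem_Iic.2 hi')]
    exact hdep i _ fun j hj => hxz j (le_trans (Set.mem_Iic.1 hj) hi'.le)
  set k := l / (2 * a) + 5 / 2 * l ^ 2 with hk
  have hk0 : 0 ≤ k := by positivity
  have hmgf : ∀ t, ∫⁻ ω, ENNReal.ofReal (Real.exp (l * √(a ^ 2 + ‖S t fun i => X i ω‖ ^ 2))) ∂Pr
      ≤ ENNReal.ofReal (Real.exp (l * a + k * ∑ i ∈ Finset.range t, w i)) := by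
    intro t
    induction t with
    | zero => simp [hS, Real.sqrt_sq ha0.le]
    | succ t ih =>
      refine (lintegral_history_le hX hind hlaw (t := t)
        (f := fun x => ENNReal.ofReal (Real.exp (l * √(a ^ 2 + ‖S (t + 1) x‖ ^ 2))))
        (h := fun x => ENNReal.ofReal (Real.exp (k * w t))
          * ENNReal.ofReal (Real.exp (l * √(a ^ 2 + ‖S t x‖ ^ 2))))
        (fun x e => ENNReal.ofReal (Real.exp (l * √(a ^ 2 + ‖S t x + y t x e‖ ^ 2))))
        ?_ ?_ ?_).trans ?_
      · intro e x z hxz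
        have h1 : y t x e = y t z e := hdep t e hxz
        simp only [hSdep t hxz, h1]
      · intro x
        simp only [hS, Finset.sum_range_succ]
        exact le_rfl
      · intro x
        refine (lintegral_exp_sqrt_step ha0 (by linarith) hl0.le hlB (S t x) (hy t x) (hy0 t x)
          (hyw t x)).trans (le_of_eq ?_)
        rw [← ENNReal.ofReal_mul (by positivity), ← Real.exp_add, add_comm]
      · have hm : Measurable fun ω =>
            ENNReal.ofReal (Real.exp (l * √(a ^ 2 + ‖S t fun i => X i ω‖ ^ 2))) :=
          DependsOn.measurable_comp (t := t)
            (f := fun x => ENNReal.ofReal (Real.exp (l * √(a ^ 2 + ‖S t x‖ ^ 2))))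
            (fun x z hxz => by simp only [hSdep t hxz]) hX
        rw [lintegral_const_mul _ hm]
        refine (mul_le_mul_right ih _).trans (le_of_eq ?_)
        rw [← ENNReal.ofReal_mul (by positivity), ← Real.exp_add, Finset.sum_range_succ]
        ring_nf
  have hm : Measurable fun ω =>
      ENNReal.ofReal (Real.exp (l * √(a ^ 2 + ‖S T fun i => X i ω‖ ^ 2))) :=
    DependsOn.measurable_comp (t := T)
      (f := fun x => ENNReal.ofReal (Real.exp (l * √(a ^ 2 + ‖S T x‖ ^ 2))))
      (fun x z hxz => by simp only [hSdep T hxz]) hX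
  have key := (mul_meas_ge_le_lintegral hm (ENNReal.ofReal (Real.exp (l * a + k * W + L)))).trans
    (hmgf T)
  rw [← ENNReal.mul_le_mul_iff_right (a := ENNReal.ofReal (Real.exp (l * a + k * W + L)))
    (by simpa using by positivity) ENNReal.ofReal_ne_top, ← ENNReal.ofReal_mul (by positivity),
    ← Real.exp_add, show l * a + k * W + L + -L = l * a + k * W by ring]
  refine le_trans (mul_le_mul_right (measure_mono ?_) _) (key.trans ?_)
  · intro ω hω
    simp only [Set.mem_ofPred_eq] at hω ⊢
    refine ENNReal.ofReal_le_ofReal (Real.exp_le_exp.2 ?_)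
    have h1 : 5 * √(W * L) + 3 * B * L ≤ √(a ^ 2 + ‖S T fun i => X i ω‖ ^ 2) :=
      hω.trans (Real.le_sqrt_of_sq_le (by nlinarith [sq_nonneg a]))
    refine le_trans ?_ (mul_le_mul_of_nonneg_left h1 hl0.le)
    have h2 : W / (2 * a) ≤ √W / 2 := by
      rw [div_le_div_iff₀ (by positivity) (by norm_num)]
      nlinarith
    have h3 : l * W ≤ √W * √L := by
      rw [hl, div_mul_eq_mul_div, div_le_iff₀ hden, one_mul]
      have : √W * √L * (2 * B + √W / √L) = 2 * B * (√W * √L) + √W ^ 2 := by field_simp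
      rw [this, hsW2]
      have : 0 ≤ 2 * B * (√W * √L) := by positivity
      linarith
    have h4 : L = l * (2 * B * L + √W * √L) := by
      rw [hl, div_mul_eq_mul_div, eq_div_iff hden.ne', one_mul]
      have : √W / √L * L = √W * √L := by
        rw [div_mul_eq_mul_div, div_eq_iff (by positivity), mul_assoc, ← pow_two, hsL2]
      nlinarith
    have h5 : k * W = l * (W / (2 * a) + 5 / 2 * (l * W)) := by rw [hk]; ring
    rw [hsWL]
    have h6 : l * a + k * W + L
        = l * (a + (W / (2 * a) + 5 / 2 * (l * W)) + (2 * B * L + √W * √L)) := by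
      rw [h5]
      nlinarith
    rw [h6]
    refine mul_le_mul_of_nonneg_left ?_ hl0.le
    have h7 : √W ≤ √W * √L := le_mul_of_one_le_right hsW hsL
    have h8 : B ≤ B * L := le_mul_of_one_le_right hB.le hL
    rw [ha] at h2 ⊢
    linarith
  · refine ENNReal.ofReal_le_ofReal (Real.exp_le_exp.2 ?_)
    gcongr

end Bernstein

/-! ### Envelope sums and the Polyak-Ruppert decomposition. -/

/-- The envelope `min 1 (n / t)`. -/
noncomputable def envelope (n t : ℕ) : ℝ := if t ≤ n then 1 else (n : ℝ) / t

lemma envelope_nonneg (n t : ℕ) : 0 ≤ envelope n t := by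
  unfold envelope; split_ifs <;> positivity

lemma envelope_le_one (n t : ℕ) : envelope n t ≤ 1 := by
  unfold envelope
  split_ifs with h
  · exact le_rfl
  · exact div_le_one_of_le₀ (by exact_mod_cast (by omega : n ≤ t)) (by positivity)

lemma sum_mul_envelope_le {f g : ℕ → ℝ} (hf : ∀ t, 0 ≤ f t) {n : ℕ}
    (hfg : ∀ t, n < t → f t * envelope n t ≤ g t) (T : ℕ) :
    ∑ t ∈ Finset.Icc 1 T, f t * envelope n t
      ≤ ∑ t ∈ Finset.Icc 1 n, f t + ∑ t ∈ Finset.Ioc n T, g t := by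
  classical
  have hsub : Finset.Icc 1 T ⊆ Finset.Icc 1 n ∪ Finset.Ioc n T := by
    intro t ht
    simp only [Finset.mem_union, Finset.mem_Icc, Finset.mem_Ioc] at ht ⊢
    omega
  have hdis : Disjoint (Finset.Icc 1 n) (Finset.Ioc n T) := by
    rw [Finset.disjoint_left]
    intro t h1 h2
    simp only [Finset.mem_Icc, Finset.mem_Ioc] at h1 h2
    omega
  calc _ ≤ ∑ t ∈ Finset.Icc 1 n ∪ Finset.Ioc n T, f t * envelope n t :=
        Finset.sum_le_sum_of_subset_of_nonneg hsub fun t _ _ =>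
          mul_nonneg (hf t) (envelope_nonneg n t)
    _ = ∑ t ∈ Finset.Icc 1 n, f t * envelope n t + ∑ t ∈ Finset.Ioc n T, f t * envelope n t :=
        Finset.sum_union hdis
    _ ≤ _ := add_le_add
        (Finset.sum_le_sum fun t _ => mul_le_of_le_one_right (hf t) (envelope_le_one n t))
        (Finset.sum_le_sum fun t ht => hfg t (Finset.mem_Ioc.1 ht).1)

/-- The weights `t ^ (α - 1)` bound the increments of `t ^ α`, that is of `1/η_t` up to the factor
`η₀`. The resulting bound is uniform in `T`, so the transient adds only a constant to the drift
term. -/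
lemma sum_rpow_mul_envelope_le {α : ℝ} (hα0 : 0 < α) (hα1 : α < 1) {n : ℕ} (hn : 1 ≤ n) (T : ℕ) :
    ∑ t ∈ Finset.Icc 1 T, (t : ℝ) ^ (α - 1) * envelope n t
      ≤ (n : ℝ) ^ α * (1 / α + 1 / (1 - α)) := by
  have hn0 : (0 : ℝ) < n := by exact_mod_cast hn
  refine (sum_mul_envelope_le (g := fun t => n * (t : ℝ) ^ (-(2 - α)))
    (fun t => by positivity) (n := n) ?_ T).trans ?_
  · intro t ht
    have ht0 : (0 : ℝ) < t := by exact_mod_cast (by omega : 0 < t)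
    have e : (t : ℝ) ^ (-(2 - α)) = (t : ℝ) ^ (α - 1) / t := by
      rw [show -(2 - α) = (α - 1) - 1 by ring, Real.rpow_sub_one ht0.ne']
    rw [envelope, if_neg (by omega), e]
    refine le_of_eq ?_
    ring
  · rw [← Finset.mul_sum, mul_add]
    refine add_le_add ?_ ?_
    · have := sum_Icc_rpow_neg_le (s := 1 - α) (by linarith) (by linarith) n
      simpa [div_eq_mul_inv] using this
    · have := sum_Ioc_rpow_neg_le (s := 2 - α) (by linarith) hn T
      refine (mul_le_mul_of_nonneg_left this hn0.le).trans (le_of_eq ?_)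
      rw [show 1 - (2 - α) = α - 1 by ring, show 2 - α - 1 = 1 - α by ring,
        Real.rpow_sub_one hn0.ne']
      field_simp

lemma sum_envelope_sq_le {n : ℕ} (hn : 1 ≤ n) (T : ℕ) :
    ∑ t ∈ Finset.Icc 1 T, envelope n t ^ 2 ≤ 2 * n := by
  have hn0 : (0 : ℝ) < n := by exact_mod_cast hn
  simp only [pow_two]
  refine (sum_mul_envelope_le (g := fun t => n ^ 2 * (t : ℝ) ^ (-(2 : ℝ)))
    (fun t => envelope_nonneg n t) (n := n) ?_ T).trans ?_
  · intro t ht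
    have ht0 : (0 : ℝ) < t := by exact_mod_cast (by omega : 0 < t)
    rw [envelope, if_neg (by omega), Real.rpow_neg ht0.le, Real.rpow_two]
    refine le_of_eq ?_
    field_simp
  · have h1 : ∑ t ∈ Finset.Icc 1 n, envelope n t ≤ n := by
      refine (Finset.sum_le_sum fun t _ => envelope_le_one n t).trans ?_
      simp
    rw [← Finset.mul_sum]
    have h2 := mul_le_mul_of_nonneg_left
      (sum_Ioc_rpow_neg_le (s := 2) (by norm_num) hn T) (sq_nonneg (n : ℝ))
    have h3 : (n : ℝ) ^ 2 * ((n : ℝ) ^ ((1 : ℝ) - 2) / (2 - 1)) = n := by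
      rw [show (1 : ℝ) - 2 = -1 by norm_num, Real.rpow_neg_one]
      field_simp
      norm_num
    linarith

/-- Concavity bound for the increments of `t ^ α`. -/
lemma rpow_succ_sub_rpow_le {α : ℝ} (hα0 : 0 ≤ α) (hα1 : α ≤ 1) {t : ℕ} (ht : 1 ≤ t) :
    ((t : ℝ) + 1) ^ α - (t : ℝ) ^ α ≤ (t : ℝ) ^ (α - 1) := by
  have ht0 : (0 : ℝ) < t := by exact_mod_cast ht
  have h := rpow_one_add_le_one_add_mul_self (s := 1 / (t : ℝ)) (p := α)
    (by have : 0 < 1 / (t : ℝ) := by positivity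
        linarith) hα0 hα1
  have e : (t : ℝ) + 1 = t * (1 + 1 / t) := by field_simp
  rw [e, Real.mul_rpow ht0.le (by positivity), Real.rpow_sub_one ht0.ne']
  have h1 := mul_le_mul_of_nonneg_left h (Real.rpow_nonneg ht0.le α)
  have h2 : (t : ℝ) ^ α * (α * (1 / t)) ≤ (t : ℝ) ^ α / t := by
    calc _ = α * ((t : ℝ) ^ α / t) := by ring
      _ ≤ _ := mul_le_of_le_one_left (by positivity) hα1
  linarith

/-- Summation by parts for `∑ c_t (u_{t-1} - u_t)`. -/
lemma sum_range_smul_sub {H : Type*} [AddCommGroup H] [Module ℝ H] (c : ℕ → ℝ) (u : ℕ → H)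
    (T : ℕ) :
    ∑ t ∈ Finset.range T, c (t + 1) • (u t - u (t + 1))
      = c 1 • u 0 - c (T + 1) • u T
        + ∑ t ∈ Finset.Icc 1 T, (c (t + 1) - c t) • u t := by
  induction T with
  | zero => simp
  | succ n ih =>
    rw [Finset.sum_range_succ, ih, Finset.sum_Icc_succ_top (by omega)]
    module

namespace LinearSA

variable {E H : Type*} [MeasurableSpace E] {ν : Measure E}
  [NormedAddCommGroup H] [InnerProductSpace ℝ H] (P : LinearSA ν H)

/-- The Polyak-Ruppert decomposition of the summed errors. -/
lemma sum_err_eq (η : ℕ → ℝ) (hη : ∀ t, 1 ≤ t → η t ≠ 0) (Δ₀ : H) (x : ℕ → E) (T : ℕ) :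
    ∑ t ∈ Finset.Icc 1 T, P.err η Δ₀ t x
      = P.inv ((η 1)⁻¹ • Δ₀ - (η (T + 1))⁻¹ • P.err η Δ₀ T x
          + ∑ t ∈ Finset.Icc 1 T, ((η (t + 1))⁻¹ - (η t)⁻¹) • P.err η Δ₀ t x)
        - ∑ t ∈ Finset.range T, P.inv (P.noise (x (t + 1)))
        - P.inv (∑ t ∈ Finset.range T,
            (P.mat (x (t + 1)) (P.err η Δ₀ t x) - P.mean (P.err η Δ₀ t x)))
        + (P.err η Δ₀ T x - Δ₀) := by
  -- The recursion divided by the step size, with the random matrix split into its mean and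
  -- fluctuation, then multiplied by the inverse mean.
  have h1 : ∀ t, P.err η Δ₀ t x = P.inv ((η (t + 1))⁻¹ • (P.err η Δ₀ t x - P.err η Δ₀ (t + 1) x))
      - P.inv (P.noise (x (t + 1)))
      - P.inv (P.mat (x (t + 1)) (P.err η Δ₀ t x) - P.mean (P.err η Δ₀ t x)) := by
    intro t
    have e : P.err η Δ₀ (t + 1) x = P.err η Δ₀ t x - η (t + 1) •
      (P.mat (x (t + 1)) (P.err η Δ₀ t x) + P.noise (x (t + 1))) := rfl
    rw [e, sub_sub_cancel, smul_smul, inv_mul_cancel₀ (hη (t + 1) (by omega)), one_smul, map_add,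
      map_sub, P.inv_mean]
    abel
  -- The recursion expresses the errors at times `0, …, T - 1`, whereas the average runs over `1, …,
  -- T`; the shift costs `Δ_T - Δ₀`.
  have h2 : ∑ t ∈ Finset.Icc 1 T, P.err η Δ₀ t x
      = ∑ t ∈ Finset.range T, P.err η Δ₀ t x + (P.err η Δ₀ T x - Δ₀) := by
    induction T with
    | zero => simp [err, errIterate]
    | succ n ih =>
      rw [Finset.sum_Icc_succ_top (by omega), ih, Finset.sum_range_succ]
      abel
  rw [h2, Finset.sum_congr rfl fun t _ => h1 t, Finset.sum_sub_distrib, Finset.sum_sub_distrib,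
    ← map_sum, ← map_sum, sum_range_smul_sub (fun t => (η t)⁻¹) (fun t => P.err η Δ₀ t x), map_sum]
  simp only [err, errIterate, map_sum]

end LinearSA

/-! ### Polynomial step sizes and the transient phase. -/

/-- The polynomially decaying step sizes `η₀ t ^ (-α)`. -/
noncomputable def polyStep (η₀ α : ℝ) (t : ℕ) : ℝ := η₀ * (t : ℝ) ^ (-α)

section PolyStep

variable {η₀ α : ℝ}

lemma polyStep_nonneg (hη : 0 ≤ η₀) (t : ℕ) : 0 ≤ polyStep η₀ α t := by
  unfold polyStep; positivity

lemma polyStep_pos (hη : 0 < η₀) {t : ℕ} (ht : 1 ≤ t) : 0 < polyStep η₀ α t := by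
  have : (0 : ℝ) < t := by exact_mod_cast ht
  unfold polyStep; positivity

lemma polyStep_le (hη : 0 ≤ η₀) (hα : 0 < α) (t : ℕ) : polyStep η₀ α t ≤ η₀ := by
  unfold polyStep
  refine mul_le_of_le_one_right hη ?_
  rcases Nat.eq_zero_or_pos t with rfl | ht
  · simp [Real.zero_rpow (neg_ne_zero.2 hα.ne')]
  · exact Real.rpow_le_one_of_one_le_of_nonpos (by exact_mod_cast ht) (by linarith)

lemma polyStep_anti (hη : 0 ≤ η₀) (hα : 0 < α) {s t : ℕ} (hs : 1 ≤ s) (hst : s ≤ t) :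
    polyStep η₀ α t ≤ polyStep η₀ α s := by
  have hs0 : (0 : ℝ) < s := by exact_mod_cast hs
  unfold polyStep
  exact mul_le_mul_of_nonneg_left (Real.rpow_le_rpow_of_nonpos hs0 (by exact_mod_cast hst)
    (by linarith)) hη

lemma inv_polyStep (t : ℕ) : (polyStep η₀ α t)⁻¹ = (t : ℝ) ^ α / η₀ := by
  unfold polyStep
  rw [mul_inv, Real.rpow_neg (by positivity), inv_inv, div_eq_inv_mul]

lemma mul_polyStep {t : ℕ} (ht : 1 ≤ t) :
    (t : ℝ) * polyStep η₀ α t = η₀ * (t : ℝ) ^ (1 - α) := by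
  have ht0 : (0 : ℝ) < t := by exact_mod_cast ht
  unfold polyStep
  rw [sub_eq_add_neg, Real.rpow_add ht0, Real.rpow_one]
  ring

lemma sum_polyStep_sq_le (hα : 1 / 2 < α) (T : ℕ) :
    ∑ t ∈ Finset.Icc 1 T, polyStep η₀ α t ^ 2 ≤ η₀ ^ 2 * (1 + 1 / (2 * α - 1)) := by
  have e : ∀ t : ℕ, polyStep η₀ α t ^ 2 = η₀ ^ 2 * (t : ℝ) ^ (-(2 * α)) := by
    intro t
    unfold polyStep
    rw [mul_pow, ← Real.rpow_mul_natCast (by positivity)]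
    norm_num
    left
    ring_nf
  simp only [e]
  rw [← Finset.mul_sum]
  exact mul_le_mul_of_nonneg_left (sum_Icc_rpow_neg_le_of_one_lt (by linarith) T) (sq_nonneg _)

lemma mul_rpow_le_sum_polyStep (hη : 0 ≤ η₀) (hα : 0 < α) {t : ℕ} (ht : 1 ≤ t) :
    η₀ * (t : ℝ) ^ (1 - α) ≤ ∑ i ∈ Finset.Icc 1 t, polyStep η₀ α i := by
  rw [← mul_polyStep ht]
  have := Finset.card_nsmul_le_sum (Finset.Icc 1 t) (polyStep η₀ α) (polyStep η₀ α t)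
    fun i hi => polyStep_anti hη hα (Finset.mem_Icc.1 hi).1 (Finset.mem_Icc.1 hi).2
  simpa using this

end PolyStep

/-- The length `⌈(4 / (β η₀)) ^ (1 / (1 - α))⌉` of the transient phase. -/
noncomputable def transient (β η₀ α : ℝ) : ℕ := ⌈(4 / (β * η₀)) ^ (1 / (1 - α))⌉₊

section Transient

variable {β η₀ α : ℝ}

lemma one_le_transient (hβ : 0 < β) (hη : 0 < η₀) : 1 ≤ transient β η₀ α :=
  Nat.one_le_iff_ne_zero.2 (Nat.ceil_pos.2 (by positivity)).ne'

lemma transient_le (hβ : 0 < β) (hβ1 : β ≤ 1) (hη : 0 < η₀) (hη1 : η₀ ≤ 1) (hα1 : α < 1) :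
    (transient β η₀ α : ℝ) ≤ 2 * (4 / β) ^ (1 / (1 - α)) * η₀ ^ (-(1 / (1 - α))) := by
  have h1 : 1 ≤ 4 / (β * η₀) := by
    rw [le_div_iff₀ (by positivity)]
    nlinarith
  have h2 : (1 : ℝ) ≤ (4 / (β * η₀)) ^ (1 / (1 - α)) :=
    Real.one_le_rpow h1 (div_nonneg zero_le_one (by linarith))
  have h3 : (4 / (β * η₀)) ^ (1 / (1 - α)) = (4 / β) ^ (1 / (1 - α)) * η₀ ^ (-(1 / (1 - α))) := by
    rw [← div_div, Real.div_rpow (by positivity) hη.le, Real.rpow_neg hη.le, div_eq_mul_inv]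
  have h4 := (Nat.ceil_lt_add_one (by linarith :
    (0 : ℝ) ≤ (4 / (β * η₀)) ^ (1 / (1 - α)))).le
  unfold transient
  rw [mul_assoc, ← h3]
  linarith

/-- The inequality amounts to `(t + 1) ^ (1 - α) ≥ 4 / (β η₀)`, which explains the length chosen in
`transient`. -/
lemma two_div_le_polyStep (hβ : 0 < β) (hη : 0 < η₀) (hα1 : α < 1) {t : ℕ}
    (ht : transient β η₀ α ≤ t) :
    2 / ((t : ℝ) + 1) ≤ β / 2 * polyStep η₀ α (t + 1) := by
  have h0 : 0 < 1 - α := by linarith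
  have h1 : (4 / (β * η₀)) ^ (1 / (1 - α)) ≤ (t : ℝ) + 1 :=
    (Nat.le_ceil _).trans (by
      have : (transient β η₀ α : ℝ) ≤ t := by exact_mod_cast ht
      unfold transient at this
      linarith)
  have h2 := Real.rpow_le_rpow (by positivity) h1 h0.le
  rw [← Real.rpow_mul (by positivity), one_div_mul_cancel h0.ne', Real.rpow_one,
    div_le_iff₀ (by positivity)] at h2
  have h3 := mul_polyStep (η₀ := η₀) (α := α) (t := t + 1) (by omega)
  push_cast at h3
  rw [div_le_iff₀ (by positivity)]
  nlinarith

lemma mul_polyStep_mono (hη : 0 < η₀) (hα1 : α < 1) {t : ℕ} (ht : 1 ≤ t) :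
    t * polyStep η₀ α t ≤ (t + 1) * polyStep η₀ α (t + 1) := by
  have h3 := mul_polyStep (η₀ := η₀) (α := α) (t := t + 1) (by omega)
  push_cast at h3
  rw [mul_polyStep ht, h3]
  gcongr
  linarith

end Transient

/-- All that the proof needs from the step-size condition `(*)`: the sum of squared steps times the
confidence parameter `log (4/δ)` is bounded. -/
lemma sq_mul_log_le {δ η₀ : ℝ} (hδ : 0 < δ) (hδ1 : δ < 1) (hη : 0 < η₀) (hη1 : η₀ < 1 / 2)
    (hs : η₀ * √(Real.log (1 / (δ * η₀))) ≤ 1) : η₀ ^ 2 * Real.log (4 / δ) ≤ 2 := by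
  have h1 : Real.log (1 / δ) ≤ Real.log (1 / (δ * η₀)) := by
    refine Real.log_le_log (by positivity) ?_
    refine one_div_le_one_div_of_le (by positivity) ?_
    nlinarith
  have h0 : 0 ≤ Real.log (1 / (δ * η₀)) := by
    refine Real.log_nonneg ?_
    rw [le_div_iff₀ (by positivity)]
    nlinarith
  have h2 : η₀ ^ 2 * Real.log (1 / (δ * η₀)) ≤ 1 := by
    have := mul_self_le_mul_self (by positivity) hs
    calc _ = (η₀ * √(Real.log (1 / (δ * η₀)))) * (η₀ * √(Real.log (1 / (δ * η₀)))) := by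
          rw [mul_mul_mul_comm, Real.mul_self_sqrt h0]; ring
      _ ≤ 1 := by linarith
  have h3 : Real.log (4 / δ) = Real.log 4 + Real.log (1 / δ) := by
    rw [← Real.log_mul (by norm_num) (by positivity)]
    ring_nf
  have h4 : Real.log 4 ≤ 2 := by
    have : Real.log 4 = 2 * Real.log 2 := by
      rw [show (4 : ℝ) = 2 ^ 2 by norm_num, Real.log_pow]; norm_num
    linarith [Real.log_two_lt_d9]
  rw [h3]
  have h5 : η₀ ^ 2 ≤ 1 / 4 := by nlinarith
  nlinarith [mul_le_mul_of_nonneg_left h1 (sq_nonneg η₀), mul_le_mul_of_nonneg_left h4 (sq_nonneg η₀)]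

lemma exp_neg_log_div {δ k : ℝ} (hδ : 0 < δ) (hk : 0 < k) : Real.exp (-Real.log (k / δ)) = δ / k := by
  rw [Real.exp_neg, Real.exp_log (by positivity), inv_div]

/-! ### High-probability envelope of the error. -/

namespace LinearSA

variable {E H : Type*} [MeasurableSpace E] [Countable E] [DiscreteMeasurableSpace E]
  {ν : Measure E} [IsProbabilityMeasure ν]
  [NormedAddCommGroup H] [InnerProductSpace ℝ H] (P : LinearSA ν H)

/-- A radius which the error iterates do not leave, with high probability. -/
noncomputable def radius (α : ℝ) (Δ₀ : H) : ℝ :=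
  √((‖Δ₀‖ ^ 2 + 1) * Real.exp (1 + (1 + 1 / (2 * α - 1)) * (8 + 2 * P.B ^ 2 + (4 + P.B) ^ 2)))

omit [Countable E] [DiscreteMeasurableSpace E] [IsProbabilityMeasure ν] in
lemma radius_sq (α : ℝ) (Δ₀ : H) : P.radius α Δ₀ ^ 2 = (‖Δ₀‖ ^ 2 + 1)
    * Real.exp (1 + (1 + 1 / (2 * α - 1)) * (8 + 2 * P.B ^ 2 + (4 + P.B) ^ 2)) :=
  Real.sq_sqrt (by positivity)

omit [Countable E] [DiscreteMeasurableSpace E] [IsProbabilityMeasure ν] in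
lemma radius_pos (α : ℝ) (Δ₀ : H) : 0 < P.radius α Δ₀ := Real.sqrt_pos.2 (by positivity)

variable {Ω : Type*} [MeasurableSpace Ω] {Pr : Measure Ω} [IsProbabilityMeasure Pr]
  {X : ℕ → Ω → E}

/-- The growth bound with `θ = log (4/δ)`. The exponent contains `θ` only through `η₀² θ ≤ 2`, which
is why `radius` depends on neither `δ` nor `η₀`. -/
lemma measure_radius_le [CompleteSpace H] (hX : ∀ t, Measurable (X t)) (hind : iIndepFun X Pr)
    (hlaw : ∀ t, Pr.map (X t) = ν) {κ ρ α δ η₀ : ℝ} (hκ : 0 ≤ κ) (hκ1 : κ ≤ 1)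
    (hξ : ∀ᵐ y ∂ν, ‖P.noise y‖ ^ 2 ≤ P.B ^ 2 * κ)
    (hρ : ∀ v : H, ρ * (‖v‖ ^ 2 + κ) ≤ 2 * P.β * ‖v‖ ^ 2) (hα : 1 / 2 < α)
    (hδ : 0 < δ) (hδ1 : δ < 1) (hη : 0 < η₀) (hη1 : η₀ < 1 / 2)
    (hs : η₀ * √(Real.log (1 / (δ * η₀))) ≤ 1) (Δ₀ : H) (T : ℕ) :
    Pr {ω | ∃ t ≤ T, P.radius α Δ₀ ^ 2 * Real.exp (-(ρ * ∑ i ∈ Finset.Icc 1 t, polyStep η₀ α i))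
        ≤ ‖P.err (polyStep η₀ α) Δ₀ t fun i => X i ω‖ ^ 2 + κ} ≤ ENNReal.ofReal (δ / 4) := by
  have hlog : 0 < Real.log (4 / δ) := Real.log_pos (by rw [lt_div_iff₀ hδ]; linarith)
  have hα' : 0 < 2 * α - 1 := by linarith
  have h := P.measure_growth_le hX hind hlaw (η := polyStep η₀ α) (θ := Real.log (4 / δ)) hκ hξ hρ
    hlog (polyStep_nonneg hη.le) (sum_polyStep_sq_le hα) (Δ₀ := Δ₀)
    (U₀ := ‖Δ₀‖ ^ 2 + 1) (by positivity) (by linarith) T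
  rw [exp_neg_log_div hδ (by norm_num)] at h
  refine (measure_mono ?_).trans h
  rintro ω ⟨t, ht, hω⟩
  refine ⟨t, ht, le_trans ?_ hω⟩
  rw [radius_sq, mul_assoc (‖Δ₀‖ ^ 2 + 1) (Real.exp _), ← Real.exp_add]
  refine mul_le_mul_of_nonneg_left (Real.exp_le_exp.2 ?_) (by positivity)
  rw [sub_eq_add_neg]
  refine add_le_add (add_le_add le_rfl ?_) le_rfl
  have h2 := sq_mul_log_le hδ hδ1 hη hη1 hs
  have h3 : η₀ ^ 2 ≤ 1 := by nlinarith
  have h4 : 0 ≤ 1 + 1 / (2 * α - 1) := by positivity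
  calc η₀ ^ 2 * (1 + 1 / (2 * α - 1)) * (8 + 2 * P.B ^ 2 + Real.log (4 / δ) * (4 + P.B) ^ 2 / 2)
      = (1 + 1 / (2 * α - 1)) * (η₀ ^ 2 * (8 + 2 * P.B ^ 2)
        + (η₀ ^ 2 * Real.log (4 / δ)) * ((4 + P.B) ^ 2 / 2)) := by ring
    _ ≤ (1 + 1 / (2 * α - 1)) * (1 * (8 + 2 * P.B ^ 2) + 2 * ((4 + P.B) ^ 2 / 2)) := by gcongr
    _ = _ := by ring

/-- The scale of the squared error relative to the step size. -/
noncomputable def errScale (α : ℝ) (Δ₀ : H) : ℝ :=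
  3 / (P.β / 2 / (2 * P.radius α Δ₀ + P.B) ^ 2)

omit [Countable E] [DiscreteMeasurableSpace E] [IsProbabilityMeasure ν] in
lemma errScale_pos (α : ℝ) (Δ₀ : H) : 0 < P.errScale α Δ₀ := by
  have := P.radius_pos α Δ₀
  have := P.β_pos
  have := P.B_nonneg
  unfold errScale
  positivity

/-- The envelope of the squared error at time `t`, when the logarithmic factor is `L`. -/
noncomputable def sqEnvelope (α η₀ : ℝ) (Δ₀ : H) (L : ℝ) (t : ℕ) : ℝ :=
  P.errScale α Δ₀ * L * polyStep η₀ α t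
    + P.radius α Δ₀ ^ 2 * envelope (transient P.β η₀ α) t ^ 2

omit [Countable E] [DiscreteMeasurableSpace E] [IsProbabilityMeasure ν] in
lemma sqEnvelope_nonneg {α η₀ : ℝ} (hη : 0 ≤ η₀) (Δ₀ : H) {L : ℝ} (hL : 0 ≤ L) (t : ℕ) :
    0 ≤ P.sqEnvelope α η₀ Δ₀ L t := by
  have := P.errScale_pos α Δ₀
  have := polyStep_nonneg (α := α) hη t
  unfold sqEnvelope
  positivity

lemma log_exp_mul_div {T : ℕ} (hT : 1 ≤ T) {δ : ℝ} (hδ : 0 < δ) :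
    Real.log (Real.exp 1 * T / δ) = 1 + Real.log T + Real.log (1 / δ) := by
  have hT0 : (0 : ℝ) < T := by exact_mod_cast hT
  rw [mul_div_assoc, Real.log_mul (Real.exp_ne_zero _) (by positivity), Real.log_exp,
    div_eq_mul_one_div, Real.log_mul hT0.ne' (by positivity)]
  ring

lemma log_four_div {δ : ℝ} (hδ : 0 < δ) :
    Real.log (4 / δ) ≤ 3 / 2 + Real.log (1 / δ) ∧ 1 + Real.log (1 / δ) ≤ Real.log (4 / δ) := by
  have h3 : Real.log (4 / δ) = Real.log 4 + Real.log (1 / δ) := by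
    rw [← Real.log_mul (by norm_num) (by positivity)]
    ring_nf
  have : Real.log 4 = 2 * Real.log 2 := by
    rw [show (4 : ℝ) = 2 ^ 2 by norm_num, Real.log_pow]; norm_num
  constructor <;> linarith [Real.log_two_lt_d9, Real.log_two_gt_d9]

/-- With high probability the error stays in a fixed ball and decays like the square root of the
step size after the transient phase. -/
lemma measure_not_sqEnvelope_le [CompleteSpace H] (hX : ∀ t, Measurable (X t))
    (hind : iIndepFun X Pr) (hlaw : ∀ t, Pr.map (X t) = ν) {α δ η₀ : ℝ} (hα : 1 / 2 < α)
    (hα1 : α < 1) (hδ : 0 < δ) (hδ1 : δ < 1) (hη : 0 < η₀) (hη1 : η₀ < 1 / 2)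
    (hs : η₀ * √(Real.log (1 / (δ * η₀))) ≤ 1) (Δ₀ : H) {T : ℕ} (hT : 1 ≤ T) :
    Pr {ω | ¬ ∀ t ≤ T, ‖P.err (polyStep η₀ α) Δ₀ t fun i => X i ω‖ ≤ P.radius α Δ₀ ∧
        ‖P.err (polyStep η₀ α) Δ₀ t fun i => X i ω‖ ^ 2
          ≤ P.sqEnvelope α η₀ Δ₀ (Real.log (Real.exp 1 * T / δ)) t}
      ≤ ENNReal.ofReal (δ / 2) := by
  have hT0 : (0 : ℝ) < T := by exact_mod_cast hT
  have hR := P.radius_pos α Δ₀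
  have hβ := P.β_pos
  have hB := P.B_nonneg
  set R := P.radius α Δ₀ with hRdef
  set η := polyStep η₀ α with hηdef
  set n₀ := transient P.β η₀ α with hn₀def
  set c := P.β / 2 / (2 * R + P.B) ^ 2 with hcdef
  have hc : 0 < c := by positivity
  have hcQ : c * (2 * R + P.B) ^ 2 ≤ P.β / 2 := by
    rw [hcdef, div_mul_cancel₀ _ (by positivity)]
  have hn₀ : 1 ≤ n₀ := one_le_transient hβ hη
  set z := Real.log (4 * T / δ) with hz
  set Lg := Real.log (Real.exp 1 * T / δ) with hLg
  have hlogT : 0 ≤ Real.log T := Real.log_nonneg (by exact_mod_cast hT)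
  have hlogδ : 0 ≤ Real.log (1 / δ) := Real.log_nonneg (by rw [le_div_iff₀ hδ]; linarith)
  have hLg' : Lg = 1 + Real.log T + Real.log (1 / δ) := log_exp_mul_div hT hδ
  -- Source of the `3` in `errScale`: the level `z = log (4T/δ)` is fit for a union bound over at
  -- most `T` times.
  have hzL : 1 + z ≤ 3 * Lg := by
    have h3 : z = Real.log T + Real.log (4 / δ) := by
      rw [hz, ← Real.log_mul (by positivity) (by positivity)]
      ring_nf
    linarith [(log_four_div hδ).1]
  have hLg0 : 0 ≤ Lg := by linarith
  -- Confinement uses no contraction, hence `ρ = 0`. It spends `δ/4` of the failure probability, and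
  -- the union bound another `δ/4`.
  have hE1 := P.measure_radius_le hX hind hlaw (κ := 1) (ρ := 0) (α := α) zero_le_one le_rfl
    (Filter.Eventually.of_forall fun y => by
      rw [mul_one]; exact pow_le_pow_left₀ (norm_nonneg _) (P.noise_le y) 2)
    (fun v => by simp only [zero_mul]; positivity) hα hδ hδ1 hη hη1 hs Δ₀ T
  simp only [zero_mul, neg_zero, Real.exp_zero, mul_one] at hE1
  set bad : ℕ → Set Ω := fun t => {ω | (∀ s ≤ t, ‖P.err η Δ₀ s fun i => X i ω‖ ≤ R) ∧
    η t / c * (1 + z) + R ^ 2 * ((n₀ : ℝ) / t) ^ 2 ≤ ‖P.err η Δ₀ t fun i => X i ω‖ ^ 2} with hbad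
  have hE2 : ∀ t ∈ Finset.Icc n₀ T, Pr (bad t) ≤ ENNReal.ofReal (δ / (4 * T)) := by
    intro t ht
    have h := P.measure_confined_sq_le hX hind hlaw hR.le hc hcQ
      (fun t ht => polyStep_pos hη ht) (fun t => (polyStep_le hη.le (by linarith) t).trans
        (by linarith)) hn₀ (fun t ht => two_div_le_polyStep hβ hη hα1 ht)
      (fun t ht => mul_polyStep_mono hη hα1 (hn₀.trans ht)) Δ₀ (Finset.mem_Icc.1 ht).1
      (polyStep_anti hη.le (by linarith) hn₀ (Finset.mem_Icc.1 ht).1) z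
    rwa [hz, exp_neg_log_div hδ (by positivity)] at h
  refine (measure_mono (t := {ω | ∃ t ≤ T, R ^ 2 ≤ ‖P.err η Δ₀ t fun i => X i ω‖ ^ 2 + 1}
    ∪ ⋃ t ∈ Finset.Icc n₀ T, bad t) ?_).trans ?_
  · intro ω hω
    by_contra hcon
    simp only [Set.mem_union, Set.mem_iUnion, not_or, not_exists, Set.mem_ofPred_eq, not_and,
      not_le] at hcon
    obtain ⟨h1, h2⟩ := hcon
    have hr : ∀ t ≤ T, ‖P.err η Δ₀ t fun i => X i ω‖ ≤ R := fun t ht =>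
      (abs_le_of_sq_le_sq' (by linarith [h1 t ht]) hR.le).2
    refine hω fun t ht => ⟨hr t ht, ?_⟩
    rw [sqEnvelope, envelope]
    have hηt := polyStep_nonneg (α := α) hη.le t
    split_ifs with htn
    · have : 0 ≤ P.errScale α Δ₀ * Lg * polyStep η₀ α t := by
        have := P.errScale_pos α Δ₀
        positivity
      have := pow_le_pow_left₀ (norm_nonneg _) (hr t ht) 2
      linarith
    · have h3 : ω ∉ bad t := h2 t (Finset.mem_Icc.2 ⟨by omega, ht⟩)
      have h4 : ¬ (η t / c * (1 + z) + R ^ 2 * ((n₀ : ℝ) / t) ^ 2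
          ≤ ‖P.err η Δ₀ t fun i => X i ω‖ ^ 2) := fun h => h3 ⟨fun s hs => hr s (hs.trans ht), h⟩
      push Not at h4
      refine h4.le.trans ?_
      have e : P.errScale α Δ₀ * Lg * polyStep η₀ α t = η t / c * (3 * Lg) := by
        rw [errScale, ← hRdef, ← hcdef]
        ring
      rw [e]
      have : 0 ≤ η t / c := div_nonneg hηt hc.le
      gcongr
  · refine (measure_union_le _ _).trans ?_
    have h5 : Pr (⋃ t ∈ Finset.Icc n₀ T, bad t) ≤ ENNReal.ofReal (δ / 4) := by
      refine (measure_biUnion_finset_le _ _).trans ((Finset.sum_le_sum hE2).trans ?_)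
      rw [Finset.sum_const, nsmul_eq_mul, ← ENNReal.ofReal_natCast,
        ← ENNReal.ofReal_mul (by positivity)]
      refine ENNReal.ofReal_le_ofReal ?_
      have : ((Finset.Icc n₀ T).card : ℝ) ≤ T := by
        rw [Nat.card_Icc]
        exact_mod_cast (by omega)
      calc _ ≤ (T : ℝ) * (δ / (4 * T)) := by gcongr
        _ = _ := by field_simp
    calc _ ≤ ENNReal.ofReal (δ / 4) + ENNReal.ofReal (δ / 4) := add_le_add hE1 h5
      _ = _ := by
        rw [← ENNReal.ofReal_add (by positivity) (by positivity)]
        ring_nf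

end LinearSA

/-! ### Absorption of the boundary term. -/

lemma rpow_mul_envelope_le {α : ℝ} (hα0 : 0 ≤ α) (hα1 : α ≤ 1) {n T : ℕ} (hn : 1 ≤ n)
    (hT : 1 ≤ T) : (T : ℝ) ^ α * envelope n T ≤ (n : ℝ) ^ α := by
  have hT0 : (0 : ℝ) < T := by exact_mod_cast hT
  have hn0 : (0 : ℝ) < n := by exact_mod_cast hn
  unfold envelope
  split_ifs with h
  · rw [mul_one]
    exact Real.rpow_le_rpow hT0.le (by exact_mod_cast h) hα0
  · have h1 : (T : ℝ) ^ (α - 1) ≤ (n : ℝ) ^ (α - 1) :=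
      Real.rpow_le_rpow_of_nonpos hn0 (by exact_mod_cast (by omega : n ≤ T)) (by linarith)
    rw [Real.rpow_sub_one hT0.ne', Real.rpow_sub_one hn0.ne'] at h1
    calc (T : ℝ) ^ α * (n / T) = (T : ℝ) ^ α / T * n := by ring
      _ ≤ (n : ℝ) ^ α / n * n := by gcongr
      _ = _ := div_mul_cancel₀ _ hn0.ne'

/-- A term of order `√(L / η₀) T ^ (α / 2)` is dominated by a noise level of order `√T` as soon
as `T` is large in terms of `η₀`. -/
lemma exists_absorb {α s A₀ : ℝ} (hα : 1 / 2 < α) (hα1 : α < 1) (hs : 0 < s) (hA : 0 ≤ A₀) :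
    ∃ M : ℝ, 0 ≤ M ∧ ∀ η₀ l : ℝ, ∀ T : ℕ, 0 < η₀ → η₀ < 1 → 1 ≤ l → 1 ≤ T →
      A₀ * √((l + Real.log T) / η₀) * (T : ℝ) ^ (α / 2)
        ≤ √(T * s * l) + M * η₀ ^ (-(1 / (1 - α))) * (T : ℝ) ^ ((1 - α) / 2)
          * (l + Real.log T) := by
  have h1α : 0 < 1 - α := by linarith
  set ε := (1 - α) / 2 with hε
  have hε0 : 0 < ε := by positivity
  set M₅ := A₀ ^ 2 * (1 + 1 / ε) / s with hM₅
  have hM₅0 : 0 ≤ M₅ := by positivity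
  refine ⟨A₀ * M₅ ^ ((2 * α - 1) / (1 - α)), by positivity, fun η₀ l T hη hη1 hl hT => ?_⟩
  have hT1 : (1 : ℝ) ≤ T := by exact_mod_cast hT
  have hT0 : (0 : ℝ) < T := by linarith
  have hlog : 0 ≤ Real.log T := Real.log_nonneg hT1
  set Lg := l + Real.log T with hLg
  have hLg1 : 1 ≤ Lg := by linarith
  set y := (T : ℝ) ^ ε with hy
  have hy0 : 0 < y := by positivity
  have hy1 : 1 ≤ y := Real.one_le_rpow hT1 hε0.le
  -- Either the term is below the noise level, or `T ^ (1 - α) = y²` is at most of order `Lg / (η₀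
  -- l)`. In the second case `log T ≲ y` yields `y ≤ M₅ / η₀`, and the surplus of `T ^ (α/2)` over
  -- `y` becomes a power of `1/η₀`.
  by_cases hc : A₀ ^ 2 * (Lg / η₀) * (T : ℝ) ^ α ≤ T * s * l
  · have h1 : A₀ * √(Lg / η₀) * (T : ℝ) ^ (α / 2) ≤ √(T * s * l) := by
      refine Real.le_sqrt_of_sq_le ?_
      rw [mul_pow, mul_pow, Real.sq_sqrt (by positivity), ← Real.rpow_mul_natCast hT0.le]
      simpa using hc
    have h2 : 0 ≤ A₀ * M₅ ^ ((2 * α - 1) / (1 - α)) * η₀ ^ (-(1 / (1 - α))) * y * Lg := by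
      positivity
    linarith
  · push Not at hc
    have hlogT : Real.log T ≤ 1 / ε * y := by
      have := Real.log_le_rpow_div hT0.le hε0
      rwa [div_eq_inv_mul, ← one_div] at this
    have hLgl : Lg ≤ l * ((1 + 1 / ε) * y) := by
      have h1 : 0 ≤ 1 / ε * y := by positivity
      have : 1 + 1 / ε * y ≤ (1 + 1 / ε) * y := by nlinarith
      have h2 : Lg ≤ l * (1 + 1 / ε * y) := by nlinarith
      nlinarith
    have hTα : (T : ℝ) = (T : ℝ) ^ α * (y * y) := by
      rw [hy, ← Real.rpow_add hT0, ← Real.rpow_add hT0]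
      conv_lhs => rw [← Real.rpow_one (T : ℝ)]
      congr 1
      rw [hε]
      ring
    have hyM : y ≤ M₅ / η₀ := by
      have h1 : (T : ℝ) ^ α * (y * y) * s * l < A₀ ^ 2 * (l * ((1 + 1 / ε) * y) / η₀) * (T : ℝ) ^ α := by
        rw [← hTα]
        refine hc.trans_le ?_
        gcongr
      rw [hM₅, div_div, le_div_iff₀ (by positivity)]
      have h2 : 0 < (T : ℝ) ^ α * l * y / η₀ := by positivity
      refine le_of_mul_le_mul_left (a := (T : ℝ) ^ α * l * y / η₀) ?_ h2
      calc _ = (T : ℝ) ^ α * (y * y) * s * l := by field_simp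
        _ ≤ _ := h1.le
        _ = _ := by field_simp
    have hTy : (T : ℝ) ^ (α / 2) = y * y ^ ((2 * α - 1) / (1 - α)) := by
      rw [hy, ← Real.rpow_mul hT0.le, ← Real.rpow_add hT0]
      congr 1
      rw [hε]
      field_simp
      ring
    have hpow : 0 ≤ (2 * α - 1) / (1 - α) := div_nonneg (by linarith) h1α.le
    have h3 : y ^ ((2 * α - 1) / (1 - α)) ≤ M₅ ^ ((2 * α - 1) / (1 - α))
        * (1 / η₀) ^ ((2 * α - 1) / (1 - α)) := by
      rw [← Real.mul_rpow hM₅0 (by positivity)]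
      exact Real.rpow_le_rpow hy0.le (by rwa [mul_one_div]) hpow
    have h4 : √(Lg / η₀) ≤ Lg * (1 / η₀) ^ ((1 : ℝ) / 2) := by
      rw [div_eq_mul_one_div, Real.sqrt_mul (by positivity), Real.sqrt_eq_rpow (1 / η₀)]
      gcongr
      rw [Real.sqrt_le_iff]
      constructor <;> nlinarith
    have h5 : (1 / η₀) ^ ((1 : ℝ) / 2) * (1 / η₀) ^ ((2 * α - 1) / (1 - α))
        ≤ η₀ ^ (-(1 / (1 - α))) := by
      rw [← Real.rpow_add (by positivity), Real.rpow_neg hη.le, ← Real.inv_rpow hη.le,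
        one_div η₀]
      refine Real.rpow_le_rpow_of_exponent_le (one_le_inv_iff₀.2 ⟨hη, hη1.le⟩) ?_
      -- The available power `1 / (1 - α)` of `1/η₀` exceeds the required one by `3/2`.
      have : 1 / (1 - α) - (1 / 2 + (2 * α - 1) / (1 - α)) = 3 / 2 := by
        field_simp
        ring
      linarith
    calc A₀ * √(Lg / η₀) * (T : ℝ) ^ (α / 2)
        ≤ A₀ * (Lg * (1 / η₀) ^ ((1 : ℝ) / 2)) * (y * (M₅ ^ ((2 * α - 1) / (1 - α))
        * (1 / η₀) ^ ((2 * α - 1) / (1 - α)))) := by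
          rw [hTy]
          gcongr
      _ = A₀ * M₅ ^ ((2 * α - 1) / (1 - α)) * ((1 / η₀) ^ ((1 : ℝ) / 2)
          * (1 / η₀) ^ ((2 * α - 1) / (1 - α))) * y * Lg := by ring
      _ ≤ A₀ * M₅ ^ ((2 * α - 1) / (1 - α)) * η₀ ^ (-(1 / (1 - α))) * y * Lg := by gcongr
      _ ≤ _ := le_add_of_nonneg_left (Real.sqrt_nonneg _)

/-! ### The two martingale sums. -/

namespace LinearSA

variable {E H : Type*} [MeasurableSpace E] [Countable E] [DiscreteMeasurableSpace E]
  {ν : Measure E} [IsProbabilityMeasure ν]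
  [NormedAddCommGroup H] [InnerProductSpace ℝ H] (P : LinearSA ν H)

omit [Countable E] [DiscreteMeasurableSpace E] in
lemma norm_mean_le (v : H) : ‖P.mean v‖ ≤ 2 * ‖v‖ := by
  rw [← P.integral_mat]
  have := norm_integral_le_of_norm_le_const (μ := ν)
    (Filter.Eventually.of_forall fun y => P.norm_mat_le y v)
  simpa using this

/-- The trace of the asymptotic covariance. -/
noncomputable def avar : ℝ := ∫ e, ‖P.inv (P.noise e)‖ ^ 2 ∂ν

omit [Countable E] [DiscreteMeasurableSpace E] [IsProbabilityMeasure ν] in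
lemma avar_nonneg : 0 ≤ P.avar := integral_nonneg fun _ => sq_nonneg _

variable {Ω : Type*} [MeasurableSpace Ω] {Pr : Measure Ω} [IsProbabilityMeasure Pr]
  {X : ℕ → Ω → E}

lemma measure_sum_inv_noise_le [CompleteSpace H] (hX : ∀ t, Measurable (X t))
    (hind : iIndepFun X Pr) (hlaw : ∀ t, Pr.map (X t) = ν) (T : ℕ) {L : ℝ} (hL : 1 ≤ L) :
    Pr {ω | 5 * √(T * P.avar * L) + 3 * (‖P.inv‖ * P.B + 1) * L
        ≤ ‖∑ t ∈ Finset.range T, P.inv (P.noise (X (t + 1) ω))‖} ≤ ENNReal.ofReal (Real.exp (-L)) := by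
  have hB := P.B_nonneg
  refine measure_norm_sum_martingaleDiff_le (ν := ν) (y := fun _ _ e => P.inv (P.noise e)) hX hind
    hlaw (fun _ _ _ _ _ => rfl) (by positivity) (fun _ _ e => ?_) (fun _ _ => ?_)
    (w := fun _ => P.avar) (fun _ _ => le_rfl) (mul_nonneg (Nat.cast_nonneg T) P.avar_nonneg)
    (by simp) hL
  · calc _ ≤ ‖P.inv‖ * ‖P.noise e‖ := P.inv.le_opNorm _
      _ ≤ ‖P.inv‖ * P.B := by gcongr; exact P.noise_le e
      _ ≤ _ := by linarith
  · rw [P.inv.integral_comp_comm (integrable_of_norm_le P.noise_le), P.integral_noise, map_zero]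

/-- The envelope of the error holds only with high probability, while Bernstein needs deterministic
bounds. Each difference is therefore set to zero when the current error violates its bound. This
test depends on the past only, so centring is preserved, and on the good event the sum is unchanged.
-/
lemma measure_sum_mat_sub_mean_le [CompleteSpace H] (hX : ∀ t, Measurable (X t))
    (hind : iIndepFun X Pr) (hlaw : ∀ t, Pr.map (X t) = ν) (η : ℕ → ℝ) (Δ₀ : H) {R : ℝ}
    (hR : 0 < R) {s : ℕ → ℝ} (hs0 : ∀ t, 0 ≤ s t) {T : ℕ} {W L : ℝ} (hL : 1 ≤ L)
    (hW : ∑ t ∈ Finset.range T, s t ≤ W) :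
    Pr {ω | (∀ t < T, ‖P.err η Δ₀ t fun i => X i ω‖ ≤ R
          ∧ ‖P.err η Δ₀ t fun i => X i ω‖ ^ 2 ≤ s t) ∧
        5 * √(16 * W * L) + 3 * (4 * R) * L
          ≤ ‖∑ t ∈ Finset.range T, (P.mat (X (t + 1) ω) (P.err η Δ₀ t fun i => X i ω)
            - P.mean (P.err η Δ₀ t fun i => X i ω))‖} ≤ ENNReal.ofReal (Real.exp (-L)) := by
  classical
  have hdep := dependsOn_errIterate P.mat P.noise η Δ₀
  have hbd : ∀ (e : E) (v : H), ‖P.mat e v - P.mean v‖ ≤ 4 * ‖v‖ := fun e v =>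
    (norm_sub_le _ _).trans (by linarith [P.norm_mat_le e v, P.norm_mean_le v])
  have h := measure_norm_sum_martingaleDiff_le (ν := ν)
    (y := fun t x e => if ‖P.err η Δ₀ t x‖ ≤ R ∧ ‖P.err η Δ₀ t x‖ ^ 2 ≤ s t
      then P.mat e (P.err η Δ₀ t x) - P.mean (P.err η Δ₀ t x) else 0) hX hind hlaw
    (fun t e x z hxz => by
      have e1 : P.err η Δ₀ t x = P.err η Δ₀ t z := hdep t hxz
      beta_reduce
      rw [e1]) (B := 4 * R) (by positivity)
    (fun t x e => by
      split_ifs with hc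
      · exact (hbd e _).trans (by linarith [hc.1])
      · simp only [norm_zero]; positivity)
    (fun t x => by
      split_ifs with hc
      · rw [integral_sub (integrable_of_norm_le fun e => P.norm_mat_le e _) (integrable_const _),
          P.integral_mat]
        simp
      · simp)
    (w := fun t => 16 * s t)
    (fun t x => by
      split_ifs with hc
      · have h1 : ∀ e, ‖P.mat e (P.err η Δ₀ t x) - P.mean (P.err η Δ₀ t x)‖ ^ 2 ≤ 16 * s t := by
          intro e
          have := pow_le_pow_left₀ (norm_nonneg _) (hbd e (P.err η Δ₀ t x)) 2
          nlinarith [hc.2]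
        have h2 := norm_integral_le_of_norm_le_const (μ := ν) (f := fun e =>
          ‖P.mat e (P.err η Δ₀ t x) - P.mean (P.err η Δ₀ t x)‖ ^ 2) (C := 16 * s t)
          (Filter.Eventually.of_forall fun e => by
            rw [Real.norm_of_nonneg (sq_nonneg _)]; exact h1 e)
        simp only [probReal_univ, mul_one] at h2
        exact (le_abs_self _).trans h2
      · simpa using hs0 t)
    (T := T) (W := 16 * W) (L := L)
    (mul_nonneg (by norm_num) ((Finset.sum_nonneg fun t _ => hs0 t).trans hW))
    (by rw [← Finset.mul_sum]; linarith) hL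
  refine (measure_mono ?_).trans h
  rintro ω ⟨h1, h2⟩
  refine h2.trans (le_of_eq ?_)
  congr 1
  refine Finset.sum_congr rfl fun t ht => ?_
  rw [if_pos (h1 t (Finset.mem_range.1 ht))]

omit [Countable E] [DiscreteMeasurableSpace E] [IsProbabilityMeasure ν] in
lemma sum_sqEnvelope_le {α η₀ : ℝ} (hα : 1 / 2 < α) (hα1 : α < 1) (hη : 0 < η₀) (Δ₀ : H) {L : ℝ}
    (hL : 0 ≤ L) (T : ℕ) :
    ∑ t ∈ Finset.range T, P.sqEnvelope α η₀ Δ₀ L t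
      ≤ P.errScale α Δ₀ * L * η₀ * (T : ℝ) ^ (1 - α) / (1 - α)
        + 3 * P.radius α Δ₀ ^ 2 * transient P.β η₀ α := by
  have hn := one_le_transient (α := α) P.β_pos hη
  have hn' : (1 : ℝ) ≤ transient P.β η₀ α := by exact_mod_cast hn
  have hK := P.errScale_pos α Δ₀
  have h1α : 0 < 1 - α := by linarith
  have hsub : ∑ t ∈ Finset.range T, P.sqEnvelope α η₀ Δ₀ L t
      ≤ P.sqEnvelope α η₀ Δ₀ L 0 + ∑ t ∈ Finset.Icc 1 T, P.sqEnvelope α η₀ Δ₀ L t := by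
    rw [← Finset.sum_range_one (fun t => P.sqEnvelope α η₀ Δ₀ L t)]
    refine (Finset.sum_le_sum_of_subset_of_nonneg ?_
      fun t _ _ => P.sqEnvelope_nonneg hη.le Δ₀ hL t).trans (le_of_eq (Finset.sum_union
        (s₁ := Finset.range 1) (s₂ := Finset.Icc 1 T) ?_))
    · intro t ht
      simp only [Finset.mem_union, Finset.mem_range, Finset.mem_Icc] at ht ⊢
      omega
    · rw [Finset.disjoint_left]
      intro t h1 h2
      simp only [Finset.mem_range, Finset.mem_Icc] at h1 h2
      omega
  refine hsub.trans ?_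
  -- At index `0` the step size is `0`, because `0 ^ (-α) = 0`. This extra `R²` turns the `2` of
  -- `sum_envelope_sq_le` into the `3` of the conclusion.
  have h0 : P.sqEnvelope α η₀ Δ₀ L 0 = P.radius α Δ₀ ^ 2 := by
    simp [sqEnvelope, polyStep, envelope, Real.zero_rpow (neg_ne_zero.2 (by linarith : α ≠ 0))]
  have h1 : ∑ t ∈ Finset.Icc 1 T, polyStep η₀ α t ≤ η₀ * ((T : ℝ) ^ (1 - α) / (1 - α)) := by
    simp only [polyStep]
    rw [← Finset.mul_sum]
    exact mul_le_mul_of_nonneg_left (sum_Icc_rpow_neg_le (by linarith) hα1 T) hη.le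
  have h2 := sum_envelope_sq_le hn T
  have h3 : ∑ t ∈ Finset.Icc 1 T, P.sqEnvelope α η₀ Δ₀ L t
      = P.errScale α Δ₀ * L * ∑ t ∈ Finset.Icc 1 T, polyStep η₀ α t
        + P.radius α Δ₀ ^ 2 * ∑ t ∈ Finset.Icc 1 T, envelope (transient P.β η₀ α) t ^ 2 := by
    simp only [sqEnvelope, Finset.sum_add_distrib, Finset.mul_sum]
  rw [h0, h3]
  have h4 := mul_le_mul_of_nonneg_left h1 (by positivity : 0 ≤ P.errScale α Δ₀ * L)
  have h5 := mul_le_mul_of_nonneg_left h2 (sq_nonneg (P.radius α Δ₀))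
  have h6 := mul_le_mul_of_nonneg_left hn' (sq_nonneg (P.radius α Δ₀))
  have e : P.errScale α Δ₀ * L * η₀ * (T : ℝ) ^ (1 - α) / (1 - α)
      = P.errScale α Δ₀ * L * (η₀ * ((T : ℝ) ^ (1 - α) / (1 - α))) := by ring
  rw [e]
  nlinarith

end LinearSA

lemma exp_neg_le_div_rpow {u m : ℝ} (hu : 0 < u) (hm : 0 < m) : Real.exp (-u) ≤ (m / u) ^ m := by
  have h1 : Real.exp (-u) = (Real.exp (-(u / m))) ^ m := by
    rw [← Real.exp_mul]
    field_simp
  rw [h1]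
  refine Real.rpow_le_rpow (Real.exp_nonneg _) ?_ hm.le
  rw [Real.exp_neg, ← inv_div u m]
  gcongr
  linarith [Real.add_one_le_exp (u / m)]

lemma measure_compl_inter_le {Ω : Type*} [MeasurableSpace Ω] {Pr : Measure Ω} {s t u v : Set Ω}
    {δ : ℝ} (hδ : 0 ≤ δ) (hs : Pr s ≤ ENNReal.ofReal (δ / 2)) (ht : Pr t ≤ ENNReal.ofReal (δ / 4))
    (hu : Pr u ≤ ENNReal.ofReal (δ / 4)) (h : v ⊆ s ∪ t ∪ u) : Pr v ≤ ENNReal.ofReal δ :=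
  calc Pr v ≤ Pr (s ∪ t ∪ u) := measure_mono h
    _ ≤ Pr s + Pr t + Pr u := (measure_union_le _ _).trans (by gcongr; exact measure_union_le _ _)
    _ ≤ ENNReal.ofReal (δ / 2) + ENNReal.ofReal (δ / 4) + ENNReal.ofReal (δ / 4) := by gcongr
    _ = _ := by
      rw [← ENNReal.ofReal_add (by positivity) (by positivity),
        ← ENNReal.ofReal_add (by positivity) (by positivity)]
      ring_nf

/-- Passes from `log (4/δ)` to `log (e/δ)` in the leading term; `5 √2 < 8`. -/
lemma five_mul_sqrt_le {v l L : ℝ} (hv : 0 ≤ v) (hl : 0 ≤ l) (hL : L ≤ 2 * l) :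
    5 * √(v * L) ≤ 8 * √(v * l) := by
  have : √(v * L) ≤ √((8 / 5) ^ 2 * (v * l)) := by
    refine Real.sqrt_le_sqrt ?_
    nlinarith [mul_le_mul_of_nonneg_left hL hv, mul_nonneg hv hl]
  rw [Real.sqrt_mul (by positivity) (v * l), Real.sqrt_sq (by norm_num)] at this
  linarith

/-- The exponents match: `α / (1 - α) + 1 = 1 / (1 - α)`, so the transient part of the boundary and
drift costs the same power of `1/η₀` as the transient length itself. -/
lemma transient_rpow_div_le {α β η₀ : ℝ} (hα0 : 0 < α) (hα1 : α < 1) (hβ : 0 < β) (hβ1 : β ≤ 1)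
    (hη : 0 < η₀) (hη1 : η₀ ≤ 1) :
    (transient β η₀ α : ℝ) ^ α / η₀
      ≤ 2 * (4 / β) ^ (1 / (1 - α)) * η₀ ^ (-(1 / (1 - α))) := by
  have h1α : 0 < 1 - α := by linarith
  have hn := transient_le (α := α) hβ hβ1 hη hη1 hα1
  set M := 2 * (4 / β) ^ (1 / (1 - α)) with hM
  have hM1 : 1 ≤ M := by
    have : (1 : ℝ) ≤ (4 / β) ^ (1 / (1 - α)) :=
      Real.one_le_rpow (by rw [le_div_iff₀ hβ]; linarith) (by positivity)
    linarith
  set G := η₀ ^ (-(1 / (1 - α))) with hG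
  have hG0 : 0 < G := by positivity
  have h1 : (transient β η₀ α : ℝ) ^ α ≤ (M * G) ^ α := Real.rpow_le_rpow (by positivity) hn hα0.le
  have h2 : M ^ α ≤ M := by
    conv_rhs => rw [← Real.rpow_one M]
    exact Real.rpow_le_rpow_of_exponent_le hM1 hα1.le
  have h3 : G ^ α / η₀ = G := by
    rw [hG, ← Real.rpow_mul hη.le, ← Real.rpow_sub_one hη.ne']
    congr 1
    field_simp
    ring
  calc _ ≤ (M * G) ^ α / η₀ := by gcongr
    _ = M ^ α * (G ^ α / η₀) := by rw [Real.mul_rpow (by linarith) hG0.le]; ring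
    _ ≤ _ := by rw [h3]; gcongr

/-- Used with `G = η₀ ^ (-1/(1-α))`, `y = T ^ ((1-α)/2)` and `K = log (eT/δ)`: the fluctuation of
the matrix martingale has exactly the shape of the second-order term. -/
lemma sqrt_variance_le {S R η₀ G y K L M n : ℝ} (hS : 0 ≤ S) (hη1 : η₀ ≤ 1) (hG : 1 ≤ G) (hy : 1 ≤ y) (hK : 1 ≤ K) (hL : 0 ≤ L) (hLK : L ≤ 2 * K)
    (hM : 0 ≤ M) (hn : n ≤ M * G) :
    √((S * K * η₀ * (y * y) + 3 * R ^ 2 * n) * L)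
      ≤ √(2 * (S + 3 * R ^ 2 * M)) * (G * y * K) := by
  have h1 : S * K * η₀ * (y * y) ≤ S * (K * (G * y) ^ 2) := by
    calc S * K * η₀ * (y * y) = S * (K * (η₀ * (y * y))) := by ring
      _ ≤ S * (K * (G ^ 2 * (y * y))) := by
        gcongr
        nlinarith
      _ = _ := by ring
  have h2 : n ≤ M * (K * (G * y) ^ 2) := by
    refine hn.trans ?_
    gcongr
    calc G = 1 * (G * 1) := by ring
      _ ≤ K * ((G * y) * (G * y)) := by
        gcongr
        · exact le_mul_of_one_le_right (by linarith) hy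
        · exact one_le_mul_of_one_le_of_one_le hG hy
      _ = _ := by ring
  have h3 : S * K * η₀ * (y * y) + 3 * R ^ 2 * n ≤ (S + 3 * R ^ 2 * M) * (K * (G * y) ^ 2) := by
    have := mul_le_mul_of_nonneg_left h2 (by positivity : 0 ≤ 3 * R ^ 2)
    linarith
  calc _ ≤ √(2 * (S + 3 * R ^ 2 * M) * (G * y * K) ^ 2) := by
        refine Real.sqrt_le_sqrt ?_
        calc _ ≤ (S + 3 * R ^ 2 * M) * (K * (G * y) ^ 2) * (2 * K) := by gcongr
          _ = _ := by ring
    _ = _ := by rw [Real.sqrt_mul (by positivity), Real.sqrt_sq (by positivity)]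

/-! ### Summed errors on the good event, with and without noise. -/

namespace LinearSA

variable {E H : Type*} [MeasurableSpace E] {ν : Measure E}
  [NormedAddCommGroup H] [InnerProductSpace ℝ H] (P : LinearSA ν H)

/-- The factor `√(S L η₀)` is written as `η₀ √(S L / η₀)` because the bound is later divided by
`η₀`. -/
lemma norm_le_of_sqEnvelope {α η₀ : ℝ} (hη : 0 < η₀) {Δ₀ v : H} {L : ℝ} (hL : 0 ≤ L)
    {t : ℕ} (ht : 1 ≤ t) (h : ‖v‖ ^ 2 ≤ P.sqEnvelope α η₀ Δ₀ L t) :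
    ‖v‖ ≤ η₀ * √(P.errScale α Δ₀ * L / η₀) * (t : ℝ) ^ (-(α / 2))
      + P.radius α Δ₀ * envelope (transient P.β η₀ α) t := by
  have ht0 : (0 : ℝ) < t := by exact_mod_cast ht
  have hK := P.errScale_pos α Δ₀
  have hR := P.radius_pos α Δ₀
  have he := envelope_nonneg (transient P.β η₀ α) t
  refine (abs_le_of_sq_le_sq' (h.trans ?_) (by positivity)).2
  have e1 : (η₀ * √(P.errScale α Δ₀ * L / η₀) * (t : ℝ) ^ (-(α / 2))) ^ 2
      = P.errScale α Δ₀ * L * polyStep η₀ α t := by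
    rw [mul_pow, mul_pow, Real.sq_sqrt (by positivity), ← Real.rpow_mul_natCast ht0.le, polyStep]
    have : -(α / 2) * ((2 : ℕ) : ℝ) = -α := by push_cast; ring
    rw [this]
    field_simp
  rw [add_sq, e1, mul_pow, sqEnvelope]
  have : 0 ≤ 2 * (η₀ * √(P.errScale α Δ₀ * L / η₀) * (t : ℝ) ^ (-(α / 2)))
    * (P.radius α Δ₀ * envelope (transient P.β η₀ α) t) := by positivity
  linarith

/-- The stationary part of the error contributes `2 + 4 = 6` times `√(S L / η₀) T ^ (α/2)`, from the
last boundary term and the drift. The transient part contributes `1 + 2` from the boundary and `1/α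
+ 1/(1 - α)` from the drift. -/
lemma norm_boundary_add_drift_le {α η₀ : ℝ} (hα : 1 / 2 < α) (hα1 : α < 1) (hη : 0 < η₀) {Δ₀ : H}
    {L : ℝ} (hL : 0 ≤ L) {T : ℕ} (hT : 1 ≤ T) {x : ℕ → E}
    (hr : ∀ t ≤ T, ‖P.err (polyStep η₀ α) Δ₀ t x‖ ≤ P.radius α Δ₀)
    (he : ∀ t ≤ T, ‖P.err (polyStep η₀ α) Δ₀ t x‖ ^ 2 ≤ P.sqEnvelope α η₀ Δ₀ L t) :
    ‖(polyStep η₀ α 1)⁻¹ • Δ₀ - (polyStep η₀ α (T + 1))⁻¹ • P.err (polyStep η₀ α) Δ₀ T x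
        + ∑ t ∈ Finset.Icc 1 T, ((polyStep η₀ α (t + 1))⁻¹ - (polyStep η₀ α t)⁻¹)
          • P.err (polyStep η₀ α) Δ₀ t x‖
      ≤ 6 * √(P.errScale α Δ₀ * L / η₀) * (T : ℝ) ^ (α / 2)
        + P.radius α Δ₀ * (3 + (1 / α + 1 / (1 - α))) *
          ((transient P.β η₀ α : ℝ) ^ α / η₀) := by
  have hα0 : 0 < α := by linarith
  have hT0 : (0 : ℝ) < T := by exact_mod_cast hT
  have hT1 : (1 : ℝ) ≤ T := by exact_mod_cast hT
  have hn := one_le_transient (α := α) P.β_pos hη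
  have hR := P.radius_pos α Δ₀
  set n := transient P.β η₀ α with hndef
  set R := P.radius α Δ₀ with hRdef
  set D := √(P.errScale α Δ₀ * L / η₀) with hD
  have hD0 : 0 ≤ D := Real.sqrt_nonneg _
  set u : ℕ → H := fun t => P.err (polyStep η₀ α) Δ₀ t x with hu
  have hub : ∀ t, 1 ≤ t → t ≤ T →
      ‖u t‖ ≤ η₀ * D * (t : ℝ) ^ (-(α / 2)) + R * envelope n t := fun t h1 h2 =>
    P.norm_le_of_sqEnvelope hη hL h1 (he t h2)
  have hn1 : (1 : ℝ) ≤ (n : ℝ) ^ α := Real.one_le_rpow (by exact_mod_cast hn) hα0.le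
  have b1 : ‖(polyStep η₀ α 1)⁻¹ • Δ₀‖ ≤ R * ((n : ℝ) ^ α / η₀) := by
    rw [norm_smul, inv_polyStep, Real.norm_of_nonneg (by positivity), mul_comm]
    have : ‖Δ₀‖ ≤ R := hr 0 (Nat.zero_le _)
    gcongr
  have hpow : ((T : ℝ) + 1) ^ α ≤ 2 * (T : ℝ) ^ α := by
    have h1 := rpow_succ_sub_rpow_le hα0.le hα1.le hT
    have h2 : (T : ℝ) ^ (α - 1) ≤ (T : ℝ) ^ α :=
      Real.rpow_le_rpow_of_exponent_le hT1 (by linarith)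
    linarith
  have hTT : (T : ℝ) ^ α * (T : ℝ) ^ (-(α / 2)) = (T : ℝ) ^ (α / 2) := by
    rw [← Real.rpow_add hT0]
    ring_nf
  have b2 : ‖(polyStep η₀ α (T + 1))⁻¹ • u T‖
      ≤ 2 * D * (T : ℝ) ^ (α / 2) + 2 * R * ((n : ℝ) ^ α / η₀) := by
    rw [norm_smul, inv_polyStep, Real.norm_of_nonneg (by positivity)]
    push_cast
    calc ((T : ℝ) + 1) ^ α / η₀ * ‖u T‖
        ≤ 2 * (T : ℝ) ^ α / η₀ * (η₀ * D * (T : ℝ) ^ (-(α / 2)) + R * envelope n T) := by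
          gcongr
          exact hub T hT le_rfl
      _ = 2 * D * ((T : ℝ) ^ α * (T : ℝ) ^ (-(α / 2)))
          + 2 * R * (((T : ℝ) ^ α * envelope n T) / η₀) := by field_simp
      _ ≤ _ := by
          rw [hTT]
          gcongr
          exact rpow_mul_envelope_le hα0.le hα1.le hn hT
  have hs1 : ∑ t ∈ Finset.Icc 1 T, (t : ℝ) ^ (-(1 - α / 2)) ≤ 4 * (T : ℝ) ^ (α / 2) := by
    have h1 := sum_Icc_rpow_neg_le (s := 1 - α / 2) (by linarith) (by linarith) T
    rw [sub_sub_cancel] at h1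
    refine h1.trans ?_
    rw [div_le_iff₀ (by positivity)]
    have : 0 ≤ (T : ℝ) ^ (α / 2) := by positivity
    nlinarith
  have hs2 := sum_rpow_mul_envelope_le hα0 hα1 hn T
  have b3 : ‖∑ t ∈ Finset.Icc 1 T, ((polyStep η₀ α (t + 1))⁻¹ - (polyStep η₀ α t)⁻¹) • u t‖
      ≤ 4 * D * (T : ℝ) ^ (α / 2) + R * (1 / α + 1 / (1 - α)) * ((n : ℝ) ^ α / η₀) := by
    calc _ ≤ ∑ t ∈ Finset.Icc 1 T, (D * (t : ℝ) ^ (-(1 - α / 2))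
          + R / η₀ * ((t : ℝ) ^ (α - 1) * envelope n t)) := by
          refine norm_sum_le_of_le _ fun t ht => ?_
          obtain ⟨ht1, htT⟩ := Finset.mem_Icc.1 ht
          have ht0 : (0 : ℝ) < t := by exact_mod_cast ht1
          have h0 : (t : ℝ) ^ α ≤ ((t : ℝ) + 1) ^ α :=
            Real.rpow_le_rpow ht0.le (by linarith) hα0.le
          have h1 := rpow_succ_sub_rpow_le hα0.le hα1.le ht1
          have hw : (0 : ℝ) ≤ (((t : ℝ) + 1) ^ α - (t : ℝ) ^ α) / η₀ :=
            div_nonneg (by linarith) hη.le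
          rw [norm_smul, inv_polyStep, inv_polyStep, ← sub_div]
          push_cast
          rw [Real.norm_of_nonneg hw]
          have e : (t : ℝ) ^ (α - 1) * (t : ℝ) ^ (-(α / 2)) = (t : ℝ) ^ (-(1 - α / 2)) := by
            rw [← Real.rpow_add ht0]
            ring_nf
          calc _ ≤ (t : ℝ) ^ (α - 1) / η₀
                * (η₀ * D * (t : ℝ) ^ (-(α / 2)) + R * envelope n t) := by
                gcongr
                exact hub t ht1 htT
            _ = D * ((t : ℝ) ^ (α - 1) * (t : ℝ) ^ (-(α / 2)))
                + R / η₀ * ((t : ℝ) ^ (α - 1) * envelope n t) := by field_simp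
            _ = _ := by rw [e]
      _ = D * ∑ t ∈ Finset.Icc 1 T, (t : ℝ) ^ (-(1 - α / 2))
          + R / η₀ * ∑ t ∈ Finset.Icc 1 T, (t : ℝ) ^ (α - 1) * envelope n t := by
          rw [Finset.sum_add_distrib, Finset.mul_sum, Finset.mul_sum]
      _ ≤ D * (4 * (T : ℝ) ^ (α / 2))
          + R / η₀ * ((n : ℝ) ^ α * (1 / α + 1 / (1 - α))) := by gcongr
      _ = _ := by ring
  calc _ ≤ ‖(polyStep η₀ α 1)⁻¹ • Δ₀‖ + ‖(polyStep η₀ α (T + 1))⁻¹ • u T‖ + _ :=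
        (norm_add_le _ _).trans (add_le_add (norm_sub_le _ _) le_rfl)
    _ ≤ _ := by linarith

/-- A deterministic bound for the summed errors along a well-behaved trajectory. -/
lemma norm_sum_err_le {α η₀ : ℝ} (hα : 1 / 2 < α) (hα1 : α < 1) (hη : 0 < η₀) {Δ₀ : H}
    {L a b : ℝ} (hL : 0 ≤ L) {T : ℕ} (hT : 1 ≤ T) {x : ℕ → E}
    (h : ∀ t ≤ T, ‖P.err (polyStep η₀ α) Δ₀ t x‖ ≤ P.radius α Δ₀ ∧
      ‖P.err (polyStep η₀ α) Δ₀ t x‖ ^ 2 ≤ P.sqEnvelope α η₀ Δ₀ L t)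
    (ha : ‖∑ t ∈ Finset.range T, P.inv (P.noise (x (t + 1)))‖ ≤ a)
    (hb : ‖∑ t ∈ Finset.range T, (P.mat (x (t + 1)) (P.err (polyStep η₀ α) Δ₀ t x)
      - P.mean (P.err (polyStep η₀ α) Δ₀ t x))‖ ≤ b) :
    ‖∑ t ∈ Finset.Icc 1 T, P.err (polyStep η₀ α) Δ₀ t x‖
      ≤ ‖P.inv‖ * (6 * √(P.errScale α Δ₀ * L / η₀) * (T : ℝ) ^ (α / 2)
        + P.radius α Δ₀ * (3 + (1 / α + 1 / (1 - α))) * ((transient P.β η₀ α : ℝ) ^ α / η₀))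
        + a + ‖P.inv‖ * b + 2 * P.radius α Δ₀ := by
  have hD := P.norm_boundary_add_drift_le hα hα1 hη hL hT (fun t ht => (h t ht).1)
    (fun t ht => (h t ht).2)
  rw [P.sum_err_eq (polyStep η₀ α) (fun t ht => (polyStep_pos hη ht).ne') Δ₀ x T]
  have n3 : ‖P.err (polyStep η₀ α) Δ₀ T x - Δ₀‖ ≤ 2 * P.radius α Δ₀ := by
    have a1 := (h T le_rfl).1
    have a2 : ‖Δ₀‖ ≤ P.radius α Δ₀ := (h 0 (Nat.zero_le _)).1
    exact (norm_sub_le _ _).trans (by linarith)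
  refine (norm_add_le _ _).trans (add_le_add ((norm_sub_le _ _).trans
    (add_le_add ((norm_sub_le _ _).trans (add_le_add ?_ ha)) ?_)) n3)
  · exact (P.inv.le_opNorm _).trans (mul_le_mul_of_nonneg_left hD (norm_nonneg _))
  · exact (P.inv.le_opNorm _).trans (mul_le_mul_of_nonneg_left hb (norm_nonneg _))

variable [Countable E] [DiscreteMeasurableSpace E] [IsProbabilityMeasure ν] [CompleteSpace H]

/-- Noisy case of the bound for the summed errors. -/
lemma exists_measure_sum_err_le_of_avar_pos (hσ : 0 < P.avar) {α : ℝ} (hα : 1 / 2 < α)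
    (hα1 : α < 1) (Δ₀ : H) :
    ∃ K : ℝ, 0 < K ∧ ∀ δ η₀ : ℝ, 0 < δ → δ < 1 → 0 < η₀ → η₀ < 1 / 2 →
      η₀ * √(Real.log (1 / (δ * η₀))) ≤ 1 →
      ∀ (Ω : Type w) [MeasurableSpace Ω] (Pr : Measure Ω) [IsProbabilityMeasure Pr]
        (X : ℕ → Ω → E), (∀ t, Measurable (X t)) → iIndepFun X Pr → (∀ t, Pr.map (X t) = ν) →
        ∀ T : ℕ, 1 ≤ T →
          Pr {ω | ¬ ‖∑ t ∈ Finset.Icc 1 T, P.err (polyStep η₀ α) Δ₀ t fun i => X i ω‖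
            ≤ 9 * √(T * P.avar * (1 + Real.log (1 / δ)))
              + K * η₀ ^ (-(1 / (1 - α))) * (T : ℝ) ^ ((1 - α) / 2)
                * (1 + Real.log T + Real.log (1 / δ))} ≤ ENNReal.ofReal δ := by
  have hα0 : 0 < α := by linarith
  have h1α : 0 < 1 - α := by linarith
  have hR := P.radius_pos α Δ₀
  have hS := P.errScale_pos α Δ₀
  have hB := P.B_nonneg
  have hβ := P.β_pos
  set R := P.radius α Δ₀ with hRdef
  set S := P.errScale α Δ₀ with hSdef
  set N := ‖P.inv‖ with hN
  have hN0 : 0 ≤ N := norm_nonneg _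
  obtain ⟨M₁, hM₁, habs⟩ := exists_absorb (s := P.avar) (A₀ := 6 * N * √S) hα hα1 hσ (by positivity)
  set M₂ := 2 * (4 / P.β) ^ (1 / (1 - α)) with hM₂
  have hM₂1 : 1 ≤ M₂ := by
    have : (1 : ℝ) ≤ (4 / P.β) ^ (1 / (1 - α)) :=
      Real.one_le_rpow (by rw [le_div_iff₀ hβ]; linarith [P.β_le]) (by positivity)
    linarith
  set c := 1 / α + 1 / (1 - α) with hc
  have hc0 : 0 < c := by positivity
  set Q := S / (1 - α) + 3 * R ^ 2 * M₂ with hQ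
  have hQ0 : 0 < Q := by positivity
  -- The summands come from the absorbed boundary term, the transient, the linear Bernstein term of
  -- the noise, the matrix martingale, and the index shift `Δ_T - Δ₀`.
  refine ⟨M₁ + N * (R * (3 + c) * M₂) + 6 * (N * P.B + 1) + N * (20 * √(2 * Q) + 24 * R) + 2 * R,
    by positivity, fun δ η₀ hδ hδ1 hη hη1 hs Ω _ Pr _ X hX hind hlaw T hT => ?_⟩
  have hT1 : (1 : ℝ) ≤ T := by exact_mod_cast hT
  have hT0 : (0 : ℝ) < T := by linarith
  have hlogT : 0 ≤ Real.log T := Real.log_nonneg hT1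
  have hlogδ : 0 ≤ Real.log (1 / δ) := Real.log_nonneg (by rw [le_div_iff₀ hδ]; linarith)
  set Lg := 1 + Real.log T + Real.log (1 / δ) with hLg
  set l := 1 + Real.log (1 / δ) with hl
  have hLg1 : 1 ≤ Lg := by linarith
  have hLgT : Lg = l + Real.log T := by rw [hLg, hl]; ring
  set L := Real.log (4 / δ) with hL
  have hL1 : 1 ≤ L := by linarith [(log_four_div hδ).2]
  have hLl : L ≤ 2 * l := by linarith [(log_four_div hδ).1]
  have hLLg : L ≤ 2 * Lg := by linarith
  have hexpL : Real.exp (-L) = δ / 4 := exp_neg_log_div hδ (by norm_num)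
  set G := η₀ ^ (-(1 / (1 - α))) with hG
  have hG1 : 1 ≤ G := by
    refine Real.one_le_rpow_of_pos_of_le_one_of_nonpos hη (by linarith) ?_
    have : 0 < 1 / (1 - α) := by positivity
    linarith
  have hG0 : 0 < G := by linarith
  set y := (T : ℝ) ^ ((1 - α) / 2) with hy
  have hy1 : 1 ≤ y := Real.one_le_rpow hT1 (by positivity)
  have hyy : (T : ℝ) ^ (1 - α) = y * y := by
    rw [hy, ← Real.rpow_add hT0]
    ring_nf
  have hn : (transient P.β η₀ α : ℝ) ≤ M₂ * G := transient_le hβ P.β_le hη (by linarith) hα1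
  have hnα : (transient P.β η₀ α : ℝ) ^ α / η₀ ≤ M₂ * G :=
    transient_rpow_div_le hα0 hα1 hβ P.β_le hη (by linarith)
  have hGy : 1 ≤ G * y := one_le_mul_of_one_le_of_one_le hG1 hy1
  have hGyL : 1 ≤ G * y * Lg := one_le_mul_of_one_le_of_one_le hGy hLg1
  set W := S * Lg * η₀ * (T : ℝ) ^ (1 - α) / (1 - α) + 3 * R ^ 2 * transient P.β η₀ α with hW
  have hsW : √(W * L) ≤ √(2 * Q) * (G * y * Lg) := by
    have e : W = S / (1 - α) * Lg * η₀ * (y * y) + 3 * R ^ 2 * transient P.β η₀ α := by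
      rw [hW, hyy]
      ring
    rw [e]
    exact sqrt_variance_le (by positivity) (by linarith) hG1 hy1 hLg1 (by linarith) hLLg
      (by linarith) hn
  have e1 := P.measure_not_sqEnvelope_le hX hind hlaw hα hα1 hδ hδ1 hη hη1 hs Δ₀ hT
  rw [log_exp_mul_div hT hδ] at e1
  have e2 := P.measure_sum_inv_noise_le hX hind hlaw T hL1
  have e3 := P.measure_sum_mat_sub_mean_le hX hind hlaw (polyStep η₀ α) Δ₀ hR
    (s := P.sqEnvelope α η₀ Δ₀ Lg) (fun t => P.sqEnvelope_nonneg hη.le Δ₀ (by linarith) t) hL1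
    (P.sum_sqEnvelope_le hα hα1 hη Δ₀ (by linarith) T)
  rw [hexpL] at e2 e3
  refine measure_compl_inter_le hδ.le e1 e2 e3 ?_
  intro ω hω
  by_contra hcon
  simp only [Set.mem_union, Set.mem_ofPred_eq, not_or, not_and, not_not, not_le] at hcon
  obtain ⟨⟨h1, h2⟩, h3⟩ := hcon
  refine hω ((P.norm_sum_err_le hα hα1 hη (by linarith : 0 ≤ Lg) hT h1 h2.le
    (h3 fun t ht => h1 t ht.le).le).trans ?_)
  have hab := habs η₀ l T hη (by linarith) (by linarith) hT
  rw [← hLgT] at hab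
  have s1 : 6 * N * √S * √(Lg / η₀) * (T : ℝ) ^ (α / 2)
      = N * (6 * √(S * Lg / η₀) * (T : ℝ) ^ (α / 2)) := by
    rw [mul_div_assoc, Real.sqrt_mul hS.le]
    ring
  rw [s1] at hab
  have s2 : √(16 * W * L) = 4 * √(W * L) := by
    rw [mul_assoc, Real.sqrt_mul (by norm_num), show (16 : ℝ) = 4 ^ 2 by norm_num,
      Real.sqrt_sq (by norm_num)]
  have s3 : 5 * √(T * P.avar * L) ≤ 8 * √(T * P.avar * l) :=
    five_mul_sqrt_le (mul_nonneg hT0.le hσ.le) (by linarith) hLl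
  have g1 : G ≤ G * y * Lg := by
    rw [mul_assoc]
    exact le_mul_of_one_le_right hG0.le (one_le_mul_of_one_le_of_one_le hy1 hLg1)
  have g2 : L ≤ 2 * (G * y * Lg) :=
    hLLg.trans (by gcongr; exact le_mul_of_one_le_left (by linarith) hGy)
  have t1 : N * (R * (3 + c) * ((transient P.β η₀ α : ℝ) ^ α / η₀))
      ≤ N * (R * (3 + c) * (M₂ * (G * y * Lg))) := by
    gcongr
    exact hnα.trans (by gcongr)
  have t2 : 3 * (N * P.B + 1) * L ≤ 3 * (N * P.B + 1) * (2 * (G * y * Lg)) := by gcongr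
  have t3 : N * (20 * √(W * L) + 12 * R * L)
      ≤ N * (20 * (√(2 * Q) * (G * y * Lg)) + 12 * R * (2 * (G * y * Lg))) := by gcongr
  have t4 : 2 * R ≤ 2 * R * (G * y * Lg) := le_mul_of_one_le_right (by positivity) hGyL
  have f1 : N * (6 * √(S * Lg / η₀) * (T : ℝ) ^ (α / 2)
        + R * (3 + c) * ((transient P.β η₀ α : ℝ) ^ α / η₀))
        + (5 * √(T * P.avar * L) + 3 * (N * P.B + 1) * L)
        + N * (5 * √(16 * W * L) + 3 * (4 * R) * L) + 2 * R
      = N * (6 * √(S * Lg / η₀) * (T : ℝ) ^ (α / 2)) + 5 * √(T * P.avar * L)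
        + N * (R * (3 + c) * ((transient P.β η₀ α : ℝ) ^ α / η₀)) + 3 * (N * P.B + 1) * L
        + N * (20 * √(W * L) + 12 * R * L) + 2 * R := by
    rw [s2]
    ring
  have f2 : 9 * √(T * P.avar * l) + (M₁ + N * (R * (3 + c) * M₂) + 6 * (N * P.B + 1)
        + N * (20 * √(2 * Q) + 24 * R) + 2 * R) * G * y * Lg
      = (√(T * P.avar * l) + M₁ * G * y * Lg) + 8 * √(T * P.avar * l)
        + N * (R * (3 + c) * (M₂ * (G * y * Lg))) + 3 * (N * P.B + 1) * (2 * (G * y * Lg))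
        + N * (20 * (√(2 * Q) * (G * y * Lg)) + 12 * R * (2 * (G * y * Lg)))
        + 2 * R * (G * y * Lg) := by
    ring
  rw [f1, f2]
  exact add_le_add (add_le_add (add_le_add (add_le_add (add_le_add hab s3) t1) t2) t3) t4

/-- Noiseless case of the bound for the summed errors. -/
lemma exists_measure_sum_err_le_of_avar_eq_zero (hσ : P.avar = 0) {α : ℝ} (hα : 1 / 2 < α)
    (hα1 : α < 1) (Δ₀ : H) :
    ∃ K : ℝ, 0 < K ∧ ∀ δ η₀ : ℝ, 0 < δ → δ < 1 → 0 < η₀ → η₀ < 1 / 2 →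
      η₀ * √(Real.log (1 / (δ * η₀))) ≤ 1 →
      ∀ (Ω : Type w) [MeasurableSpace Ω] (Pr : Measure Ω) [IsProbabilityMeasure Pr]
        (X : ℕ → Ω → E), (∀ t, Measurable (X t)) → iIndepFun X Pr → (∀ t, Pr.map (X t) = ν) →
        ∀ T : ℕ, 1 ≤ T →
          Pr {ω | ¬ ‖∑ t ∈ Finset.Icc 1 T, P.err (polyStep η₀ α) Δ₀ t fun i => X i ω‖
            ≤ K * η₀ ^ (-(1 / (1 - α)))} ≤ ENNReal.ofReal δ := by
  have hα0 : 0 < α := by linarith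
  have h1α : 0 < 1 - α := by linarith
  have hR := P.radius_pos α Δ₀
  have hβ := P.β_pos
  have hB := P.B_nonneg
  set R := P.radius α Δ₀ with hRdef
  -- With this exponent `(t ^ (1 - α)) ^ m = t²`, so `exp (-u) ≤ (m/u) ^ m` yields a summable
  -- `(n/t)²` decay; the `4` in `M` matches the one in `transient`.
  set m := 2 / (1 - α) with hm
  have hm4 : 4 ≤ m := by rw [hm, le_div_iff₀ h1α]; linarith
  have hm0 : 0 < m := by linarith
  set M := (m / 4) ^ m with hM
  have hM1 : 1 ≤ M := Real.one_le_rpow (by linarith) hm0.le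
  have hnoise : ∀ᵐ y ∂ν, P.noise y = 0 := by
    have hint : Integrable (fun e => ‖P.inv (P.noise e)‖ ^ 2) ν :=
      Integrable.of_bound StronglyMeasurable.of_discrete.aestronglyMeasurable
        ((‖P.inv‖ * P.B) ^ 2) (Filter.Eventually.of_forall fun e => by
          rw [Real.norm_of_nonneg (sq_nonneg _)]
          refine pow_le_pow_left₀ (norm_nonneg _) ((P.inv.le_opNorm _).trans ?_) 2
          exact mul_le_mul_of_nonneg_left (P.noise_le e) (norm_nonneg _))
    have h := (integral_eq_zero_iff_of_nonneg (fun e => sq_nonneg ‖P.inv (P.noise e)‖) hint).1 hσ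
    filter_upwards [h] with y hy
    have h0 : P.inv (P.noise y) = 0 := by simpa using hy
    rw [← P.mean_inv (P.noise y), h0, map_zero]
  refine ⟨R * M * (2 * (2 * (4 / P.β) ^ (1 / (1 - α)))), by positivity,
    fun δ η₀ hδ hδ1 hη hη1 hs Ω _ Pr _ X hX hind hlaw T hT => ?_⟩
  -- Without noise no additive offset is needed, and the full contraction rate `2β` of the squared
  -- norm is available.
  have e1 := P.measure_radius_le hX hind hlaw (κ := 0) (ρ := 2 * P.β) le_rfl zero_le_one
    (by filter_upwards [hnoise] with y hy; simp [hy]) (fun v => by rw [add_zero]) hα hδ hδ1 hη hη1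
    hs Δ₀ T
  set n := transient P.β η₀ α with hndef
  have hn1 : 1 ≤ n := one_le_transient hβ hη
  have hn := transient_le (α := α) hβ P.β_le hη (by linarith) hα1
  refine (measure_mono ?_).trans (e1.trans (ENNReal.ofReal_le_ofReal (by linarith)))
  intro ω hω
  by_contra hcon
  simp only [Set.mem_ofPred_eq, not_exists, not_and, not_le, add_zero] at hcon
  refine hω ?_
  set u : ℕ → H := fun t => P.err (polyStep η₀ α) Δ₀ t fun i => X i ω with hu
  have hub : ∀ t, 1 ≤ t → t ≤ T → ‖u t‖ ≤ R * M * envelope n t ^ 2 := by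
    intro t ht1 htT
    have ht0 : (0 : ℝ) < t := by exact_mod_cast ht1
    have hsum := mul_rpow_le_sum_polyStep hη.le hα0 ht1
    have h1 : ‖u t‖ ≤ R * Real.exp (-(P.β * ∑ i ∈ Finset.Icc 1 t, polyStep η₀ α i)) := by
      refine (abs_le_of_sq_le_sq' ((hcon t htT).le.trans (le_of_eq ?_)) (by positivity)).2
      rw [mul_pow, ← Real.exp_nat_mul]
      congr 2
      push_cast
      ring
    refine h1.trans ?_
    rw [mul_assoc]
    refine mul_le_mul_of_nonneg_left ?_ hR.le
    unfold envelope
    split_ifs with htn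
    · have : Real.exp (-(P.β * ∑ i ∈ Finset.Icc 1 t, polyStep η₀ α i)) ≤ 1 := by
        refine Real.exp_le_one_iff.2 ?_
        have : 0 ≤ P.β * ∑ i ∈ Finset.Icc 1 t, polyStep η₀ α i :=
          mul_nonneg hβ.le (Finset.sum_nonneg fun i _ => polyStep_nonneg hη.le i)
        linarith
      simpa using this.trans hM1
    · calc _ ≤ Real.exp (-(P.β * (η₀ * (t : ℝ) ^ (1 - α)))) := by gcongr
        _ ≤ (m / (P.β * (η₀ * (t : ℝ) ^ (1 - α)))) ^ m :=
          exp_neg_le_div_rpow (by positivity) hm0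
        _ = M * ((4 / (P.β * η₀)) ^ m / (t : ℝ) ^ 2) := by
          have e2 : m / (P.β * (η₀ * (t : ℝ) ^ (1 - α)))
              = m / 4 * (4 / (P.β * η₀)) / (t : ℝ) ^ (1 - α) := by field_simp
          have e3 : ((t : ℝ) ^ (1 - α)) ^ m = (t : ℝ) ^ 2 := by
            rw [← Real.rpow_mul ht0.le, hm, mul_div_cancel₀ _ h1α.ne', Real.rpow_two]
          rw [e2, Real.div_rpow (by positivity) (by positivity), e3,
            Real.mul_rpow (by positivity) (by positivity), mul_div_assoc]
        _ ≤ M * ((n : ℝ) / t) ^ 2 := by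
          rw [div_pow]
          gcongr
          have h2 : (4 / (P.β * η₀)) ^ (1 / (1 - α)) ≤ (n : ℝ) := Nat.le_ceil _
          have h3 := pow_le_pow_left₀ (by positivity) h2 2
          rw [← Real.rpow_mul_natCast (by positivity)] at h3
          refine le_trans (le_of_eq ?_) h3
          congr 1
          rw [hm]
          push_cast
          ring
  calc ‖∑ t ∈ Finset.Icc 1 T, u t‖ ≤ ∑ t ∈ Finset.Icc 1 T, R * M * envelope n t ^ 2 :=
        norm_sum_le_of_le _ fun t ht => hub t (Finset.mem_Icc.1 ht).1 (Finset.mem_Icc.1 ht).2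
    _ ≤ R * M * (2 * n) := by
        rw [← Finset.mul_sum]
        exact mul_le_mul_of_nonneg_left (sum_envelope_sq_le hn1 T) (by positivity)
    _ ≤ R * M * (2 * (2 * (4 / P.β) ^ (1 / (1 - α)) * η₀ ^ (-(1 / (1 - α))))) := by gcongr
    _ = _ := by ring

/-- High-probability bound for the averaged error of a linear stochastic approximation scheme. -/
theorem exists_measure_average_err_le {α : ℝ} (hα : 1 / 2 < α) (hα1 : α < 1) (Δ₀ : H) :
    ∃ K : ℝ, 0 < K ∧ ∀ δ η₀ : ℝ, 0 < δ → δ < 1 → 0 < η₀ → η₀ < 1 / 2 →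
      η₀ * √(Real.log (1 / (δ * η₀))) ≤ 1 →
      ∀ (Ω : Type w) [MeasurableSpace Ω] (Pr : Measure Ω) [IsProbabilityMeasure Pr]
        (X : ℕ → Ω → E), (∀ t, Measurable (X t)) → iIndepFun X Pr → (∀ t, Pr.map (X t) = ν) →
        ∀ T : ℕ, 1 ≤ T →
          ENNReal.ofReal (1 - δ) ≤
            Pr {ω | ‖(1 / (T : ℝ)) • ∑ t ∈ Finset.Icc 1 T,
                P.err (polyStep η₀ α) Δ₀ t fun i => X i ω‖
              ≤ 9 * √(P.avar / T * Real.log (Real.exp 1 / δ))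
                + K * η₀ ^ (-(1 / (1 - α))) * (T : ℝ) ^ (-((α + 1) / 2))
                  * Real.log (Real.exp 1 * T / δ)} := by
  obtain ⟨K, hK, h⟩ : ∃ K : ℝ, 0 < K ∧ ∀ δ η₀ : ℝ, 0 < δ → δ < 1 → 0 < η₀ → η₀ < 1 / 2 →
      η₀ * √(Real.log (1 / (δ * η₀))) ≤ 1 →
      ∀ (Ω : Type w) [MeasurableSpace Ω] (Pr : Measure Ω) [IsProbabilityMeasure Pr]
        (X : ℕ → Ω → E), (∀ t, Measurable (X t)) → iIndepFun X Pr → (∀ t, Pr.map (X t) = ν) →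
        ∀ T : ℕ, 1 ≤ T →
          Pr {ω | ¬ ‖∑ t ∈ Finset.Icc 1 T, P.err (polyStep η₀ α) Δ₀ t fun i => X i ω‖
            ≤ 9 * √(T * P.avar * (1 + Real.log (1 / δ)))
              + K * η₀ ^ (-(1 / (1 - α))) * (T : ℝ) ^ ((1 - α) / 2)
                * (1 + Real.log T + Real.log (1 / δ))} ≤ ENNReal.ofReal δ := by
    rcases P.avar_nonneg.eq_or_lt with hσ | hσ
    · obtain ⟨K, hK, h⟩ := P.exists_measure_sum_err_le_of_avar_eq_zero hσ.symm hα hα1 Δ₀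
      refine ⟨K, hK, fun δ η₀ hδ hδ1 hη hη1 hs Ω _ Pr _ X hX hind hlaw T hT => ?_⟩
      refine le_trans (measure_mono ?_) (h δ η₀ hδ hδ1 hη hη1 hs Ω Pr X hX hind hlaw T hT)
      intro ω hω hle
      refine hω (hle.trans ?_)
      have hT1 : (1 : ℝ) ≤ T := by exact_mod_cast hT
      have hlogδ : 0 ≤ Real.log (1 / δ) := Real.log_nonneg (by rw [le_div_iff₀ hδ]; linarith)
      have h1 : (1 : ℝ) ≤ (T : ℝ) ^ ((1 - α) / 2) := Real.one_le_rpow hT1 (by linarith)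
      have h2 : 1 ≤ 1 + Real.log T + Real.log (1 / δ) := by linarith [Real.log_nonneg hT1]
      rw [mul_assoc (K * _)]
      refine le_trans ?_ (le_add_of_nonneg_left (by positivity))
      exact le_mul_of_one_le_right (by positivity) (one_le_mul_of_one_le_of_one_le h1 h2)
    · exact P.exists_measure_sum_err_le_of_avar_pos hσ hα hα1 Δ₀
  refine ⟨K, hK, fun δ η₀ hδ hδ1 hη hη1 hs Ω _ Pr _ X hX hind hlaw T hT => ?_⟩
  have hT0 : (0 : ℝ) < T := by exact_mod_cast hT
  have hbad := h δ η₀ hδ hδ1 hη hη1 hs Ω Pr X hX hind hlaw T hT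
  set good := {ω | ‖(1 / (T : ℝ)) • ∑ t ∈ Finset.Icc 1 T,
                P.err (polyStep η₀ α) Δ₀ t fun i => X i ω‖
              ≤ 9 * √(P.avar / T * Real.log (Real.exp 1 / δ))
                + K * η₀ ^ (-(1 / (1 - α))) * (T : ℝ) ^ (-((α + 1) / 2))
                  * Real.log (Real.exp 1 * T / δ)} with hgood
  have hc : Pr goodᶜ ≤ ENNReal.ofReal δ := by
    refine le_trans (measure_mono ?_) hbad
    intro ω hω hle
    refine hω ?_
    have hle' := mul_le_mul_of_nonneg_left hle (by positivity : 0 ≤ 1 / (T : ℝ))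
    rw [hgood, Set.mem_ofPred_eq, norm_smul, Real.norm_of_nonneg (by positivity)]
    refine hle'.trans (le_of_eq ?_)
    have e0 : Real.log (Real.exp 1 / δ) = 1 + Real.log (1 / δ) := by
      have := log_exp_mul_div le_rfl hδ
      simpa using this
    rw [e0, log_exp_mul_div hT hδ, mul_add]
    congr 1
    · have : T * P.avar * (1 + Real.log (1 / δ))
          = (T : ℝ) ^ 2 * (P.avar / T * (1 + Real.log (1 / δ))) := by field_simp
      rw [this, Real.sqrt_mul (by positivity), Real.sqrt_sq hT0.le]
      field_simp
    · have : (T : ℝ) ^ (-((α + 1) / 2)) = (T : ℝ) ^ ((1 - α) / 2) / T := by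
        rw [← Real.rpow_sub_one hT0.ne']
        congr 1
        ring
      rw [this]
      ring
  -- Subadditivity suffices here, so measurability of the event is not needed.
  have h1 : (1 : ℝ≥0∞) ≤ Pr good + Pr goodᶜ := by
    rw [← measure_univ (μ := Pr), ← Set.union_compl_self good]
    exact measure_union_le _ _
  rw [ENNReal.ofReal_sub _ hδ.le, ENNReal.ofReal_one, tsub_le_iff_right]
  exact h1.trans (by gcongr)

end LinearSA

/-! ### Temporal difference learning as a linear scheme. -/

lemma Matrix.PosDef.exists_pos_mul_norm_sq_le {d : ℕ} {Q : Matrix (Fin d) (Fin d) ℝ}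
    (hQ : Q.PosDef) : ∃ c : ℝ, 0 < c ∧ ∀ v : EuclideanSpace ℝ (Fin d),
      c * ‖v‖ ^ 2 ≤ ∑ i, ∑ j, v i * Q i j * v j := by
  set q : EuclideanSpace ℝ (Fin d) → ℝ := fun v => ∑ i, ∑ j, v i * Q i j * v j with hq
  have hqc : Continuous q := by
    rw [hq]
    fun_prop
  have hpos : ∀ v, v ≠ 0 → 0 < q v := by
    intro v hv
    have h := hQ.dotProduct_mulVec_pos (x := fun i => v i) (by
      intro h0
      apply hv
      ext i
      exact congrFun h0 i)
    simp only [dotProduct, Matrix.mulVec, Finset.mul_sum] at h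
    simpa [hq, mul_assoc] using h
  have hsmul : ∀ (r : ℝ) v, q (r • v) = r ^ 2 * q v := by
    intro r v
    simp only [hq, Finset.mul_sum, PiLp.smul_apply, smul_eq_mul]
    exact Finset.sum_congr rfl fun i _ => Finset.sum_congr rfl fun j _ => by ring
  rcases isEmpty_or_nonempty (Fin d) with hd | hd
  · refine ⟨1, one_pos, fun v => ?_⟩
    have : v = 0 := Subsingleton.elim _ _
    simp [this]
  · obtain ⟨u, hu, hmin⟩ := (isCompact_sphere (0 : EuclideanSpace ℝ (Fin d)) 1).exists_isMinOn
      (NormedSpace.sphere_nonempty.2 zero_le_one) hqc.continuousOn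
    have hu0 : u ≠ 0 := by
      rintro rfl
      simp at hu
    refine ⟨q u, hpos u hu0, fun v => ?_⟩
    by_cases hv : v = 0
    · simp [hv]
    · have hn : 0 < ‖v‖ := norm_pos_iff.2 hv
      have h1 : q u ≤ q (‖v‖⁻¹ • v) := hmin (by simp [norm_smul, hn.ne'])
      rw [hsmul, inv_pow, ← div_eq_inv_mul, le_div_iff₀ (by positivity)] at h1
      exact h1

namespace MDP

variable {S A : Type*} [Countable S] [Countable A]
  [MeasurableSpace S] [DiscreteMeasurableSpace S] [MeasurableSpace A] [DiscreteMeasurableSpace A]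
  (M : MDP S A) {π : S → PMF A} {μ : PMF S} {d : ℕ} {φ : S → EuclideanSpace ℝ (Fin d)}

omit [Countable S] [Countable A] [MeasurableSpace S] [DiscreteMeasurableSpace S]
  [MeasurableSpace A] [DiscreteMeasurableSpace A] in
lemma map_fst_sampleLaw : (M.sampleLaw π μ).map (fun x => x.1) = μ := by
  have h : ∀ (s : S) (p : PMF S), p.map (fun _ => s) = PMF.pure s := fun s p => p.map_const s
  simp only [sampleLaw, PMF.map_bind, PMF.map_comp]
  simp [Function.comp_def, h]

omit [Countable S] [Countable A] [MeasurableSpace S] [DiscreteMeasurableSpace S]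
  [MeasurableSpace A] [DiscreteMeasurableSpace A] in
lemma map_snd_sampleLaw (h : M.IsStationary π μ) :
    (M.sampleLaw π μ).map (fun x => x.2.2) = μ := by
  have h' : ∀ p : PMF S, p.map (fun s => s) = p := fun p => p.map_id
  refine Eq.trans ?_ h
  simp only [sampleLaw, PMF.map_bind, PMF.map_comp]
  simp only [Function.comp_def, h']
  rfl

lemma integral_comp_fst (f : S → ℝ) :
    ∫ x, f x.1 ∂(M.sampleLaw π μ).toMeasure = ∫ s, f s ∂μ.toMeasure := by
  conv_rhs => rw [← M.map_fst_sampleLaw (π := π) (μ := μ)]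
  rw [← PMF.toMeasure_map _ _ Measurable.of_discrete,
    integral_map Measurable.of_discrete.aemeasurable
      StronglyMeasurable.of_discrete.aestronglyMeasurable]

lemma integral_comp_snd (h : M.IsStationary π μ) (f : S → ℝ) :
    ∫ x, f x.2.2 ∂(M.sampleLaw π μ).toMeasure = ∫ s, f s ∂μ.toMeasure := by
  conv_rhs => rw [← M.map_snd_sampleLaw h]
  rw [← PMF.toMeasure_map _ _ Measurable.of_discrete,
    integral_map Measurable.of_discrete.aemeasurable
      StronglyMeasurable.of_discrete.aestronglyMeasurable]

omit [Countable S] [Countable A] [MeasurableSpace S] [DiscreteMeasurableSpace S]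
  [MeasurableSpace A] [DiscreteMeasurableSpace A] in
lemma toEuclideanLin_sampleA (x : S × A × S) (v : EuclideanSpace ℝ (Fin d)) :
    Matrix.toEuclideanLin (M.sampleA φ x) v = ⟪φ x.1 - M.γ • φ x.2.2, v⟫ • φ x.1 := by
  ext i
  simp only [Matrix.toLpLin_apply, Matrix.mulVec, dotProduct, sampleA, Matrix.of_apply,
    PiLp.smul_apply, PiLp.inner_apply, PiLp.sub_apply, smul_eq_mul, Finset.sum_mul]
  refine Finset.sum_congr rfl fun j _ => ?_
  simp
  ring

/-- The matrix of one sample as a continuous linear map. -/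
noncomputable def sampleCLM (φ : S → EuclideanSpace ℝ (Fin d)) (x : S × A × S) :
    EuclideanSpace ℝ (Fin d) →L[ℝ] EuclideanSpace ℝ (Fin d) :=
  (Matrix.toEuclideanLin (M.sampleA φ x)).toContinuousLinearMap

omit [Countable S] [Countable A] [MeasurableSpace S] [DiscreteMeasurableSpace S]
  [MeasurableSpace A] [DiscreteMeasurableSpace A] in
lemma sampleCLM_apply (x : S × A × S) (v : EuclideanSpace ℝ (Fin d)) :
    M.sampleCLM φ x v = ⟪φ x.1 - M.γ • φ x.2.2, v⟫ • φ x.1 :=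
  M.toEuclideanLin_sampleA x v

omit [Countable S] [Countable A] [MeasurableSpace S] [DiscreteMeasurableSpace S]
  [MeasurableSpace A] [DiscreteMeasurableSpace A] in
lemma norm_sampleCLM_le (hφ : ∀ s, ‖φ s‖ ≤ 1) (x : S × A × S) : ‖M.sampleCLM φ x‖ ≤ 2 := by
  refine ContinuousLinearMap.opNorm_le_bound _ zero_le_two fun v => ?_
  rw [sampleCLM_apply, norm_smul]
  have h1 : ‖φ x.1 - M.γ • φ x.2.2‖ ≤ 2 := by
    refine (norm_sub_le _ _).trans ?_
    rw [norm_smul, Real.norm_of_nonneg M.γ_nonneg]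
    have := mul_le_one₀ M.γ_lt_one.le (norm_nonneg _) (hφ x.2.2)
    linarith [hφ x.1]
  calc _ ≤ ‖φ x.1 - M.γ • φ x.2.2‖ * ‖v‖ * ‖φ x.1‖ := by
        gcongr
        exact norm_inner_le_norm _ _
    _ ≤ 2 * ‖v‖ * 1 := by
        gcongr
        exact hφ _
    _ = _ := mul_one _

lemma integrable_of_abs_le {E : Type*} [MeasurableSpace E] [Countable E]
    [DiscreteMeasurableSpace E] {ν : Measure E} [IsProbabilityMeasure ν] {f : E → ℝ} {C : ℝ}
    (h : ∀ y, |f y| ≤ C) : Integrable f ν :=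
  Integrable.of_bound StronglyMeasurable.of_discrete.aestronglyMeasurable C
    (Filter.Eventually.of_forall h)

omit [Countable S] [MeasurableSpace S] [DiscreteMeasurableSpace S] in
lemma abs_apply_le (hφ : ∀ s, ‖φ s‖ ≤ 1) (s : S) (i : Fin d) : |φ s i| ≤ 1 :=
  (PiLp.norm_apply_le (φ s) i).trans (hφ s)

omit [Countable S] [Countable A] [MeasurableSpace S] [DiscreteMeasurableSpace S]
  [MeasurableSpace A] [DiscreteMeasurableSpace A] in
lemma abs_sampleA_le (hφ : ∀ s, ‖φ s‖ ≤ 1) (x : S × A × S) (i j : Fin d) :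
    |M.sampleA φ x i j| ≤ 2 := by
  simp only [sampleA, Matrix.of_apply]
  rw [abs_mul]
  have h1 := abs_apply_le hφ x.1 i
  have h2 := abs_apply_le hφ x.1 j
  have h3 : |M.γ * φ x.2.2 j| ≤ 1 := by
    rw [abs_mul, abs_of_nonneg M.γ_nonneg]
    exact mul_le_one₀ M.γ_lt_one.le (abs_nonneg _) (abs_apply_le hφ x.2.2 j)
  have h4 := abs_sub (φ x.1 j) (M.γ * φ x.2.2 j)
  calc _ ≤ 1 * 2 := mul_le_mul h1 (by linarith) (abs_nonneg _) zero_le_one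
    _ = _ := one_mul _

lemma integral_sampleCLM (hφ : ∀ s, ‖φ s‖ ≤ 1) (v : EuclideanSpace ℝ (Fin d)) :
    ∫ x, M.sampleCLM φ x v ∂(M.sampleLaw π μ).toMeasure
      = Matrix.toEuclideanLin (M.meanA φ π μ) v := by
  have hint : Integrable (fun x => M.sampleCLM φ x v) (M.sampleLaw π μ).toMeasure :=
    LinearSA.integrable_of_norm_le (C := 2 * ‖v‖) fun x =>
      (M.sampleCLM φ x).le_of_opNorm_le (M.norm_sampleCLM_le hφ x) v
  ext i
  have h1 : ∫ x, M.sampleCLM φ x v i ∂(M.sampleLaw π μ).toMeasure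
      = (∫ x, M.sampleCLM φ x v ∂(M.sampleLaw π μ).toMeasure) i :=
    (EuclideanSpace.proj (𝕜 := ℝ) i).integral_comp_comm hint
  rw [← h1]
  simp only [Matrix.toLpLin_apply, Matrix.mulVec, dotProduct, meanA, Matrix.of_apply,
    sampleCLM, LinearMap.coe_toContinuousLinearMap']
  rw [integral_finsetSum _ fun j _ => (integrable_of_abs_le fun x => M.abs_sampleA_le hφ x i j).mul_const _]
  simp only [integral_mul_const]

/-- With `x = ⟨φ(s), v⟩` and `x' = ⟨φ(s'), v⟩`, the quadratic form is `E[x² - γ x x']`. The bound `x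
x' ≤ (x² + x'²)/2` and stationarity, `E x'² = E x²`, leave `(1 - γ) E x²`. -/
lemma inner_meanA_ge (hμ : M.IsStationary π μ) (hφ : ∀ s, ‖φ s‖ ≤ 1)
    (v : EuclideanSpace ℝ (Fin d)) :
    (1 - M.γ) * ∫ s, ⟪φ s, v⟫ ^ 2 ∂μ.toMeasure
      ≤ ⟪v, Matrix.toEuclideanLin (M.meanA φ π μ) v⟫ := by
  have hint : Integrable (fun x => M.sampleCLM φ x v) (M.sampleLaw π μ).toMeasure :=
    LinearSA.integrable_of_norm_le (C := 2 * ‖v‖) fun x =>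
      (M.sampleCLM φ x).le_of_opNorm_le (M.norm_sampleCLM_le hφ x) v
  rw [← M.integral_sampleCLM hφ, ← _root_.integral_inner hint]
  have hb : ∀ s, |⟪φ s, v⟫ ^ 2| ≤ ‖v‖ ^ 2 := by
    intro s
    rw [abs_pow]
    refine pow_le_pow_left₀ (abs_nonneg _) ((abs_real_inner_le_norm _ _).trans ?_) 2
    exact mul_le_of_le_one_left (norm_nonneg _) (hφ s)
  have i1 : Integrable (fun x : S × A × S => ⟪φ x.1, v⟫ ^ 2) (M.sampleLaw π μ).toMeasure :=
    integrable_of_abs_le fun x => hb x.1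
  have i2 : Integrable (fun x : S × A × S => ⟪φ x.2.2, v⟫ ^ 2) (M.sampleLaw π μ).toMeasure :=
    integrable_of_abs_le fun x => hb x.2.2
  calc _ = ∫ x, ((1 - M.γ / 2) * ⟪φ x.1, v⟫ ^ 2 - M.γ / 2 * ⟪φ x.2.2, v⟫ ^ 2)
        ∂(M.sampleLaw π μ).toMeasure := by
        rw [integral_sub (i1.const_mul _) (i2.const_mul _), integral_const_mul,
          integral_const_mul, M.integral_comp_fst (fun s => ⟪φ s, v⟫ ^ 2),
          M.integral_comp_snd hμ (fun s => ⟪φ s, v⟫ ^ 2)]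
        ring
    _ ≤ _ := by
        refine integral_mono ((i1.const_mul _).sub (i2.const_mul _)) (hint.const_inner v)
          fun x => ?_
        have e : ⟪v, M.sampleCLM φ x v⟫ = (⟪φ x.1, v⟫ - M.γ * ⟪φ x.2.2, v⟫) * ⟪φ x.1, v⟫ := by
          rw [sampleCLM_apply, inner_smul_right, inner_sub_left, real_inner_smul_left,
            real_inner_comm (φ x.1) v]
        rw [e]
        have := mul_nonneg M.γ_nonneg (sq_nonneg (⟪φ x.1, v⟫ - ⟪φ x.2.2, v⟫))
        nlinarith

lemma integral_inner_sq (hφ : ∀ s, ‖φ s‖ ≤ 1) (v : EuclideanSpace ℝ (Fin d)) :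
    ∫ s, ⟪φ s, v⟫ ^ 2 ∂μ.toMeasure = ∑ i, ∑ j, v i * featureCov μ φ i j * v j := by
  have e : ∀ s, ⟪φ s, v⟫ ^ 2 = ∑ i, ∑ j, v i * (φ s i * φ s j) * v j := by
    intro s
    rw [pow_two, PiLp.inner_apply, Finset.sum_mul_sum]
    refine Finset.sum_congr rfl fun i _ => Finset.sum_congr rfl fun j _ => ?_
    simp
    ring
  have hi : ∀ i j, Integrable (fun s => v i * (φ s i * φ s j) * v j) μ.toMeasure := fun i j =>
    ((integrable_of_abs_le (C := 1 * 1) fun s => by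
      rw [abs_mul]
      exact mul_le_mul (abs_apply_le hφ s i) (abs_apply_le hφ s j) (abs_nonneg _)
        zero_le_one).const_mul _).mul_const _
  simp only [e, featureCov, Matrix.of_apply]
  rw [integral_finsetSum _ fun i _ => integrable_finsetSum _ fun j _ => hi i j]
  refine Finset.sum_congr rfl fun i _ => ?_
  rw [integral_finsetSum _ fun j _ => hi i j]
  refine Finset.sum_congr rfl fun j _ => ?_
  rw [integral_mul_const, integral_const_mul]

lemma exists_coercive (hμ : M.IsStationary π μ) (hφ : ∀ s, ‖φ s‖ ≤ 1)
    (hcov : (featureCov μ φ).PosDef) : ∃ β : ℝ, 0 < β ∧ β ≤ 1 ∧ ∀ v : EuclideanSpace ℝ (Fin d),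
      β * ‖v‖ ^ 2 ≤ ⟪v, Matrix.toEuclideanLin (M.meanA φ π μ) v⟫ := by
  obtain ⟨c, hc, h⟩ := hcov.exists_pos_mul_norm_sq_le
  have hγ : 0 < 1 - M.γ := by linarith [M.γ_lt_one]
  refine ⟨min 1 ((1 - M.γ) * c), by positivity, min_le_left _ _, fun v => ?_⟩
  have h1 := h v
  rw [← integral_inner_sq hφ] at h1
  calc _ ≤ (1 - M.γ) * c * ‖v‖ ^ 2 := by
        gcongr
        exact min_le_right _ _
    _ ≤ (1 - M.γ) * ∫ s, ⟪φ s, v⟫ ^ 2 ∂μ.toMeasure := by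
        rw [mul_assoc]
        gcongr
    _ ≤ _ := M.inner_meanA_ge hμ hφ v

omit [Countable S] [Countable A] [DiscreteMeasurableSpace S] [DiscreteMeasurableSpace A] in
lemma isUnit_det_meanA {β : ℝ} (hβ : 0 < β) (h : ∀ v : EuclideanSpace ℝ (Fin d),
      β * ‖v‖ ^ 2 ≤ ⟪v, Matrix.toEuclideanLin (M.meanA φ π μ) v⟫) :
    IsUnit (M.meanA φ π μ).det := by
  rw [isUnit_iff_ne_zero]
  intro h0
  obtain ⟨v, hv, hv0⟩ := Matrix.exists_mulVec_eq_zero_iff.2 h0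
  apply hv
  have h1 := h (WithLp.toLp 2 v)
  rw [Matrix.toLpLin_apply] at h1
  simp only [hv0, WithLp.toLp_zero, inner_zero_right] at h1
  have h2 : ‖WithLp.toLp 2 v‖ ^ 2 = 0 :=
    le_antisymm (by nlinarith [sq_nonneg ‖WithLp.toLp 2 v‖]) (sq_nonneg _)
  have h3 : WithLp.toLp 2 v = 0 := by simpa using h2
  simpa using h3

omit [Countable S] [Countable A] [MeasurableSpace S] [DiscreteMeasurableSpace S]
  [MeasurableSpace A] [DiscreteMeasurableSpace A] in
lemma norm_sampleB_le (hφ : ∀ s, ‖φ s‖ ≤ 1) (x : S × A × S) : ‖M.sampleB φ x‖ ≤ 1 := by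
  rw [sampleB, norm_smul, Real.norm_of_nonneg (M.r_nonneg _ _)]
  exact mul_le_one₀ (M.r_le_one _ _) (norm_nonneg _) (hφ _)

omit [Countable S] [Countable A] [DiscreteMeasurableSpace S] [DiscreteMeasurableSpace A] in
lemma norm_noise_le (hφ : ∀ s, ‖φ s‖ ≤ 1) (x : S × A × S) :
    ‖M.noise φ π μ x‖ ≤ 2 * ‖M.thetaStar φ π μ‖ + 1 :=
  (norm_sub_le _ _).trans (add_le_add
    ((M.sampleCLM φ x).le_of_opNorm_le (M.norm_sampleCLM_le hφ x) _) (M.norm_sampleB_le hφ x))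

/-- Temporal difference learning as a linear stochastic approximation scheme. -/
lemma exists_linearSA (hμ : M.IsStationary π μ) (hφ : ∀ s, ‖φ s‖ ≤ 1)
    (hcov : (featureCov μ φ).PosDef) :
    ∃ P : LinearSA (M.sampleLaw π μ).toMeasure (EuclideanSpace ℝ (Fin d)),
      P.mat = M.sampleCLM φ ∧ P.noise = M.noise φ π μ ∧
      P.inv = (Matrix.toEuclideanLin (M.meanA φ π μ)⁻¹).toContinuousLinearMap := by
  obtain ⟨β, hβ, hβ1, hcoer⟩ := M.exists_coercive hμ hφ hcov
  have hdet := M.isUnit_det_meanA hβ hcoer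
  have hmi : ∀ v : EuclideanSpace ℝ (Fin d), Matrix.toEuclideanLin (M.meanA φ π μ)
      (Matrix.toEuclideanLin (M.meanA φ π μ)⁻¹ v) = v := fun v => by
    simp [Matrix.toLpLin_apply, Matrix.mulVec_mulVec, Matrix.mul_nonsing_inv _ hdet]
  have him : ∀ v : EuclideanSpace ℝ (Fin d), Matrix.toEuclideanLin (M.meanA φ π μ)⁻¹
      (Matrix.toEuclideanLin (M.meanA φ π μ) v) = v := fun v => by
    simp [Matrix.toLpLin_apply, Matrix.mulVec_mulVec, Matrix.nonsing_inv_mul _ hdet]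
  refine ⟨{ mat := M.sampleCLM φ
            noise := M.noise φ π μ
            mean := (Matrix.toEuclideanLin (M.meanA φ π μ)).toContinuousLinearMap
            inv := (Matrix.toEuclideanLin (M.meanA φ π μ)⁻¹).toContinuousLinearMap
            B := 2 * ‖M.thetaStar φ π μ‖ + 1
            β := β
            mat_le := M.norm_sampleCLM_le hφ
            noise_le := M.norm_noise_le hφ
            B_nonneg := by positivity
            β_pos := hβ
            β_le := hβ1
            integral_mat := M.integral_sampleCLM hφ
            integral_noise := ?_
            coercive := hcoer
            inv_mean := him
            mean_inv := hmi }, rfl, rfl, rfl⟩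
  have h1 : Integrable (fun x => M.sampleCLM φ x (M.thetaStar φ π μ))
      (M.sampleLaw π μ).toMeasure :=
    LinearSA.integrable_of_norm_le (C := 2 * ‖M.thetaStar φ π μ‖) fun x =>
      (M.sampleCLM φ x).le_of_opNorm_le (M.norm_sampleCLM_le hφ x) _
  have h2 : Integrable (M.sampleB φ) (M.sampleLaw π μ).toMeasure :=
    LinearSA.integrable_of_norm_le (M.norm_sampleB_le hφ)
  calc ∫ x, M.noise φ π μ x ∂(M.sampleLaw π μ).toMeasure
      = ∫ x, (M.sampleCLM φ x (M.thetaStar φ π μ) - M.sampleB φ x)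
        ∂(M.sampleLaw π μ).toMeasure := rfl
    _ = 0 := by
      rw [integral_sub h1 h2, M.integral_sampleCLM hφ, thetaStar, hmi, meanB, sub_self]

/-- Identifies the abstract variance `LinearSA.avar` with the trace in the theorem. -/
lemma trace_asympCov (hφ : ∀ s, ‖φ s‖ ≤ 1) :
    (M.asympCov φ π μ).trace = ∫ x, ‖Matrix.toEuclideanLin (M.meanA φ π μ)⁻¹ (M.noise φ π μ x)‖ ^ 2
      ∂(M.sampleLaw π μ).toMeasure := by
  set N := (M.meanA φ π μ)⁻¹ with hN
  set ξ := M.noise φ π μ with hξ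
  set C := 2 * ‖M.thetaStar φ π μ‖ + 1
  have hb : ∀ x i, |ξ x i| ≤ C := fun x i =>
    (PiLp.norm_apply_le (ξ x) i).trans (M.norm_noise_le hφ x)
  have hi : ∀ i j k, Integrable (fun x => N i j * (ξ x j * ξ x k) * N i k)
      (M.sampleLaw π μ).toMeasure := fun i j k =>
    ((integrable_of_abs_le (C := C * C) fun x => by
      rw [abs_mul]
      exact mul_le_mul (hb x j) (hb x k) (abs_nonneg _)
        ((abs_nonneg _).trans (hb x j))).const_mul _).mul_const _
  have e : ∀ x, ‖Matrix.toEuclideanLin N (ξ x)‖ ^ 2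
      = ∑ i, ∑ k, ∑ j, N i j * (ξ x j * ξ x k) * N i k := by
    intro x
    rw [EuclideanSpace.norm_sq_eq]
    refine Finset.sum_congr rfl fun i _ => ?_
    simp only [Matrix.toLpLin_apply, Matrix.mulVec, dotProduct, Real.norm_eq_abs, sq_abs]
    rw [pow_two, Finset.sum_mul_sum, Finset.sum_comm]
    exact Finset.sum_congr rfl fun k _ => Finset.sum_congr rfl fun j _ => by ring
  simp only [e]
  rw [integral_finsetSum _ fun i _ => integrable_finsetSum _ fun k _ =>
    integrable_finsetSum _ fun j _ => hi i j k]
  simp only [asympCov, Matrix.trace, Matrix.diag, Matrix.mul_apply, Matrix.transpose_apply,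
    noiseCov, Matrix.of_apply]
  refine Finset.sum_congr rfl fun i _ => ?_
  rw [integral_finsetSum _ fun k _ => integrable_finsetSum _ fun j _ => hi i j k]
  refine Finset.sum_congr rfl fun k _ => ?_
  rw [integral_finsetSum _ fun j _ => hi i j k, Finset.sum_mul]
  refine Finset.sum_congr rfl fun j _ => ?_
  rw [integral_mul_const, integral_const_mul]

omit [Countable S] [Countable A] [DiscreteMeasurableSpace S] [DiscreteMeasurableSpace A] in
lemma tdIterate_sub_thetaStar (η : ℕ → ℝ) (θ₀ : EuclideanSpace ℝ (Fin d)) (x : ℕ → S × A × S)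
    (t : ℕ) : M.tdIterate φ η θ₀ x t - M.thetaStar φ π μ
      = errIterate (M.sampleCLM φ) (M.noise φ π μ) η (θ₀ - M.thetaStar φ π μ) t x := by
  induction t with
  | zero => rfl
  | succ t ih =>
    simp only [errIterate, ← ih, tdIterate, noise, sampleCLM,
      LinearMap.coe_toContinuousLinearMap', map_sub]
    module

end MDP

/-! ### The main theorem. -/

theorem theorem1 :
    -- the constant of the leading term is absolute
    ∃ C : ℝ, 0 < C ∧
    ∀ (S A : Type*) [Countable S] [Countable A]
      [MeasurableSpace S] [DiscreteMeasurableSpace S]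
      [MeasurableSpace A] [DiscreteMeasurableSpace A]
      (M : MDP S A) (π : S → PMF A) (μ : PMF S) (d : ℕ)
      (φ : S → EuclideanSpace ℝ (Fin d)) (θ₀ : EuclideanSpace ℝ (Fin d)) (α : ℝ),
      M.IsStationary π μ →
      (∀ s, ‖φ s‖ ≤ 1) →
      (MDP.featureCov μ φ).PosDef →
      1 / 2 < α → α < 1 →
      -- `c` and `K` depend on the problem and on `α`, but not on `δ`, `η₀`, `T`
      ∃ c K : ℝ, 0 < c ∧ 0 < K ∧
        (∀ δ : ℝ, 0 < δ → δ < 1 →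
          ∃ η₀ : ℝ, 0 < η₀ ∧ η₀ < 1 / 2 ∧ η₀ * √(Real.log (1 / (δ * η₀))) ≤ c) ∧
        ∀ δ η₀ : ℝ, 0 < δ → δ < 1 → 0 < η₀ → η₀ < 1 / 2 →
          η₀ * √(Real.log (1 / (δ * η₀))) ≤ c →
          ∀ (Ω : Type*) [MeasurableSpace Ω] (Pr : Measure Ω) [IsProbabilityMeasure Pr]
            (X : ℕ → Ω → S × A × S),
            (∀ t, Measurable (X t)) →
            iIndepFun X Pr →
            (∀ t, Pr.map (X t) = (M.sampleLaw π μ).toMeasure) →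
            ∀ T : ℕ, 1 ≤ T →
              ENNReal.ofReal (1 - δ) ≤
                Pr {ω | ‖M.tdAverage φ (fun t => η₀ * (t : ℝ) ^ (-α)) θ₀ (fun t => X t ω) T
                      - M.thetaStar φ π μ‖
                    ≤ C * √((M.asympCov φ π μ).trace / T * Real.log (Real.exp 1 / δ))
                      + K * η₀ ^ (-(1 / (1 - α))) * (T : ℝ) ^ (-((α + 1) / 2))
                        * Real.log (Real.exp 1 * T / δ)} := by
  -- The constant is `8` from Bernstein for the noise sum plus `1` from the absorbed boundary term.
  refine ⟨9, by norm_num, fun S A _ _ _ _ _ _ M π μ d φ θ₀ α hμ hφ hcov hα hα1 => ?_⟩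
  obtain ⟨P, hmat, hnoise, hinv⟩ := M.exists_linearSA hμ hφ hcov
  obtain ⟨K, hK, h⟩ := P.exists_measure_average_err_le hα hα1 (θ₀ - M.thetaStar φ π μ)
  refine ⟨1, K, one_pos, hK, fun δ hδ hδ1 => ?_, fun δ η₀ hδ hδ1 hη hη1 hs Ω _ Pr _ X hX hind hlaw
    T hT => ?_⟩
  -- The threshold `c = 1` is met by `η₀ = δ/4`: the logarithm is at most its argument `(2/δ)²`, so
  -- the product is at most `1/2`.
  · refine ⟨δ / 4, by positivity, by linarith, ?_⟩
    have h1 : Real.log (1 / (δ * (δ / 4))) ≤ (2 / δ) ^ 2 := by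
      refine (Real.log_le_self (by positivity)).trans (le_of_eq ?_)
      field_simp
      norm_num
    calc δ / 4 * √(Real.log (1 / (δ * (δ / 4)))) ≤ δ / 4 * (2 / δ) := by
          gcongr
          rw [← Real.sqrt_sq (by positivity : 0 ≤ 2 / δ)]
          exact Real.sqrt_le_sqrt h1
      _ = 1 / 2 := by field_simp; norm_num
      _ ≤ 1 := by norm_num
  · have hT0 : (T : ℝ) ≠ 0 := by exact_mod_cast (by omega : T ≠ 0)
    have htr : P.avar = (M.asympCov φ π μ).trace := by
      rw [M.trace_asympCov hφ, LinearSA.avar, hinv, hnoise]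
      rfl
    have havg : ∀ ω, M.tdAverage φ (polyStep η₀ α) θ₀ (fun t => X t ω) T - M.thetaStar φ π μ
        = (1 / (T : ℝ)) • ∑ t ∈ Finset.Icc 1 T,
          P.err (polyStep η₀ α) (θ₀ - M.thetaStar φ π μ) t fun i => X i ω := by
      intro ω
      have e : ∀ t, P.err (polyStep η₀ α) (θ₀ - M.thetaStar φ π μ) t (fun i => X i ω)
          = M.tdIterate φ (polyStep η₀ α) θ₀ (fun i => X i ω) t - M.thetaStar φ π μ := by
        intro t
        rw [M.tdIterate_sub_thetaStar, LinearSA.err, hmat, hnoise]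
      simp only [e, Finset.sum_sub_distrib, Finset.sum_const, Nat.card_Icc, Nat.add_sub_cancel,
        smul_sub, MDP.tdAverage]
      congr 1
      rw [← Nat.cast_smul_eq_nsmul ℝ, smul_smul, one_div_mul_cancel hT0, one_smul]
    have h1 := h δ η₀ hδ hδ1 hη hη1 hs Ω Pr X hX hind hlaw T hT
    simp only [← havg, htr] at h1
    exact h1
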